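/- **Graphs.** Let $G$ be a finite connected orientable Feynman graph with quartic vertices of type $\bar\phi\star\phi\star\bar\phi\star\phi$: vertex set $V$, internal lines $\ell\in\{1,\dots,L\}$; the four corners of a vertex $w$, at positions $x_{w,1},\dots,x_{w,4}\in\mathbb R^4$, carry in cyclic order the fields $\bar\phi,\phi,\bar\phi,\phi$; each internal line joins a $\bar\phi$-corner (position $x$) to a $\phi$-corner (position $y$); each corner is on at most one line, and the remaining corners are the external legs, at positions $x_e$. Fix a root vertex $r\in V$ and $\theta>0$, $\Omega>0$, and put $\tilde\Omega=2\Omega/\theta$, $x\wedge y=x_1y_2-x_2y_1+x_3y_4-x_4y_3$. For a line put $u_\ell=(x-y)/\sqrt2$, $v_\ell=(x+y)/\sqrt2$; let $p_w$ be the hypermomentum of the vertex $w$ ($\delta(z)\propto\int e^{i\tilde\Omega\,p\wedge z}\,dp$). The internal variables are the $u_\ell$, the $v_\ell$ and the $p_w$ with $w\ne r$; the external variables are the $x_e$ and $p_r$. **Polynomials.** Let $B$ be the real antisymmetric matrix with $$\tfrac12\sum_{a,b}B_{ab}\,\xi_a\wedge\xi_b=\frac1\Omega\sum_w\sum_{i<j}(-1)^{i+j}x_{w,i}\wedge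 x_{w,j}+\sum_w p_w\wedge\sum_i(-1)^{i+1}x_{w,i}\;\Big(+\sum_\ell u_\ell\wedge v_\ell\ \text{ for LSZ}\Big),$$ where $\xi$ runs over all variables, with blocks $B_{ii}$ (internal–internal), $W$ (external–internal), $B_{ee}$ (external–external). Let $A$ be the diagonal matrix on the internal variables with entries $1/t_\ell$ at $u_\ell$, $t_\ell$ at $v_\ell$, $0$ at $p_w$ (Grosse–Wulkenhaar model), respectively $(1+t_\ell^2)/(2t_\ell)$ at $u_\ell$, $0$ at $v_\ell$ and at $p_w$ (LSZ model; here assume also $\Omega\neq1$). Thus the product of the propagators and vertex factors is, up to prefactors, $\exp\big(-\frac{\tilde\Omega}2(\sum_a A_{aa}\xi_a^2-i\sum_{a,b} B_{ab}\,\xi_a\wedge\xi_b)\big)$, and Gaussian integration over the internal variables gives the polynomials in $t=(t_1,\dots,t_L)$ $$HU=\Big(\prod_\ell t_\ell\Big)\det(A+B_{ii}),\qquad E=\tfrac{\tilde\Omega}2\,HU\,\big(W(A+B_{ii})^{-1}W^{T}+B_{ee}\big),$$ $$HV=HV^{\mathcal R}+i\,HV^{\mathcal I},\qquad HV^{\mathcal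 R}=\sum_{e,e'}\tfrac12(E+E^T)_{ee'}\,x_e\cdot x_{e'},\qquad HV^{\mathcal I}=\sum_{e,e'}\tfrac12(E^T-E)_{ee'}\,x_e\wedge x_{e'}$$ ($e,e'$ run over all external variables). Collecting monomials, write $$HU=\sum_{K_U}a_{K_U}\prod_\ell t_\ell^{u_{\ell K_U}},\quad HV^{\mathcal R}=\sum_{K_V}s^{\mathcal R}_{K_V}\prod_\ell t_\ell^{v^{\mathcal R}_{\ell K_V}},\quad HV^{\mathcal I}=\sum_{K_V}s^{\mathcal I}_{K_V}\prod_\ell t_\ell^{v^{\mathcal I}_{\ell K_V}},$$ where each sum is over the monomials that occur (for some external configuration); the $s^{\mathcal R}_{K_V},s^{\mathcal I}_{K_V}$ are the external invariants. **Amplitude.** For a constant $K\in\mathbb C$ and complex $D$, $$\mathcal A_G(D)=K\int_{(0,1)^L}\prod_{\ell}dt_\ell\,(1-t_\ell^2)^{\frac D2-1}\;HU(t)^{-\frac D2}\,e^{-HV(t)/HU(t)} ,$$ regarded as a function of the external variables, or as a function of independent external invariants $s^{\mathcal R}_{K_V}>0$, $s^{\mathcal I}_{K_V}\in\mathbb R$.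 **Theorem.** (i) For each value of the external variables the integral converges absolutely and is analytic in $D$ in the strip $0<\Re D<2$, and it is the value of the amplitude at the corresponding external invariants. (ii) For $0<\Re D<2$ the amplitude is a tempered distribution of the external invariants, $T_D(f)=\int f(s)\,\mathcal A_G(D;s)\,ds$ (integral over $s^{\mathcal R}_{K_V}>0$, $s^{\mathcal I}_{K_V}\in\mathbb R$, absolutely convergent), and $D\mapsto T_D(f)$ is analytic in this strip for every Schwartz function $f$. (iii) Let $0<\Re D<2$, let $\phi_\ell=\sum_{K_U}u_{\ell K_U}x_{K_U}+\sum_{K_V}(v^{\mathcal R}_{\ell K_V}y^{\mathcal R}_{K_V}+v^{\mathcal I}_{\ell K_V}y^{\mathcal I}_{K_V})+1$, and let $\Delta$ be the set of all real $(\sigma,\tau^{\mathcal R},\tau^{\mathcal I})$ with $\sigma_{K_U}<0$, $\tau^{\mathcal R}_{K_V}<0$, $-1<\tau^{\mathcal I}_{K_V}<0$, $\sum\sigma_{K_U}+\sum\tau^{\mathcal R}_{K_V}+\sum\tau^{\mathcal I}_{K_V}=-\frac{\Re D}2$ and, for all $\ell$, $\sum_{K_U}u_{\ell K_U}\sigma_{K_U}+\sum_{K_V}(v^{\mathcal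 R}_{\ell K_V}\tau^{\mathcal R}_{K_V}+v^{\mathcal I}_{\ell K_V}\tau^{\mathcal I}_{K_V})+1>0$. Then $\Delta$ is convex and non-empty, and for every point of $\Delta$, in the sense of tempered distributions of the external invariants, $$\mathcal A_G=K\int\frac{\prod_{K_U}a_{K_U}^{x_{K_U}}\Gamma(-x_{K_U})}{\Gamma(-\sum_{K_U}x_{K_U})}\prod_{K_V}(s^{\mathcal R}_{K_V})^{y^{\mathcal R}_{K_V}}\Gamma(-y^{\mathcal R}_{K_V})\prod_{K_V}(i\,s^{\mathcal I}_{K_V})^{y^{\mathcal I}_{K_V}}\Gamma(-y^{\mathcal I}_{K_V})\prod_{\ell=1}^L\frac{\Gamma(\frac{\phi_\ell}2)\Gamma(\frac D2)}{2\,\Gamma(\frac{\phi_\ell+D}2)} ,$$ where the real parts of $x,y^{\mathcal R},y^{\mathcal I}$ are fixed at the point $(\sigma,\tau^{\mathcal R},\tau^{\mathcal I})$ of $\Delta$, the variables are subject to $\sum x_{K_U}+\sum(y^{\mathcal R}_{K_V}+y^{\mathcal I}_{K_V})=-\frac D2$, which eliminates one (any) of the $x_{K_U}$, and the integration is over the imaginary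 parts of the remaining variables, each with $\frac{d\,\Im}{2\pi}$; powers of $i s^{\mathcal I}$ are on the principal branch. That is: smeared against any Schwartz function $f(s)$ under the integral sign, the smearing integrals and then the integral over the imaginary parts converge absolutely, and the latter, multiplied by $K$, equals $T_D(f)$. -/

import Mathlib

open scoped SchwartzMap

noncomputable section

namespace NCQFT

/-- The two models: Grosse-Wulkenhaar and Langmann-Szabo-Zarembo. -/
inductive Model where
  | grosseWulkenhaar
  | lsz

/-- An orientable Feynman graph of the interaction `φ̄ ⋆ φ ⋆ φ̄ ⋆ φ`, with vertices `V` and internal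
lines `L`.  The corners `(w, 0), (w, 1), (w, 2), (w, 3)` of a vertex `w` carry, in this cyclic order,
the fields `φ̄, φ, φ̄, φ` at the positions `x₁, x₂, x₃, x₄`.  Every internal line joins a `φ̄`-corner
`src` to a `φ`-corner `tgt`, and every corner belongs to at most one line. -/
structure FeynmanGraph (V L : Type*) where
  src : L → V × Fin 4
  tgt : L → V × Fin 4
  src_injective : Function.Injective src
  tgt_injective : Function.Injective tgt
  src_even : ∀ l, Even ((src l).2 : ℕ)
  tgt_odd : ∀ l, Odd ((tgt l).2 : ℕ)

/-- The monomials of the polynomials `HU`, `HV^R` and `HV^I` in the variables `t_l`, `l : L`: the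
coefficients `a` of `HU` and the exponents `u`, `vR`, `vI` of the three polynomials. -/
structure MonomialData (L KU KR KI : Type*) where
  a : KU → ℝ
  u : KU → L → ℕ
  vR : KR → L → ℕ
  vI : KI → L → ℕ

namespace FeynmanGraph

variable {V L : Type*}

/-- The graph is connected: any two vertices are joined by a chain of internal lines. -/
def Connected (G : FeynmanGraph V L) : Prop :=
  ∀ w w' : V, Relation.EqvGen (fun a b => ∃ l, (G.src l).1 = a ∧ (G.tgt l).1 = b) w w'

/-- The external legs: the corners that are not joined to an internal line. -/
abbrev Ext (G : FeynmanGraph V L) : Type _ :=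
  {c : V × Fin 4 // ∀ l, G.src l ≠ c ∧ G.tgt l ≠ c}

/-- The integrated variables: the short variables `u_l`, the long variables `v_l`, and the
hypermomenta `p_w` of the vertices `w` other than the root `r`. -/
abbrev IntVar (_G : FeynmanGraph V L) (r : V) : Type _ := L ⊕ L ⊕ {w : V // w ≠ r}

/-- The external variables: the external positions `x_e` and the hypermomentum of the root. -/
abbrev ExtVar (G : FeynmanGraph V L) : Type _ := G.Ext ⊕ Unit

abbrev Var (G : FeynmanGraph V L) (r : V) : Type _ := G.IntVar r ⊕ G.ExtVar

variable [Fintype V] [DecidableEq V] [Fintype L] [DecidableEq L]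

/-- The position of a corner as a linear combination of the variables: at the two ends `x` (`src`)
and `y` (`tgt`) of a line, `x = (v + u) / √2` and `y = (v - u) / √2`, that is
`u = (x - y) / √2` and `v = (x + y) / √2`; at an external corner the position is `x_e`. -/
def position (G : FeynmanGraph V L) (r : V) (c : V × Fin 4) : G.Var r → ℝ
  | .inl (.inl l) => if G.src l = c then 1 / √2 else if G.tgt l = c then -(1 / √2) else 0
  | .inl (.inr (.inl l)) => if G.src l = c ∨ G.tgt l = c then 1 / √2 else 0
  | .inl (.inr (.inr _)) => 0
  | .inr (.inl e) => if (e : V × Fin 4) = c then 1 else 0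
  | .inr (.inr _) => 0

/-- The hypermomentum of the vertex `w` as a linear combination of the variables. -/
def hypermomentum (G : FeynmanGraph V L) (r : V) (w : V) : G.Var r → ℝ
  | .inl (.inl _) => 0
  | .inl (.inr (.inl _)) => 0
  | .inl (.inr (.inr w')) => if (w' : V) = w then 1 else 0
  | .inr (.inl _) => 0
  | .inr (.inr _) => if r = w then 1 else 0

/-- In the LSZ propagator, the phase `u_l ∧ v_l` of each line; nothing in the Grosse-Wulkenhaar
propagator. -/
def propagatorPhase (G : FeynmanGraph V L) (r : V) : Model → G.Var r → G.Var r → ℝ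
  | .lsz, .inl (.inl l), .inl (.inr (.inl l')) => if l = l' then 1 else 0
  | _, _, _ => 0

/-- Put `Ω̃ = 2 Ω / θ`, `ε_i = 1, -1, 1, -1` for the four corners of a vertex, and write each vertex
distribution as `δ(z) = const * ∫ exp (i Ω̃ (p ∧ z)) dp`, with `z = ∑ i, ε_i x_i`.  Since
`x Θ⁻¹ y = - (x ∧ y) / θ`, the total phase of the vertices and of the propagators is `Ω̃` times

`Ω⁻¹ ∑_w ∑_{i < j} ε_i ε_j (x_{w,i} ∧ x_{w,j}) + ∑_w p_w ∧ ∑_i ε_i x_{w,i} (+ ∑_l u_l ∧ v_l)`,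

and `phaseCoeff` is the array of the coefficients `c a b` in `∑ a b, c a b (ξ_a ∧ ξ_b)`. -/
def phaseCoeff (G : FeynmanGraph V L) (m : Model) (Ω : ℝ) (r : V) (a b : G.Var r) : ℝ :=
  Ω⁻¹ * ∑ w : V, ∑ i : Fin 4, ∑ j : Fin 4,
      (if i < j then
        (-1 : ℝ) ^ ((i : ℕ) + (j : ℕ)) * G.position r (w, i) a * G.position r (w, j) b else 0)
    + ∑ w : V, ∑ i : Fin 4, (-1 : ℝ) ^ (i : ℕ) * G.hypermomentum r w a * G.position r (w, i) b
    + G.propagatorPhase r m a b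

/-- The antisymmetric matrix `B` of the phase: the phase is `(Ω̃ / 2) ∑ a b, B a b (ξ_a ∧ ξ_b)`. -/
def phaseMatrix (G : FeynmanGraph V L) (m : Model) (Ω : ℝ) (r : V) :
    Matrix (G.Var r) (G.Var r) ℝ :=
  Matrix.of fun a b => G.phaseCoeff m Ω r a b - G.phaseCoeff m Ω r b a

/-- Multiplying the row of each `u_l` by `t_l` clears the denominators `1 / t_l`. -/
def rowScale (G : FeynmanGraph V L) (r : V) : G.IntVar r → MvPolynomial L ℝ
  | .inl l => MvPolynomial.X l
  | .inr _ => 1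

/-- The absolute values of the propagators are `exp (- (Ω̃ / 2) ∑ a, A a ξ_a ^ 2)`, where
`A u_l = 1 / t_l`, `A v_l = t_l`, `A p_w = 0` in the Grosse-Wulkenhaar model and
`A u_l = (1 + t_l ^ 2) / (2 t_l)`, `A v_l = 0`, `A p_w = 0` in the LSZ model.
This is `A a`, times `t_l` in the rows `a = u_l`. -/
def scaledDiag (G : FeynmanGraph V L) (r : V) : Model → G.IntVar r → MvPolynomial L ℝ
  | .grosseWulkenhaar, .inl _ => 1
  | .grosseWulkenhaar, .inr (.inl l) => MvPolynomial.X l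
  | .lsz, .inl l => MvPolynomial.C (1 / 2) * (1 + MvPolynomial.X l ^ 2)
  | .lsz, .inr (.inl _) => 0
  | _, .inr (.inr _) => 0

/-- The matrix `A + B` on the integrated variables, with the rows of the `u_l` multiplied
by `t_l`. -/
def scaledMatrix (G : FeynmanGraph V L) (m : Model) (Ω : ℝ) (r : V) :
    Matrix (G.IntVar r) (G.IntVar r) (MvPolynomial L ℝ) :=
  Matrix.diagonal (G.scaledDiag r m) +
    Matrix.of fun a b =>
      G.rowScale r a * MvPolynomial.C (G.phaseMatrix m Ω r (Sum.inl a) (Sum.inl b))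

/-- The first polynomial `HU = (∏ l, t_l) * det (A + B)`. -/
def HU (G : FeynmanGraph V L) (m : Model) (Ω : ℝ) (r : V) : MvPolynomial L ℝ :=
  (G.scaledMatrix m Ω r).det

/-- The polynomial matrix `HU * (A + B)⁻¹`. -/
def HUinverse (G : FeynmanGraph V L) (m : Model) (Ω : ℝ) (r : V) :
    Matrix (G.IntVar r) (G.IntVar r) (MvPolynomial L ℝ) :=
  (G.scaledMatrix m Ω r).adjugate * Matrix.diagonal (G.rowScale r)

/-- The matrix `(Ω̃ / 2) * HU * (W (A + B)⁻¹ Wᵀ + B')`, where `W` is the block of the phase matrix that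
couples external to integrated variables and `B'` is its external block. -/
def schurMatrix (G : FeynmanGraph V L) (m : Model) (Ω θ : ℝ) (r : V) :
    Matrix G.ExtVar G.ExtVar (MvPolynomial L ℝ) :=
  Matrix.of fun e e' => MvPolynomial.C (Ω / θ) *
    ((∑ a, ∑ b, MvPolynomial.C (G.phaseMatrix m Ω r (Sum.inr e) (Sum.inl a)) *
        G.HUinverse m Ω r a b * MvPolynomial.C (G.phaseMatrix m Ω r (Sum.inr e') (Sum.inl b)))
      + G.HU m Ω r * MvPolynomial.C (G.phaseMatrix m Ω r (Sum.inr e) (Sum.inr e')))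

/-- Gaussian integration over the variables `u_l`, `v_l`, `p_w` (`w ≠ r`) turns the exponent
`- (Ω̃ / 2) (∑ a, A a ξ_a ^ 2 - i ∑ a b, B a b (ξ_a ∧ ξ_b))` into `- HV / HU`, where
`HV = ∑ e e', HVR e e' (x_e · x_e') + i ∑ e e', HVI e e' (x_e ∧ x_e')`.  The real part `HVR` is the
symmetric part of `schurMatrix`. -/
def HVR (G : FeynmanGraph V L) (m : Model) (Ω θ : ℝ) (r : V) :
    Matrix G.ExtVar G.ExtVar (MvPolynomial L ℝ) :=
  Matrix.of fun e e' => MvPolynomial.C (1 / 2) *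
    (G.schurMatrix m Ω θ r e e' + G.schurMatrix m Ω θ r e' e)

/-- The imaginary part of `HV`: minus the antisymmetric part of `schurMatrix`. -/
def HVI (G : FeynmanGraph V L) (m : Model) (Ω θ : ℝ) (r : V) :
    Matrix G.ExtVar G.ExtVar (MvPolynomial L ℝ) :=
  Matrix.of fun e e' => MvPolynomial.C (1 / 2) *
    (G.schurMatrix m Ω θ r e' e - G.schurMatrix m Ω θ r e e')

/-- The monomials of `HU`. -/
abbrev KU (G : FeynmanGraph V L) (m : Model) (Ω : ℝ) (r : V) : Type _ :=
  {k : L →₀ ℕ // k ∈ (G.HU m Ω r).support}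

open Classical in
/-- The monomials of `HV^R`. -/
abbrev KR (G : FeynmanGraph V L) (m : Model) (Ω θ : ℝ) (r : V) : Type _ :=
  {k : L →₀ ℕ // k ∈ Finset.univ.biUnion fun e : G.ExtVar × G.ExtVar =>
    (G.HVR m Ω θ r e.1 e.2).support}

open Classical in
/-- The monomials of `HV^I`. -/
abbrev KI (G : FeynmanGraph V L) (m : Model) (Ω θ : ℝ) (r : V) : Type _ :=
  {k : L →₀ ℕ // k ∈ Finset.univ.biUnion fun e : G.ExtVar × G.ExtVar =>
    (G.HVI m Ω θ r e.1 e.2).support}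

/-- The coefficients of `HU` and the exponents of `HU`, `HV^R`, `HV^I`. -/
def monomialData (G : FeynmanGraph V L) (m : Model) (Ω θ : ℝ) (r : V) :
    MonomialData L (G.KU m Ω r) (G.KR m Ω θ r) (G.KI m Ω θ r) where
  a k := (G.HU m Ω r).coeff k
  u k l := (k : L →₀ ℕ) l
  vR k l := (k : L →₀ ℕ) l
  vI k l := (k : L →₀ ℕ) l

/-- `x · y` in `ℝ⁴`. -/
def dot (x y : Fin 4 → ℝ) : ℝ := ∑ μ, x μ * y μ

/-- `x ∧ y = x₁ y₂ - x₂ y₁ + x₃ y₄ - x₄ y₃` in `ℝ⁴`. -/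
def wedge (x y : Fin 4 → ℝ) : ℝ := x 0 * y 1 - x 1 * y 0 + x 2 * y 3 - x 3 * y 2

/-- The external invariant `s^R_k` of an external configuration: the coefficient of the monomial `k`
in `HV^R`. -/
def invariantR (G : FeynmanGraph V L) (m : Model) (Ω θ : ℝ) (r : V)
    (x : G.ExtVar → Fin 4 → ℝ) (k : G.KR m Ω θ r) : ℝ :=
  ∑ e, ∑ e', (G.HVR m Ω θ r e e').coeff k * dot (x e) (x e')

/-- The external invariant `s^I_k` of an external configuration: the coefficient of the monomial `k`
in `HV^I`. -/
def invariantI (G : FeynmanGraph V L) (m : Model) (Ω θ : ℝ) (r : V)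
    (x : G.ExtVar → Fin 4 → ℝ) (k : G.KI m Ω θ r) : ℝ :=
  ∑ e, ∑ e', (G.HVI m Ω θ r e e').coeff k * wedge (x e) (x e')

/-- `HV(t)` at an external configuration. -/
def HV (G : FeynmanGraph V L) (m : Model) (Ω θ : ℝ) (r : V)
    (x : G.ExtVar → Fin 4 → ℝ) (t : L → ℝ) : ℂ :=
  ((∑ e, ∑ e', MvPolynomial.eval t (G.HVR m Ω θ r e e') * dot (x e) (x e') : ℝ) : ℂ) +
    Complex.I * ((∑ e, ∑ e', MvPolynomial.eval t (G.HVI m Ω θ r e e') * wedge (x e) (x e') : ℝ) : ℂ)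

/-- `∏ l, (1 - t_l ^ 2) ^ (D / 2 - 1) * HU(t) ^ (- D / 2) * exp (- HV(t) / HU(t))`, at an external
configuration `x`. -/
def parametricIntegrand (G : FeynmanGraph V L) (m : Model) (Ω θ : ℝ) (r : V) (D : ℂ)
    (x : G.ExtVar → Fin 4 → ℝ) (t : L → ℝ) : ℂ :=
  (∏ l, ((1 - t l ^ 2 : ℝ) : ℂ) ^ (D / 2 - 1)) *
    ((MvPolynomial.eval t (G.HU m Ω r) : ℝ) : ℂ) ^ (-D / 2) *
    Complex.exp (-(G.HV m Ω θ r x t) / ((MvPolynomial.eval t (G.HU m Ω r) : ℝ) : ℂ))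

/-- The Feynman amplitude at an external configuration, in dimension `D`, with prefactor `K`. -/
def amplitude (G : FeynmanGraph V L) (m : Model) (Ω θ : ℝ) (r : V) (K D : ℂ)
    (x : G.ExtVar → Fin 4 → ℝ) : ℂ :=
  K * ∫ t in Set.univ.pi fun _ : L => Set.Ioo (0 : ℝ) 1, G.parametricIntegrand m Ω θ r D x t

end FeynmanGraph

namespace MonomialData

variable {L KU KR KI : Type*} [Fintype L] [Fintype KU] [Fintype KR] [Fintype KI]

/-- `HU(t) = ∑ k, a_k ∏ l, t_l ^ u_{l k}`. -/
def U (M : MonomialData L KU KR KI) (t : L → ℝ) : ℝ := ∑ k, M.a k * ∏ l, t l ^ M.u k l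

/-- `HV(t) = ∑ k, s^R_k ∏ l, t_l ^ v^R_{l k} + i ∑ k, s^I_k ∏ l, t_l ^ v^I_{l k}` as a function of the
external invariants `s = (s^R, s^I)`. -/
def V (M : MonomialData L KU KR KI) (s : (KR → ℝ) × (KI → ℝ)) (t : L → ℝ) : ℂ :=
  ((∑ k, s.1 k * ∏ l, t l ^ M.vR k l : ℝ) : ℂ) +
    Complex.I * ((∑ k, s.2 k * ∏ l, t l ^ M.vI k l : ℝ) : ℂ)

/-- The amplitude as a function of the external invariants. -/
def amplitude (M : MonomialData L KU KR KI) (K D : ℂ) (s : (KR → ℝ) × (KI → ℝ)) : ℂ :=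
  K * ∫ t in Set.univ.pi fun _ : L => Set.Ioo (0 : ℝ) 1,
    (∏ l, ((1 - t l ^ 2 : ℝ) : ℂ) ^ (D / 2 - 1)) * ((M.U t : ℝ) : ℂ) ^ (-D / 2) *
      Complex.exp (-(M.V s t) / ((M.U t : ℝ) : ℂ))

/-- The range of the external invariants: `s^R_k > 0` and `s^I_k` real. -/
def invariantDomain (_M : MonomialData L KU KR KI) : Set ((KR → ℝ) × (KI → ℝ)) :=
  {s | ∀ k, 0 < s.1 k}

/-- `φ_l = ∑ k, u_{l k} x_k + ∑ k, v^R_{l k} y^R_k + ∑ k, v^I_{l k} y^I_k + 1`. -/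
def phi (M : MonomialData L KU KR KI) (x : KU → ℂ) (yR : KR → ℂ) (yI : KI → ℂ) (l : L) : ℂ :=
  ∑ k, (M.u k l : ℂ) * x k + (∑ k, (M.vR k l : ℂ) * yR k + ∑ k, (M.vI k l : ℂ) * yI k) + 1

/-- The domain `Δ` of the real parts `(σ, τ^R, τ^I)`. -/
def Delta (M : MonomialData L KU KR KI) (D : ℂ) : Set ((KU → ℝ) × (KR → ℝ) × (KI → ℝ)) :=
  {q | (∀ k, q.1 k < 0) ∧ (∀ k, q.2.1 k < 0) ∧ (∀ k, -1 < q.2.2 k ∧ q.2.2 k < 0) ∧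
    ∑ k, q.1 k + (∑ k, q.2.1 k + ∑ k, q.2.2 k) = -(D.re / 2) ∧
    ∀ l, 0 < ∑ k, (M.u k l : ℝ) * q.1 k +
      (∑ k, (M.vR k l : ℝ) * q.2.1 k + ∑ k, (M.vI k l : ℝ) * q.2.2 k) + 1}

/-- `f(s) * ∏ k, (s^R_k) ^ (y^R_k) * ∏ k, (i s^I_k) ^ (y^I_k)`; the power of the imaginary number
`i s^I_k` is that of the principal branch. -/
def smearedPower (_M : MonomialData L KU KR KI) (f : 𝓢((KR → ℝ) × (KI → ℝ), ℂ))
    (yR : KR → ℂ) (yI : KI → ℂ) (s : (KR → ℝ) × (KI → ℝ)) : ℂ :=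
  f s * (∏ k, ((s.1 k : ℝ) : ℂ) ^ yR k) * ∏ k, (Complex.I * ((s.2 k : ℝ) : ℂ)) ^ yI k

/-- The integrand of the Mellin representation, smeared in the external invariants against `f`. -/
def mellinIntegrand (M : MonomialData L KU KR KI) (D : ℂ) (f : 𝓢((KR → ℝ) × (KI → ℝ), ℂ))
    (x : KU → ℂ) (yR : KR → ℂ) (yI : KI → ℂ) : ℂ :=
  (∏ k, ((M.a k : ℝ) : ℂ) ^ x k * Complex.Gamma (-x k)) / Complex.Gamma (-∑ k, x k) *
    ((∏ k, Complex.Gamma (-yR k)) * (∏ k, Complex.Gamma (-yI k)) *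
      ∫ s in M.invariantDomain, M.smearedPower f yR yI s) *
    ∏ l, Complex.Gamma (M.phi x yR yI l / 2) * Complex.Gamma (D / 2) /
      (2 * Complex.Gamma ((M.phi x yR yI l + D) / 2))

/-- The complex numbers with given real and imaginary parts. -/
def line {ι : Type*} (re im : ι → ℝ) (k : ι) : ℂ := (re k : ℂ) + Complex.I * (im k : ℂ)

open Classical in
/-- The variables `x_k`: for `k ≠ k₀` the real part is `σ_k` and the imaginary part `ξ_k`, and `x_{k₀}`
is determined by `∑ k, x_k + ∑ k, (y^R_k + y^I_k) = - D / 2`. -/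
def xLine (_M : MonomialData L KU KR KI) (D : ℂ) (k₀ : KU) (σ : KU → ℝ) (ξ : {k : KU // k ≠ k₀} → ℝ)
    (yR : KR → ℂ) (yI : KI → ℂ) (k : KU) : ℂ :=
  if h : k ≠ k₀ then (σ k : ℂ) + Complex.I * (ξ ⟨k, h⟩ : ℂ)
  else -D / 2 - (∑ j, yR j + ∑ j, yI j) -
    ∑ j : {k : KU // k ≠ k₀}, ((σ j : ℂ) + Complex.I * (ξ j : ℂ))

/-- The integrand as a function of the independent imaginary parts `(ξ, η^R, η^I)`, the real parts
being fixed at `q = (σ, τ^R, τ^I)`, with the factor `1 / (2 π)` for each integration variable. -/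
def contourIntegrand (M : MonomialData L KU KR KI) (D : ℂ) (f : 𝓢((KR → ℝ) × (KI → ℝ), ℂ))
    (q : (KU → ℝ) × (KR → ℝ) × (KI → ℝ)) (k₀ : KU)
    (η : ({k : KU // k ≠ k₀} → ℝ) × (KR → ℝ) × (KI → ℝ)) : ℂ :=
  (1 / (2 * (Real.pi : ℂ))) ^ (Fintype.card KU - 1 + Fintype.card KR + Fintype.card KI) *
    M.mellinIntegrand D f
      (M.xLine D k₀ q.1 η.1 (line q.2.1 η.2.1) (line q.2.2 η.2.2))
      (line q.2.1 η.2.1) (line q.2.2 η.2.2)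

end MonomialData

/-- The strip `0 < Re D < 2`. -/
def strip : Set ℂ := {D | 0 < D.re ∧ D.re < 2}

end NCQFT

end

set_option linter.unusedSectionVars false

section

open MeasureTheory Set Filter Topology

namespace NCQFT

/-! The analysis uses only two properties of `HU`, recorded in `Admissible`: its coefficients are
positive, and one of its monomials is square-free. The second gives `HU ≥ c ∏ t_l` on the cube.
Whenever the real part of `HV` is nonnegative, the modulus of the integrand is therefore at most a
constant times `∏ t_l ^ (-Re D / 2) (1 - t_l²) ^ (Re D / 2 - 1)`, which is integrable for `0 < Re D
< 2`. The dependence on `D` has the form `g exp (D h)`, a Laplace transform, hence it is analytic.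
The amplitude is bounded on the domain of the invariants, so it is a tempered distribution.

The Mellin representation comes from three classical formulas. The Cahen-Mellin integral replaces
`exp (-z / U)`, for each monomial `z` of `HV`, by an integral of `Γ(-y) (z / U) ^ y`. The Barnes
integral writes the resulting power of the sum `U` as an integral of products of powers of its
monomials. The integral over `t` then splits into Beta integrals whose exponents are the `φ_l`.

The obstacle is absolute convergence: `(i s) ^ y` grows like `exp (π |Im y| / 2)` for one sign of
`Im y`, which uses up all the decay of `Γ(-y)`. So `i s` is replaced by `ε + i s`, with `ε > 0`.
Then Fubini applies (`integrable_fullIntegrand`, `integral_joint_eq`), and `ε → 0` is taken on each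
side by dominated convergence. On the parametric side the majorant is immediate. On the Mellin side
it comes from integrating by parts against the Schwartz function in every `s^I_k`, which gains any
power of `1 / (1 + |Im y^I_k|)` uniformly in `ε` (`exists_norm_integral_regularizedPower_le`). The
condition `-1 < τ^I_k` keeps the powers locally integrable.

It remains to see that the graph polynomials are admissible. Expanding the determinant along its
rows writes `HU` as a sum of products of polynomials with nonnegative coefficients, weighted by
determinants of an antisymmetric matrix in which some rows are replaced by rows of the identity.
These are nonnegative by a deformation to the identity (`det_piecewise_one_nonneg`). A square-free
monomial exists because a reduced matrix, in which only terms of degree at most one in each `t_l`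
survive, is invertible. A kernel vector solves stationarity equations on the graph, and
connectedness propagates its vanishing from the root (`eq_zero_of_grosseWulkenhaar`,
`eq_zero_of_lsz`). Finally, the real part of `HV` at an external configuration is nonnegative
because `(A + B)⁻¹` has nonnegative quadratic form (`adjugate_quadratic_nonneg`). -/

/-! ### Laplace transforms and bounds for the Gamma function. -/

/-- A factor `|y|` costs at most `δ⁻¹ exp (δ |y|)`; with `|ρ - ρ₀| ≤ δ` the exponent moves by at
most `2 δ`, in a direction fixed by the sign of `y`. This majorizes the derivative of a Laplace
integrand on a whole disc. -/
lemma abs_mul_exp_le {δ ρ₀ ρ y : ℝ} (hδ : 0 < δ) (hρ : |ρ - ρ₀| ≤ δ) :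
    |y| * Real.exp (ρ * y) ≤
      δ⁻¹ * (Real.exp ((ρ₀ + 2 * δ) * y) + Real.exp ((ρ₀ - 2 * δ) * y)) := by
  have h1 : δ * |y| ≤ Real.exp (δ * |y|) := by linarith [Real.add_one_le_exp (δ * |y|)]
  have h2 : δ * |y| * Real.exp (ρ * y) ≤
      Real.exp ((ρ₀ + 2 * δ) * y) + Real.exp ((ρ₀ - 2 * δ) * y) := by
    have h3 : δ * |y| * Real.exp (ρ * y) ≤ Real.exp (δ * |y| + ρ * y) := by
      rw [Real.exp_add]; gcongr
    rw [abs_le] at hρ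
    rcases abs_cases y with ⟨h, hy⟩ | ⟨h, hy⟩
    · refine h3.trans (le_trans ?_ (le_add_of_nonneg_right (Real.exp_pos _).le))
      rw [Real.exp_le_exp, h]; nlinarith
    · refine h3.trans (le_trans ?_ (le_add_of_nonneg_left (Real.exp_pos _).le))
      rw [Real.exp_le_exp, h]; nlinarith
  rw [← mul_le_mul_iff_right₀ hδ]
  calc _ = δ * |y| * Real.exp (ρ * y) := by ring
    _ ≤ _ := h2
    _ = _ := by field_simp

/-- A complex Laplace transform is analytic where it converges absolutely. -/
theorem analyticOnNhd_integral_mul_exp {α : Type*} [MeasurableSpace α] {μ : Measure α}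
    {g : α → ℂ} {h : α → ℝ} (hg : AEStronglyMeasurable g μ) (hh : AEMeasurable h μ)
    {s : Set ℝ} (hs : IsOpen s)
    (hint : ∀ ρ ∈ s, Integrable (fun ω => ‖g ω‖ * Real.exp (ρ * h ω)) μ) :
    AnalyticOnNhd ℂ (fun D : ℂ => ∫ ω, g ω * Complex.exp (D * h ω) ∂μ) {D | D.re ∈ s} := by
  have hopen : IsOpen {D : ℂ | D.re ∈ s} := hs.preimage Complex.continuous_re
  have hmeas : ∀ D : ℂ, AEStronglyMeasurable (fun ω => g ω * Complex.exp (D * h ω)) μ := by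
    intro D
    refine hg.mul (AEMeasurable.aestronglyMeasurable ?_)
    fun_prop
  refine DifferentiableOn.analyticOnNhd (fun D₀ hD₀ => ?_) hopen
  obtain ⟨ε, hε, hball⟩ := Metric.isOpen_iff.1 hs _ hD₀
  -- A third of the radius leaves room for the two abscissas `D₀.re ± 2 δ` that dominate the
  -- derivative on the disc of radius `δ`.
  set δ := ε / 3 with hδ
  have hδ0 : 0 < δ := by positivity
  have hp : D₀.re + 2 * δ ∈ s := hball (by
    rw [Metric.mem_ball, Real.dist_eq]; rw [add_sub_cancel_left, abs_of_pos (by positivity)]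
    linarith)
  have hm : D₀.re - 2 * δ ∈ s := hball (by
    rw [Metric.mem_ball, Real.dist_eq, abs_sub_comm, sub_sub_cancel, abs_of_pos (by positivity)]
    linarith)
  have hnorm : ∀ (D : ℂ) ω, ‖Complex.exp (D * h ω)‖ = Real.exp (D.re * h ω) := by
    intro D ω; rw [Complex.norm_exp]; simp
  have key := hasDerivAt_integral_of_dominated_loc_of_deriv_le (μ := μ)
    (F := fun D ω => g ω * Complex.exp (D * h ω))
    (F' := fun D ω => g ω * (Complex.exp (D * h ω) * h ω))
    (bound := fun ω => δ⁻¹ * (‖g ω‖ * Real.exp ((D₀.re + 2 * δ) * h ω) +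
      ‖g ω‖ * Real.exp ((D₀.re - 2 * δ) * h ω)))
    (Metric.ball_mem_nhds D₀ hδ0) (Eventually.of_forall hmeas) ?_ ?_ ?_ ?_ ?_
  · exact key.2.differentiableAt.differentiableWithinAt
  · refine (hint _ hD₀).mono' (hmeas _) (ae_of_all _ fun ω => ?_)
    rw [norm_mul, hnorm]
  · refine hg.mul (AEMeasurable.aestronglyMeasurable ?_)
    fun_prop
  · refine ae_of_all _ fun ω D hD => ?_
    rw [Metric.mem_ball, dist_eq_norm] at hD
    have hb := abs_mul_exp_le (ρ₀ := D₀.re) (ρ := D.re) (y := h ω) hδ0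
      (by simpa using (Complex.abs_re_le_norm (D - D₀)).trans hD.le)
    rw [norm_mul, norm_mul, hnorm, Complex.norm_real, Real.norm_eq_abs]
    calc ‖g ω‖ * (Real.exp (D.re * h ω) * |h ω|) = ‖g ω‖ * (|h ω| * Real.exp (D.re * h ω)) := by ring
      _ ≤ ‖g ω‖ * (δ⁻¹ * (Real.exp ((D₀.re + 2 * δ) * h ω) + Real.exp ((D₀.re - 2 * δ) * h ω))) := by
          gcongr
      _ = _ := by ring
  · exact ((hint _ hp).add (hint _ hm)).const_mul _
  · refine ae_of_all _ fun ω D _ => ?_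
    have h1 : HasDerivAt (fun D : ℂ => D * (h ω : ℂ)) (h ω : ℂ) D := by
      simpa using (hasDerivAt_id D).mul_const (h ω : ℂ)
    exact h1.cexp.const_mul _

lemma integrableOn_rpow_mul_exp_neg {σ r : ℝ} (hσ : 0 < σ) (hr : 0 < r) :
    IntegrableOn (fun x : ℝ => x ^ (σ - 1) * Real.exp (-(r * x))) (Ioi 0) := by
  have := integrableOn_rpow_mul_exp_neg_mul_rpow (s := σ - 1) (p := 1) (b := r) (by linarith) one_pos hr
  simpa using this

lemma norm_cpow_mul_exp_neg {a z : ℂ} {x : ℝ} (hx : 0 < x) :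
    ‖(x : ℂ) ^ (a - 1) * Complex.exp (-(z * x))‖ = x ^ (a.re - 1) * Real.exp (-(z.re * x)) := by
  rw [norm_mul, Complex.norm_cpow_eq_rpow_re_of_pos hx, Complex.norm_exp]; simp

lemma integrableOn_cpow_mul_exp_neg {a z : ℂ} (ha : 0 < a.re) (hz : 0 < z.re) :
    IntegrableOn (fun x : ℝ => (x : ℂ) ^ (a - 1) * Complex.exp (-(z * x))) (Ioi 0) := by
  refine (integrableOn_rpow_mul_exp_neg ha hz).mono' (Measurable.aestronglyMeasurable (by fun_prop)) ?_
  filter_upwards [ae_restrict_mem measurableSet_Ioi] with x hx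
  exact (norm_cpow_mul_exp_neg hx).le

/-- The Gamma integral along a rotated ray. -/
theorem integral_cpow_mul_exp_neg_mul_Ioi' {a z : ℂ} (ha : 0 < a.re) (hz : 0 < z.re) :
    ∫ x : ℝ in Ioi 0, (x : ℂ) ^ (a - 1) * Complex.exp (-(z * x)) = Complex.Gamma a * z ^ (-a) := by
  -- Both sides are analytic in `z` on the right half-plane and agree for real `z` near 1; the
  -- identity theorem does the rest.
  have hl : AnalyticOnNhd ℂ (fun z : ℂ => ∫ x : ℝ in Ioi 0,
      (x : ℂ) ^ (a - 1) * Complex.exp (z * ((-x : ℝ) : ℂ))) {z | z.re ∈ Ioi (0 : ℝ)} := by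
    refine analyticOnNhd_integral_mul_exp (Measurable.aestronglyMeasurable (by fun_prop))
      (by fun_prop) isOpen_Ioi fun ρ hρ => ?_
    refine (integrableOn_rpow_mul_exp_neg ha hρ).congr ?_
    filter_upwards [ae_restrict_mem measurableSet_Ioi] with x hx
    rw [Complex.norm_cpow_eq_rpow_re_of_pos hx]; simp
  have hr : AnalyticOnNhd ℂ (fun z : ℂ => Complex.Gamma a * z ^ (-a)) {z | z.re ∈ Ioi (0 : ℝ)} := by
    intro z hz
    exact analyticAt_const.mul (analyticAt_id.cpow analyticAt_const (Or.inl hz))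
  have hconn : IsPreconnected {z : ℂ | z.re ∈ Ioi (0 : ℝ)} :=
    (convex_halfSpace_re_gt 0).isPreconnected
  have hfreq : ∃ᶠ w in 𝓝[≠] (1 : ℂ), (∫ x : ℝ in Ioi 0,
      (x : ℂ) ^ (a - 1) * Complex.exp (w * ((-x : ℝ) : ℂ))) = Complex.Gamma a * w ^ (-a) := by
    have htend : Tendsto (fun x : ℝ => (x : ℂ)) (𝓝[≠] (1 : ℝ)) (𝓝[≠] (1 : ℂ)) := by
      refine tendsto_nhdsWithin_iff.2 ⟨?_, ?_⟩
      · exact ((Complex.continuous_ofReal.tendsto 1).mono_left nhdsWithin_le_nhds).trans (by simp)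
      · filter_upwards [self_mem_nhdsWithin] with x hx
        simpa using hx
    refine htend.frequently (Eventually.frequently ?_)
    have : ∀ᶠ x : ℝ in 𝓝[≠] (1 : ℝ), 0 < x := nhdsWithin_le_nhds (lt_mem_nhds one_pos)
    filter_upwards [this] with x hx
    have h := Complex.integral_cpow_mul_exp_neg_mul_Ioi ha hx
    simp only [Complex.ofReal_neg, mul_neg]
    rw [h, mul_comm, one_div, Complex.inv_cpow, Complex.cpow_neg]
    rw [Complex.arg_ofReal_of_nonneg hx.le]; exact Real.pi_pos.ne
  have h := hl.eqOn_of_preconnected_of_frequently_eq hr hconn (z₀ := 1) (by simp) hfreq hz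
  simpa using h

/-- `|Γ(σ + iη)|` decays like `exp (-π |η| / 2)` up to powers. -/
theorem exists_norm_Gamma_le {σ : ℝ} (hσ : 0 < σ) (hσ1 : σ ≤ 1) : ∃ C : ℝ, 0 < C ∧ ∀ z : ℂ, z.re = σ →
    ‖Complex.Gamma z‖ ≤ C * (1 + |z.im|) * Real.exp (-(Real.pi / 2 * |z.im|)) := by
  refine ⟨Real.exp 1 * 2 * Real.Gamma σ, by positivity, fun z hz => ?_⟩
  wlog hi : 0 ≤ z.im generalizing z
  · have := this ((starRingEnd ℂ) z) (by simpa using hz) (by simp; linarith)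
    rw [Complex.Gamma_conj] at this
    simpa using this
  set η := z.im
  -- Rotating the ray by `φ = π / 2 - c` gains `exp (φ η)` and costs `(cos φ) ^ (-σ)`, where `cos φ
  -- ≥ c / 2`. With `c = 1 / (1 + η)` the loss in the exponential is at most a factor `e`, and the
  -- cost is linear in `η` because `σ ≤ 1`.
  set c := 1 / (1 + η) with hc
  have hc0 : 0 < c := by positivity
  have hc1 : c ≤ 1 := by rw [hc, div_le_one (by positivity)]; linarith
  have hcπ : c < Real.pi / 2 := by linarith [Real.pi_gt_three]
  set φ := Real.pi / 2 - c with hφ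
  have hφ0 : 0 < φ := by linarith
  have hcos : c / 2 ≤ Real.cos φ := by
    rw [hφ, Real.cos_pi_div_two_sub]
    have := Real.mul_le_sin hc0.le hcπ.le
    refine le_trans ?_ this
    rw [mul_comm, div_eq_mul_inv]
    gcongr
    rw [inv_le_comm₀ (by norm_num) (by positivity), inv_div]; linarith [Real.pi_lt_four]
  have hcos0 : 0 < Real.cos φ := lt_of_lt_of_le (by positivity) hcos
  set ζ := Complex.exp (φ * Complex.I) with hζ
  have hζre : ζ.re = Real.cos φ := by rw [hζ, Complex.exp_ofReal_mul_I_re]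
  have hint := integral_cpow_mul_exp_neg_mul_Ioi' (a := z) (z := ζ) (by rw [hz]; exact hσ)
    (by rw [hζre]; exact hcos0)
  have hnorm : ‖ζ ^ (-z)‖ = Real.exp (φ * η) := by
    rw [hζ, Complex.cpow_def_of_ne_zero (Complex.exp_ne_zero _), Complex.log_exp, Complex.norm_exp]
    · simp [η]
    · rw [Complex.im_ofReal_mul, Complex.I_im]; linarith [Real.pi_pos]
    · rw [Complex.im_ofReal_mul, Complex.I_im]; linarith [Real.pi_pos]
  have hle : ‖Complex.Gamma z‖ * Real.exp (φ * η) ≤ Real.cos φ ^ (-σ) * Real.Gamma σ := by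
    rw [← hnorm, ← norm_mul, ← hint]
    refine (norm_integral_le_integral_norm _).trans ?_
    have : ∫ x : ℝ in Ioi 0, ‖(x : ℂ) ^ (z - 1) * Complex.exp (-(ζ * x))‖ =
        ∫ x : ℝ in Ioi 0, x ^ (σ - 1) * Real.exp (-(Real.cos φ * x)) := by
      refine setIntegral_congr_fun measurableSet_Ioi fun x hx => ?_
      rw [norm_cpow_mul_exp_neg hx, hz, hζre]
    rw [this, Real.integral_rpow_mul_exp_neg_mul_Ioi hσ hcos0, one_div, Real.inv_rpow hcos0.le,
      Real.rpow_neg hcos0.le]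
  have hcosp : Real.cos φ ^ (-σ) ≤ 2 * (1 + η) := by
    have h1 : (1 : ℝ) ≤ 2 * (1 + η) := by linarith
    calc Real.cos φ ^ (-σ) ≤ (c / 2) ^ (-σ) :=
          Real.rpow_le_rpow_of_nonpos (by positivity) hcos (by linarith)
      _ = (2 * (1 + η)) ^ σ := by
          rw [Real.rpow_neg (by positivity), ← Real.inv_rpow (by positivity)]; congr 1
          rw [hc]; field_simp
      _ ≤ (2 * (1 + η)) ^ (1 : ℝ) := Real.rpow_le_rpow_of_exponent_le h1 hσ1
      _ = _ := Real.rpow_one _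
  have hφη : Real.exp (-(φ * η)) ≤ Real.exp 1 * Real.exp (-(Real.pi / 2 * η)) := by
    rw [← Real.exp_add, Real.exp_le_exp, hφ]
    have : c * η ≤ 1 := by rw [hc, div_mul_eq_mul_div, div_le_one (by positivity)]; linarith
    linarith
  have hΓ : 0 < Real.Gamma σ := Real.Gamma_pos_of_pos hσ
  calc ‖Complex.Gamma z‖ = ‖Complex.Gamma z‖ * Real.exp (φ * η) * Real.exp (-(φ * η)) := by
        rw [mul_assoc, ← Real.exp_add]; simp
    _ ≤ (Real.cos φ ^ (-σ) * Real.Gamma σ) * Real.exp (-(φ * η)) := by gcongr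
    _ ≤ (2 * (1 + η) * Real.Gamma σ) * (Real.exp 1 * Real.exp (-(Real.pi / 2 * η))) := by gcongr
    _ = _ := by rw [abs_of_nonneg hi]; ring

/-- By the reflection formula `1 / Γ(z) = Γ(1 - z) sin (π z) / π`. The sine grows like `exp (π |Im
z|)` and `Γ(1 - z)` takes back half of that exponent. -/
theorem exists_norm_inv_Gamma_le {σ : ℝ} (hσ : 0 < σ) (hσ1 : σ < 1) : ∃ C : ℝ, 0 < C ∧
    ∀ z : ℂ, z.re = σ →
    ‖(Complex.Gamma z)⁻¹‖ ≤ C * (1 + |z.im|) * Real.exp (Real.pi / 2 * |z.im|) := by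
  obtain ⟨C, hC, h⟩ := exists_norm_Gamma_le (σ := 1 - σ) (by linarith) (by linarith)
  refine ⟨C, hC, fun z hz => ?_⟩
  have h1 := h (1 - z) (by simp [hz])
  have hsin : ‖Complex.sin (Real.pi * z)‖ ≤ Real.exp (Real.pi * |z.im|) := by
    rw [Complex.sin]
    have e1 : ‖Complex.exp (-(Real.pi * z) * Complex.I)‖ ≤ Real.exp (Real.pi * |z.im|) := by
      rw [Complex.norm_exp, Real.exp_le_exp]; simp
      exact mul_le_mul_of_nonneg_left (le_abs_self _) Real.pi_pos.le
    have e2 : ‖Complex.exp ((Real.pi * z) * Complex.I)‖ ≤ Real.exp (Real.pi * |z.im|) := by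
      rw [Complex.norm_exp, Real.exp_le_exp]; simp
      have := mul_le_mul_of_nonneg_left (neg_abs_le z.im) Real.pi_pos.le
      linarith
    rw [norm_div, norm_mul, Complex.norm_I, mul_one, Complex.norm_ofNat]
    have := norm_sub_le (Complex.exp (-(Real.pi * z) * Complex.I)) (Complex.exp ((Real.pi * z) * Complex.I))
    linarith
  have hG : Complex.Gamma z ≠ 0 := Complex.Gamma_ne_zero_of_re_pos (by rw [hz]; exact hσ)
  have hrefl := Complex.Gamma_mul_Gamma_one_sub z
  have hG' : Complex.Gamma (1 - z) ≠ 0 :=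
    Complex.Gamma_ne_zero_of_re_pos (by simp [hz]; linarith)
  have hs0 : Complex.sin (Real.pi * z) ≠ 0 := by
    intro h0
    rw [h0, div_zero] at hrefl
    exact mul_ne_zero hG hG' hrefl
  have hinv : (Complex.Gamma z)⁻¹ = Complex.Gamma (1 - z) * Complex.sin (Real.pi * z) / Real.pi := by
    have hpi : (Real.pi : ℂ) ≠ 0 := by exact_mod_cast Real.pi_pos.ne'
    rw [eq_div_iff hs0] at hrefl
    rw [eq_div_iff hpi, inv_mul_eq_iff_eq_mul₀ hG, ← mul_assoc, hrefl]
  rw [hinv, norm_div, norm_mul, Complex.norm_real, Real.norm_eq_abs, abs_of_pos Real.pi_pos]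
  simp only [Complex.sub_im, Complex.one_im, zero_sub, abs_neg] at h1
  calc ‖Complex.Gamma (1 - z)‖ * ‖Complex.sin (Real.pi * z)‖ / Real.pi
      ≤ ‖Complex.Gamma (1 - z)‖ * ‖Complex.sin (Real.pi * z)‖ :=
        div_le_self (by positivity) (by linarith [Real.pi_gt_three])
    _ ≤ (C * (1 + |z.im|) * Real.exp (-(Real.pi / 2 * |z.im|))) * Real.exp (Real.pi * |z.im|) := by
        gcongr
    _ = _ := by rw [mul_assoc, ← Real.exp_add]; ring_nf

/-! ### The Cahen-Mellin integral in the right half-plane. -/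

/-- The point is the explicit dependence on `δ`: it is later `Re z / ‖z‖`, and the bound must stay
polynomial in `‖z‖ / Re z` as `z` approaches the imaginary axis. -/
lemma one_add_abs_pow_mul_exp_le (M : ℕ) {δ : ℝ} (hδ : 0 < δ) (x : ℝ) :
    (1 + |x|) ^ M * Real.exp (-(δ * |x|)) ≤
      Nat.factorial (M + 2) * Real.exp 1 * (1 + δ⁻¹) ^ (M + 2) * (1 + x ^ 2)⁻¹ := by
  have h1 : 1 + |x| ≤ (1 + δ⁻¹) * (1 + δ * |x|) := by
    have : δ⁻¹ * (δ * |x|) = |x| := by field_simp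
    nlinarith [abs_nonneg x, inv_pos.2 hδ, mul_nonneg hδ.le (abs_nonneg x)]
  have h2 : (1 + δ * |x|) ^ (M + 2) ≤ Nat.factorial (M + 2) * Real.exp (1 + δ * |x|) := by
    have := Real.pow_div_factorial_le_exp (1 + δ * |x|) (by positivity) (M + 2)
    rwa [div_le_iff₀' (by positivity)] at this
  have h3 : 1 + x ^ 2 ≤ (1 + |x|) ^ 2 := by nlinarith [abs_nonneg x, sq_abs x]
  have h4 : (1 + |x|) ^ (M + 2) * Real.exp (-(δ * |x|)) ≤
      Nat.factorial (M + 2) * Real.exp 1 * (1 + δ⁻¹) ^ (M + 2) := by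
    calc (1 + |x|) ^ (M + 2) * Real.exp (-(δ * |x|))
        ≤ ((1 + δ⁻¹) * (1 + δ * |x|)) ^ (M + 2) * Real.exp (-(δ * |x|)) := by gcongr
      _ = (1 + δ⁻¹) ^ (M + 2) * (1 + δ * |x|) ^ (M + 2) * Real.exp (-(δ * |x|)) := by rw [mul_pow]
      _ ≤ (1 + δ⁻¹) ^ (M + 2) * (Nat.factorial (M + 2) * Real.exp (1 + δ * |x|)) *
            Real.exp (-(δ * |x|)) := by gcongr
      _ = _ := by
          have : Real.exp (1 + δ * |x|) * Real.exp (-(δ * |x|)) = Real.exp 1 := by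
            rw [← Real.exp_add]; ring_nf
          rw [mul_assoc, mul_assoc (Nat.factorial (M + 2) : ℝ), this]; ring
  rw [← div_eq_mul_inv, le_div_iff₀ (by positivity)]
  calc _ ≤ (1 + |x|) ^ M * Real.exp (-(δ * |x|)) * (1 + |x|) ^ 2 := by gcongr
    _ = (1 + |x|) ^ (M + 2) * Real.exp (-(δ * |x|)) := by ring
    _ ≤ _ := h4

/-- The distance of `|arg z|` from `π / 2` is at least its sine, which is `cos (arg z) = Re z /
‖z‖`. -/
lemma div_norm_le_pi_div_two_sub_abs_arg {z : ℂ} (hz : 0 < z.re) :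
    z.re / ‖z‖ ≤ Real.pi / 2 - |z.arg| := by
  have hz0 : z ≠ 0 := by rintro rfl; simp at hz
  have h := Complex.cos_arg hz0
  rw [← h, ← Real.cos_abs, ← Real.sin_pi_div_two_sub]
  exact Real.sin_le (by linarith [Complex.abs_arg_lt_pi_div_two_iff.2 (Or.inl hz)])

lemma continuous_Gamma_neg_line {τ : ℝ} (hτ : τ < 0) :
    Continuous fun η : ℝ => Complex.Gamma (-((τ : ℂ) + Complex.I * (η : ℂ))) := by
  rw [continuous_iff_continuousAt]
  intro η
  have h : ContinuousAt Complex.Gamma (-((τ : ℂ) + Complex.I * (η : ℂ))) := by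
    refine (Complex.differentiableAt_Gamma _ fun m hm => ?_).continuousAt
    have := congrArg Complex.re hm
    simp at this
    linarith [(Nat.cast_nonneg m : (0 : ℝ) ≤ m)]
  exact ContinuousAt.comp (f := fun η : ℝ => -((τ : ℂ) + Complex.I * (η : ℂ))) h (by fun_prop)

lemma norm_cpow_line {z : ℂ} (hz : z ≠ 0) (τ η : ℝ) :
    ‖z ^ ((τ : ℂ) + Complex.I * (η : ℂ))‖ = ‖z‖ ^ τ * Real.exp (-(z.arg * η)) := by
  rw [Complex.norm_cpow_of_ne_zero hz, Real.exp_neg, div_eq_mul_inv]; simp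

lemma neg_arg_mul_le (z : ℂ) (η : ℝ) : -(z.arg * η) ≤ |z.arg| * |η| := by
  rw [← abs_mul]; exact neg_le_abs _

lemma exists_norm_Gamma_neg_line_le {τ : ℝ} (hτ : τ < 0) (hτ1 : -1 ≤ τ) : ∃ C : ℝ, 0 < C ∧
    ∀ η : ℝ, ‖Complex.Gamma (-((τ : ℂ) + Complex.I * (η : ℂ)))‖ ≤
      C * (1 + |η|) * Real.exp (-(Real.pi / 2 * |η|)) := by
  obtain ⟨C, hC, h⟩ := exists_norm_Gamma_le (σ := -τ) (by linarith) (by linarith)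
  refine ⟨C, hC, fun η => ?_⟩
  simpa using h (-((τ : ℂ) + Complex.I * (η : ℂ))) (by simp)

/-- The power grows at most like `exp (|arg z| |η|)`, against the decay `exp (-π |η| / 2)` of a
Gamma function. The gap of the rates is at least `Re z / ‖z‖`, so the product is integrable in `η`,
at a polynomial price in `‖z‖ / Re z`. -/
theorem exists_exp_mul_norm_cpow_le (τ : ℝ) (M : ℕ) :
    ∃ C : ℝ, 0 < C ∧ ∀ z : ℂ, 0 < z.re → ∀ η : ℝ,
      (1 + |η|) ^ M * Real.exp (-(Real.pi / 2 * |η|)) * ‖z ^ ((τ : ℂ) + Complex.I * (η : ℂ))‖ ≤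
      C * (‖z‖ ^ τ * (1 + ‖z‖ / z.re) ^ (M + 2)) * (1 + η ^ 2)⁻¹ := by
  refine ⟨Nat.factorial (M + 2) * Real.exp 1, by positivity, fun z hz η => ?_⟩
  have hz0 : z ≠ 0 := by rintro rfl; simp at hz
  have hn : 0 < ‖z‖ := norm_pos_iff.2 hz0
  have h := one_add_abs_pow_mul_exp_le M (δ := z.re / ‖z‖) (by positivity) η
  rw [inv_div] at h
  rw [norm_cpow_line hz0]
  calc _ ≤ (1 + |η|) ^ M * Real.exp (-(Real.pi / 2 * |η|)) *
        (‖z‖ ^ τ * Real.exp (|z.arg| * |η|)) := by gcongr; exact neg_arg_mul_le z η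
    _ = ‖z‖ ^ τ * ((1 + |η|) ^ M * Real.exp (-((Real.pi / 2 - |z.arg|) * |η|))) := by
        rw [show -((Real.pi / 2 - |z.arg|) * |η|) = -(Real.pi / 2 * |η|) + |z.arg| * |η| by ring,
          Real.exp_add]; ring
    _ ≤ ‖z‖ ^ τ * ((1 + |η|) ^ M * Real.exp (-(z.re / ‖z‖ * |η|))) := by
        gcongr; exact div_norm_le_pi_div_two_sub_abs_arg hz
    _ ≤ ‖z‖ ^ τ * (Nat.factorial (M + 2) * Real.exp 1 * (1 + ‖z‖ / z.re) ^ (M + 2) * (1 + η ^ 2)⁻¹) := by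
        gcongr
    _ = _ := by ring

theorem integrable_Gamma_mul_cpow {τ : ℝ} (hτ : τ < 0) (hτ1 : -1 ≤ τ) {z : ℂ} (hz : 0 < z.re) :
    Integrable fun η : ℝ => Complex.Gamma (-((τ : ℂ) + Complex.I * (η : ℂ))) *
      z ^ ((τ : ℂ) + Complex.I * (η : ℂ)) := by
  obtain ⟨C, hC, h⟩ := exists_norm_Gamma_neg_line_le hτ hτ1
  obtain ⟨C', hC', h'⟩ := exists_exp_mul_norm_cpow_le τ 1
  refine (integrable_inv_one_add_sq.const_mul
    (C * (C' * (‖z‖ ^ τ * (1 + ‖z‖ / z.re) ^ (1 + 2))))).mono' ?_ ?_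
  · refine ((continuous_Gamma_neg_line hτ).measurable.mul ?_).aestronglyMeasurable
    fun_prop
  · refine ae_of_all _ fun η => ?_
    rw [norm_mul]
    calc _ ≤ C * (1 + |η|) * Real.exp (-(Real.pi / 2 * |η|)) *
          ‖z ^ ((τ : ℂ) + Complex.I * (η : ℂ))‖ := by gcongr; exact h η
      _ = C * ((1 + |η|) ^ 1 * Real.exp (-(Real.pi / 2 * |η|)) *
          ‖z ^ ((τ : ℂ) + Complex.I * (η : ℂ))‖) := by ring
      _ ≤ C * _ := mul_le_mul_of_nonneg_left (h' z hz η) hC.le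
      _ = _ := by ring

/-- The Cahen-Mellin integral. -/
theorem integral_Gamma_mul_cpow {τ : ℝ} (hτ : τ < 0) (hτ1 : -1 ≤ τ) {z : ℂ} (hz : 0 < z.re) :
    (1 / (2 * (Real.pi : ℂ))) * ∫ η : ℝ, Complex.Gamma (-((τ : ℂ) + Complex.I * (η : ℂ))) *
      z ^ ((τ : ℂ) + Complex.I * (η : ℂ)) = Complex.exp (-z) := by
  -- Mellin inversion of `x ↦ exp (-z x)`, whose transform is `Γ(s) z ^ (-s)`, evaluated at `x = 1`
  -- on the line `Re s = -τ`. The sign of the imaginary variable is reversed at the end.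
  set f : ℝ → ℂ := fun x => Complex.exp (-(z * x)) with hf
  have hmellin : ∀ s : ℂ, 0 < s.re → mellin f s = Complex.Gamma s * z ^ (-s) := by
    intro s hs
    rw [mellin, ← integral_cpow_mul_exp_neg_mul_Ioi' hs hz]
    simp [hf]
  have hline : ∀ η : ℝ, mellin f (((-τ : ℝ) : ℂ) + η * Complex.I) =
      Complex.Gamma (-((τ : ℂ) + Complex.I * ((-η : ℝ) : ℂ))) *
        z ^ ((τ : ℂ) + Complex.I * ((-η : ℝ) : ℂ)) := by
    intro η
    rw [hmellin _ (by simp; exact hτ)]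
    congr 2 <;> push_cast <;> ring
  have hconv : MellinConvergent f ((-τ : ℝ) : ℂ) := by
    have := integrableOn_cpow_mul_exp_neg (a := ((-τ : ℝ) : ℂ)) (z := z) (by simp; exact hτ) hz
    simpa [MellinConvergent, hf] using this
  have hvert : Complex.VerticalIntegrable (mellin f) (-τ) := by
    rw [Complex.VerticalIntegrable]
    simp_rw [hline]
    exact (integrable_Gamma_mul_cpow hτ hτ1 hz).comp_neg
  have h := mellinInv_mellin_eq (-τ) f one_pos hconv hvert (by fun_prop)
  rw [mellinInv] at h
  simp_rw [hline] at h
  simp only [Complex.ofReal_one, Complex.one_cpow, one_smul] at h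
  rw [integral_neg_eq_self (fun η : ℝ => Complex.Gamma (-((τ : ℂ) + Complex.I * (η : ℂ))) *
      z ^ ((τ : ℂ) + Complex.I * (η : ℂ)))] at h
  simpa [hf, Complex.real_smul] using h

/-! ### Barnes integrals for powers of a sum. -/

lemma ofReal_mul_cpow {x y : ℝ} (hx : 0 < x) (hy : 0 < y) (s : ℂ) :
    ((x * y : ℝ) : ℂ) ^ s = (x : ℂ) ^ s * (y : ℂ) ^ s := by
  rw [Complex.ofReal_mul, Complex.mul_cpow_ofReal_nonneg hx.le hy.le]

lemma cpow_sum {ι : Type*} (s : Finset ι) {z : ℂ} (hz : z ≠ 0) (f : ι → ℂ) :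
    z ^ (∑ i ∈ s, f i) = ∏ i ∈ s, z ^ f i := by
  classical
  induction s using Finset.induction_on with
  | empty => simp
  | insert a s ha ih => rw [Finset.sum_insert ha, Finset.prod_insert ha, Complex.cpow_add _ _ hz, ih]

/-- The Barnes multiple integral for a power of a sum of positive numbers. -/
theorem integral_prod_Gamma_mul_cpow {κ : Type*} [Fintype κ] {A : κ → ℝ} (hA : ∀ k, 0 < A k)
    {A₀ : ℝ} (hA₀ : 0 < A₀) {σ : κ → ℝ} (hσ : ∀ k, σ k < 0) (hσ1 : ∀ k, -1 ≤ σ k) {w : ℂ}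
    (hw : 0 < w.re + ∑ k, σ k) :
    (1 / (2 * (Real.pi : ℂ))) ^ Fintype.card κ * ∫ ξ : κ → ℝ,
      (∏ k, Complex.Gamma (-(MonomialData.line σ ξ k)) * (A k : ℂ) ^ MonomialData.line σ ξ k) *
        (Complex.Gamma (w + ∑ k, MonomialData.line σ ξ k) *
          (A₀ : ℂ) ^ (-(w + ∑ k, MonomialData.line σ ξ k))) =
      Complex.Gamma w * ((A₀ + ∑ k, A k : ℝ) : ℂ) ^ (-w) := by
  have hw0 : 0 < w.re := by
    have : ∑ k, σ k ≤ 0 := Finset.sum_nonpos fun k _ => (hσ k).le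
    linarith
  have hS : 0 < A₀ + ∑ k, A k := by
    have : 0 ≤ ∑ k, A k := Finset.sum_nonneg fun k _ => (hA k).le
    linarith
  set g : κ → ℝ → ℂ := fun k η => Complex.Gamma (-((σ k : ℂ) + Complex.I * (η : ℂ))) *
    (A k : ℂ) ^ ((σ k : ℂ) + Complex.I * (η : ℂ)) with hg
  have hgint : ∀ k, Integrable (g k) := fun k =>
    integrable_Gamma_mul_cpow (hσ k) (hσ1 k) (by simpa using hA k)
  have hgprod : Integrable fun ξ : κ → ℝ => ∏ k, g k (ξ k) := Integrable.fintype_prod hgint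
  -- The last Gamma factor is unfolded as an integral over `r`. Integrating over `r` first returns
  -- the Barnes integrand. Integrating over `ξ` first gives, by Cahen-Mellin, `exp (-r A_k)` for
  -- each `k`, so that the integral over `r` becomes the Gamma integral of `A₀ + ∑ A_k`. The
  -- hypothesis `hw` is convergence at `r = 0`.
  set F : ℝ → (κ → ℝ) → ℂ := fun r ξ => (r : ℂ) ^ (w - 1) * Complex.exp (-(A₀ * r)) *
    ((∏ k, (r : ℂ) ^ MonomialData.line σ ξ k) * ∏ k, g k (ξ k)) with hF
  have hline : ∀ ξ : κ → ℝ, (∑ k, MonomialData.line σ ξ k).re = ∑ k, σ k := by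
    intro ξ; simp [MonomialData.line]
  have hFint : Integrable (Function.uncurry F) ((volume.restrict (Ioi (0 : ℝ))).prod volume) := by
    have h1 : Integrable (fun r : ℝ => r ^ (w.re + ∑ k, σ k - 1) * Real.exp (-(A₀ * r)))
        (volume.restrict (Ioi (0 : ℝ))) := integrableOn_rpow_mul_exp_neg hw hA₀
    have hgm : Measurable fun ξ : κ → ℝ => ∏ k, g k (ξ k) := by
      refine Finset.measurable_prod _ fun k _ => ?_
      have := (continuous_Gamma_neg_line (hσ k)).measurable
      have h2 : Measurable (g k) := this.mul (by fun_prop)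
      exact h2.comp (measurable_pi_apply k)
    refine (h1.mul_prod hgprod.norm).mono' (Measurable.aestronglyMeasurable ?_) ?_
    · refine Measurable.mul (by fun_prop) (Measurable.mul ?_ (hgm.comp measurable_snd))
      refine Finset.measurable_prod _ fun k _ => ?_
      simp only [MonomialData.line]
      fun_prop
    · have : ∀ᵐ p : ℝ × (κ → ℝ) ∂(volume.restrict (Ioi (0 : ℝ))).prod volume, p.1 ∈ Ioi (0 : ℝ) :=
        Measure.quasiMeasurePreserving_fst.ae (ae_restrict_mem measurableSet_Ioi)
      filter_upwards [this] with p hp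
      obtain ⟨r, ξ⟩ := p
      have hr : 0 < r := hp
      have hr0 : (r : ℂ) ≠ 0 := by exact_mod_cast hr.ne'
      simp only [Function.uncurry, hF]
      rw [← cpow_sum _ hr0, norm_mul, norm_mul, norm_mul, Complex.norm_cpow_eq_rpow_re_of_pos hr,
        Complex.norm_cpow_eq_rpow_re_of_pos hr, Complex.norm_exp, hline]
      refine le_of_eq ?_
      have e1 : r ^ (w.re + ∑ k, σ k - 1) = r ^ ((w - 1).re) * r ^ (∑ k, σ k) := by
        rw [← Real.rpow_add hr]; congr 1; simp; ring
      rw [e1]; simp; ring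
  have hswap := integral_integral_swap hFint
  have hleft : ∀ r ∈ Ioi (0 : ℝ), (1 / (2 * (Real.pi : ℂ))) ^ Fintype.card κ * ∫ ξ, F r ξ =
      (r : ℂ) ^ (w - 1) * Complex.exp (-(((A₀ + ∑ k, A k : ℝ) : ℂ) * r)) := by
    intro r hr
    have hr : 0 < r := hr
    have e1 : ∀ ξ, F r ξ = (r : ℂ) ^ (w - 1) * Complex.exp (-(A₀ * r)) *
        ∏ k, Complex.Gamma (-((σ k : ℂ) + Complex.I * (ξ k : ℂ))) *
          ((r * A k : ℝ) : ℂ) ^ ((σ k : ℂ) + Complex.I * (ξ k : ℂ)) := by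
      intro ξ
      simp only [hF, hg]
      rw [← Finset.prod_mul_distrib]
      congr 1
      refine Finset.prod_congr rfl fun k _ => ?_
      rw [ofReal_mul_cpow hr (hA k), MonomialData.line]; ring
    simp_rw [e1]
    rw [integral_const_mul, integral_fintype_prod_volume_eq_prod (fun k (η : ℝ) =>
        Complex.Gamma (-((σ k : ℂ) + Complex.I * (η : ℂ))) *
          ((r * A k : ℝ) : ℂ) ^ ((σ k : ℂ) + Complex.I * (η : ℂ))),
      mul_left_comm, ← Finset.card_univ, ← Finset.prod_const, ← Finset.prod_mul_distrib]
    have e2 : ∀ k, (1 / (2 * (Real.pi : ℂ))) * ∫ η : ℝ,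
        Complex.Gamma (-((σ k : ℂ) + Complex.I * (η : ℂ))) *
          ((r * A k : ℝ) : ℂ) ^ ((σ k : ℂ) + Complex.I * (η : ℂ)) =
        Complex.exp (-((r * A k : ℝ) : ℂ)) := fun k =>
      integral_Gamma_mul_cpow (hσ k) (hσ1 k) (by simpa using mul_pos hr (hA k))
    simp_rw [e2]
    rw [← Complex.exp_sum, mul_assoc, ← Complex.exp_add]
    congr 2
    push_cast
    rw [Finset.sum_neg_distrib, ← Finset.mul_sum]; ring
  have hright : ∀ ξ : κ → ℝ, ∫ r in Ioi (0 : ℝ), F r ξ =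
      (∏ k, Complex.Gamma (-(MonomialData.line σ ξ k)) * (A k : ℂ) ^ MonomialData.line σ ξ k) *
        (Complex.Gamma (w + ∑ k, MonomialData.line σ ξ k) *
          (A₀ : ℂ) ^ (-(w + ∑ k, MonomialData.line σ ξ k))) := by
    intro ξ
    rw [← integral_cpow_mul_exp_neg_mul_Ioi' (by rw [Complex.add_re, hline]; exact hw)
      (by simpa using hA₀), ← integral_const_mul]
    refine setIntegral_congr_fun measurableSet_Ioi fun r hr => ?_
    have hr : 0 < r := hr
    have hr0 : (r : ℂ) ≠ 0 := by exact_mod_cast hr.ne'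
    simp only [hF]
    rw [← cpow_sum _ hr0, show w + ∑ k, MonomialData.line σ ξ k - 1 =
      (w - 1) + ∑ k, MonomialData.line σ ξ k by ring, Complex.cpow_add _ _ hr0]
    simp only [hg, MonomialData.line]
    ring
  simp_rw [← hright]
  rw [← hswap, ← integral_const_mul, setIntegral_congr_fun measurableSet_Ioi hleft,
    integral_cpow_mul_exp_neg_mul_Ioi' hw0 (by simpa using hS)]

lemma one_add_abs_sum_le {ι : Type*} (s : Finset ι) (f : ι → ℝ) :
    1 + |∑ i ∈ s, f i| ≤ ∏ i ∈ s, (1 + |f i|) := by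
  classical
  induction s using Finset.induction_on with
  | empty => simp
  | insert a s ha ih =>
    rw [Finset.sum_insert ha, Finset.prod_insert ha]
    have := abs_add_le (f a) (∑ i ∈ s, f i)
    nlinarith [abs_nonneg (f a), abs_nonneg (∑ i ∈ s, f i)]

lemma sum_le_of_nonpos {ι : Type*} [Fintype ι] {f : ι → ℝ} (hf : ∀ i, f i ≤ 0) (k : ι) :
    ∑ i, f i ≤ f k := by
  have := Finset.single_le_sum (f := fun i => -f i) (fun i _ => by linarith [hf i]) (Finset.mem_univ k)
  rw [Finset.sum_neg_distrib] at this
  linarith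

/-- With `X = ∑ |Im x_k|` and `h = |Im ∑ x_k|`, the Gamma factors give `exp (-π (X - h) / 2)`. This
exponent vanishes when all the imaginary parts have one sign, so powers of `X` cannot be absorbed
outright. They are traded for powers of `h` through `1 + X ≤ (1 + (X - h)) (1 + h)`; on the contour
`h` is controlled by the other variables. -/
theorem exists_norm_barnes_le {κ : Type*} [Fintype κ] [Nonempty κ] {A : κ → ℝ} (hA : ∀ k, 0 < A k)
    {σ : κ → ℝ} (hσ : ∀ k, σ k < 0) (hσ1 : -1 < ∑ k, σ k) :
    ∃ C : ℝ, ∃ N : ℕ, 0 < C ∧ ∀ x : κ → ℂ, (∀ k, (x k).re = σ k) →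
      ‖(∏ k, (A k : ℂ) ^ x k * Complex.Gamma (-x k)) / Complex.Gamma (-∑ k, x k)‖ ≤
        C * (1 + |(∑ k, x k).im|) ^ N * ∏ k, (1 + (x k).im ^ 2)⁻¹ := by
  have hσk : ∀ k, -1 ≤ σ k := by
    intro k
    linarith [sum_le_of_nonpos (fun j => (hσ j).le) k]
  have hneg : ∑ k, σ k < 0 := Finset.sum_neg (fun k _ => hσ k) Finset.univ_nonempty
  choose C hC hCb using fun k => exists_norm_Gamma_le (σ := -σ k) (by linarith [hσ k]) (by linarith [hσk k])
  obtain ⟨C', hC', hCb'⟩ := exists_norm_inv_Gamma_le (σ := -∑ k, σ k) (by linarith) (by linarith)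
  set n := Fintype.card κ with hn
  -- `n` powers of `1 + X` come from the Gamma bounds and `2 n` from the decay `∏ (1 + (Im x_k)²)⁻¹`
  -- that is to be extracted.
  set N := 3 * n with hN
  refine ⟨(∏ k, A k ^ σ k * C k) * C' * (Nat.factorial N * Real.exp 1), N + 1, ?_, fun x hx => ?_⟩
  · have : 0 < ∏ k, A k ^ σ k * C k := Finset.prod_pos fun k _ => by
      have := hA k; have := hC k; positivity
    positivity
  set X := ∑ k, |(x k).im| with hX
  set h := |(∑ k, x k).im| with hh
  have hXk : ∀ k, |(x k).im| ≤ X := fun k =>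
    Finset.single_le_sum (f := fun k => |(x k).im|) (fun i _ => abs_nonneg _) (Finset.mem_univ k)
  have hX0 : 0 ≤ X := Finset.sum_nonneg fun k _ => abs_nonneg _
  have hhX : h ≤ X := by rw [hh, Complex.im_sum]; exact Finset.abs_sum_le_sum_abs _ _
  have hh0 : 0 ≤ h := abs_nonneg _
  have hprod : ‖∏ k, (A k : ℂ) ^ x k * Complex.Gamma (-x k)‖ ≤
      (∏ k, A k ^ σ k * C k) * (1 + X) ^ n * Real.exp (-(Real.pi / 2 * X)) := by
    have : ∀ k, ‖(A k : ℂ) ^ x k * Complex.Gamma (-x k)‖ ≤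
        A k ^ σ k * C k * (1 + X) * Real.exp (-(Real.pi / 2 * |(x k).im|)) := by
      intro k
      rw [norm_mul, Complex.norm_cpow_eq_rpow_re_of_pos (hA k), hx k]
      have h1 := hCb k (-x k) (by simp [hx k])
      simp only [Complex.neg_im, abs_neg] at h1
      have h2 := hXk k
      have := hA k
      have := hC k
      calc _ ≤ A k ^ σ k * (C k * (1 + |(x k).im|) * Real.exp (-(Real.pi / 2 * |(x k).im|))) := by
            gcongr
        _ ≤ A k ^ σ k * (C k * (1 + X) * Real.exp (-(Real.pi / 2 * |(x k).im|))) := by gcongr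
        _ = _ := by ring
    rw [norm_prod]
    refine (Finset.prod_le_prod (fun _ _ => norm_nonneg _) fun k _ => this k).trans (le_of_eq ?_)
    rw [Finset.prod_mul_distrib, Finset.prod_mul_distrib, ← Real.exp_sum, Finset.prod_const,
      Finset.card_univ, Finset.sum_neg_distrib, ← Finset.mul_sum]
  have hinv : ‖(Complex.Gamma (-∑ k, x k))⁻¹‖ ≤ C' * (1 + h) * Real.exp (Real.pi / 2 * h) := by
    have := hCb' (-∑ k, x k) (by simp [hx])
    simpa only [Complex.neg_im, abs_neg] using this
  have hexp : (1 + X) ^ N * Real.exp (-(X - h)) ≤ Nat.factorial N * Real.exp 1 * (1 + h) ^ N := by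
    have h1 : 1 + X ≤ (1 + (X - h)) * (1 + h) := by nlinarith
    have h2 : (1 + (X - h)) ^ N ≤ Nat.factorial N * Real.exp (1 + (X - h)) := by
      have := Real.pow_div_factorial_le_exp (1 + (X - h)) (by linarith) N
      rwa [div_le_iff₀' (by positivity)] at this
    calc _ ≤ ((1 + (X - h)) * (1 + h)) ^ N * Real.exp (-(X - h)) := by gcongr
      _ = (1 + (X - h)) ^ N * (1 + h) ^ N * Real.exp (-(X - h)) := by rw [mul_pow]
      _ ≤ (Nat.factorial N * Real.exp (1 + (X - h))) * (1 + h) ^ N * Real.exp (-(X - h)) := by gcongr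
      _ = Nat.factorial N * (Real.exp (1 + (X - h)) * Real.exp (-(X - h))) * (1 + h) ^ N := by ring
      _ = _ := by rw [← Real.exp_add]; ring_nf
  have hdecay : ∏ k, (1 + (x k).im ^ 2) ≤ (1 + X) ^ (2 * n) := by
    rw [pow_mul, hn, ← Finset.card_univ, ← Finset.prod_const]
    refine Finset.prod_le_prod (fun _ _ => by positivity) fun k _ => ?_
    nlinarith [hXk k, abs_nonneg (x k).im, sq_abs (x k).im]
  have hP : 0 < ∏ k, (1 + (x k).im ^ 2) := Finset.prod_pos fun k _ => by positivity
  have hAC : 0 < ∏ k, A k ^ σ k * C k := Finset.prod_pos fun k _ => by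
    have := hA k; have := hC k; positivity
  rw [div_eq_mul_inv, norm_mul, Finset.prod_inv_distrib, ← div_eq_mul_inv _ (∏ k, (1 + (x k).im ^ 2)),
    le_div_iff₀ hP]
  calc _ ≤ ((∏ k, A k ^ σ k * C k) * (1 + X) ^ n * Real.exp (-(Real.pi / 2 * X))) *
        (C' * (1 + h) * Real.exp (Real.pi / 2 * h)) * (1 + X) ^ (2 * n) := by gcongr
    _ = (∏ k, A k ^ σ k * C k) * C' * (1 + h) * ((1 + X) ^ N * Real.exp (-(Real.pi / 2 * (X - h)))) := by
        rw [show -(Real.pi / 2 * (X - h)) = -(Real.pi / 2 * X) + Real.pi / 2 * h by ring, Real.exp_add,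
          show N = n + 2 * n by omega, pow_add]; ring
    _ ≤ (∏ k, A k ^ σ k * C k) * C' * (1 + h) * ((1 + X) ^ N * Real.exp (-(X - h))) := by
        have : X - h ≤ Real.pi / 2 * (X - h) :=
          le_mul_of_one_le_left (by linarith) (by linarith [Real.pi_gt_three])
        gcongr
    _ ≤ (∏ k, A k ^ σ k * C k) * C' * (1 + h) * (Nat.factorial N * Real.exp 1 * (1 + h) ^ N) := by
        gcongr
    _ = _ := by ring

lemma mul_ofReal_cpow {z : ℂ} (hz : z ≠ 0) {r : ℝ} (hr : 0 < r) (s : ℂ) :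
    (z * (r : ℂ)) ^ s = z ^ s * (r : ℂ) ^ s := by
  have hr0 : (r : ℂ) ≠ 0 := by exact_mod_cast hr.ne'
  rw [mul_comm, Complex.cpow_def_of_ne_zero (mul_ne_zero hr0 hz), Complex.log_ofReal_mul hr hz,
    Complex.cpow_def_of_ne_zero hz, Complex.cpow_def_of_ne_zero hr0, ← Complex.exp_add,
    Complex.ofReal_log hr.le]
  congr 1; ring

/-! ### The Mellin-Barnes kernel on the contour. -/

namespace MonomialData

variable {L KU KR KI : Type*} [Fintype L] [Fintype KU] [Fintype KR] [Fintype KI]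

lemma line_re {ι : Type*} (τ η : ι → ℝ) (k : ι) : (line τ η k).re = τ k := by simp [line]

lemma line_im {ι : Type*} (τ η : ι → ℝ) (k : ι) : (line τ η k).im = η k := by simp [line]

/-- The product of Gamma functions and of powers of the numbers `A k` in the Mellin representation. -/
noncomputable def barnesKernel (A : KU → ℝ) (x : KU → ℂ) (yR : KR → ℂ) (yI : KI → ℂ) : ℂ :=
  (∏ k, (A k : ℂ) ^ x k * Complex.Gamma (-x k)) / Complex.Gamma (-∑ k, x k) *
    ((∏ k, Complex.Gamma (-yR k)) * (∏ k, Complex.Gamma (-yI k)))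

variable [DecidableEq KU]

/-- The variables `x` on the contour through `q`. -/
noncomputable abbrev contourX (M : MonomialData L KU KR KI) (D : ℂ)
    (q : (KU → ℝ) × (KR → ℝ) × (KI → ℝ)) (k₀ : KU)
    (η : ({k : KU // k ≠ k₀} → ℝ) × (KR → ℝ) × (KI → ℝ)) : KU → ℂ :=
  M.xLine D k₀ q.1 η.1 (line q.2.1 η.2.1) (line q.2.2 η.2.2)

variable (M : MonomialData L KU KR KI) {D : ℂ} {q : (KU → ℝ) × (KR → ℝ) × (KI → ℝ)} (k₀ : KU)
  (η : ({k : KU // k ≠ k₀} → ℝ) × (KR → ℝ) × (KI → ℝ))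

lemma xLine_of_ne (σ : KU → ℝ) (ξ : {k : KU // k ≠ k₀} → ℝ) (yR : KR → ℂ) (yI : KI → ℂ)
    (k : {k : KU // k ≠ k₀}) :
    M.xLine D k₀ σ ξ yR yI k = line (fun k : {k : KU // k ≠ k₀} => σ k) ξ k := by
  simp [xLine, line, k.2]

/-- This is the exponent `-(w + ∑ …)` of the distinguished number `A₀` in
`integral_prod_Gamma_mul_cpow`, with `w = D / 2 + ∑ y`. -/
lemma xLine_self (σ : KU → ℝ) (ξ : {k : KU // k ≠ k₀} → ℝ) (yR : KR → ℂ) (yI : KI → ℂ) :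
    M.xLine D k₀ σ ξ yR yI k₀ = -((D / 2 + (∑ j, yR j + ∑ j, yI j)) +
      ∑ j, line (fun k : {k : KU // k ≠ k₀} => σ k) ξ j) := by
  simp only [xLine, ne_eq, not_true_eq_false, dite_false]
  have : ∀ a b c : ℂ, -a / 2 - b - c = -((a / 2 + b) + c) := by intros; ring
  rw [this]
  congr!

lemma sum_xLine (σ : KU → ℝ) (ξ : {k : KU // k ≠ k₀} → ℝ) (yR : KR → ℂ) (yI : KI → ℂ) :
    ∑ k, M.xLine D k₀ σ ξ yR yI k = -(D / 2 + (∑ j, yR j + ∑ j, yI j)) := by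
  rw [Fintype.sum_eq_add_sum_subtype_ne _ k₀, xLine_self]
  simp_rw [xLine_of_ne]
  ring

lemma contourX_re (hq : q ∈ M.Delta D) (k : KU) : (M.contourX D q k₀ η k).re = q.1 k := by
  by_cases hk : k = k₀
  · subst hk
    rw [contourX, xLine_self]
    have h := hq.2.2.2.1
    rw [Fintype.sum_eq_add_sum_subtype_ne _ k] at h
    simp [line]
    linarith
  · have := M.xLine_of_ne (D := D) k₀ q.1 η.1 (line q.2.1 η.2.1) (line q.2.2 η.2.2) ⟨k, hk⟩
    rw [contourX, this, line_re]

lemma contourX_im_of_ne (k : {k : KU // k ≠ k₀}) : (M.contourX D q k₀ η k).im = η.1 k := by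
  rw [contourX, xLine_of_ne, line_im]

lemma sum_contourX_im : (∑ k, M.contourX D q k₀ η k).im =
    -(D.im / 2 + (∑ j, η.2.1 j + ∑ j, η.2.2 j)) := by
  rw [sum_xLine]; simp [line]

/-- All real parts are negative and their total is `-Re D / 2 > -1`, so no partial sum can reach
`-1`. The Gamma bounds, valid for small positive abscissas, then apply to every factor. -/
lemma neg_one_lt_of_mem_Delta (hD : D ∈ strip) (hq : q ∈ M.Delta D) :
    -1 < ∑ k, q.1 k ∧ (∀ k, -1 < q.2.1 k) := by
  obtain ⟨h1, h2, h3, h4, -⟩ := hq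
  have hs1 : ∑ k, q.1 k ≤ 0 := Finset.sum_nonpos fun k _ => (h1 k).le
  have hs2 : ∑ k, q.2.1 k ≤ 0 := Finset.sum_nonpos fun k _ => (h2 k).le
  have hs3 : ∑ k, q.2.2 k ≤ 0 := Finset.sum_nonpos fun k _ => (h3 k).2.le
  have hD2 := hD.2
  refine ⟨by linarith, fun k => ?_⟩
  linarith [sum_le_of_nonpos (fun j => (h2 j).le) k]

/-- The imaginary part of `∑ x_k` is fixed by `D` and the `y`, so the growth left by
`exists_norm_barnes_le` is a polynomial in the `η` of the `y`. For `y^R` the decay of `Γ(-y^R)`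
absorbs it, since powers of positive numbers do not grow. For `y^I` the factor `exp (-π |η| / 2)` is
kept intact: the powers of complex numbers may need all of it. -/
theorem exists_norm_barnesKernel_le (hD : D ∈ strip) (hq : q ∈ M.Delta D) {A : KU → ℝ}
    (hA : ∀ k, 0 < A k) : ∃ C : ℝ, ∃ N : ℕ, 0 < C ∧
      ∀ η : ({k : KU // k ≠ k₀} → ℝ) × (KR → ℝ) × (KI → ℝ),
      ‖barnesKernel A (M.contourX D q k₀ η) (line q.2.1 η.2.1) (line q.2.2 η.2.2)‖ ≤
        C * ((∏ k, (1 + η.1 k ^ 2)⁻¹) * ((∏ k, (1 + η.2.1 k ^ 2)⁻¹) *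
          ∏ k, ((1 + |η.2.2 k|) ^ N * Real.exp (-(Real.pi / 2 * |η.2.2 k|))))) := by
  have : Nonempty KU := ⟨k₀⟩
  obtain ⟨hs, hτR⟩ := M.neg_one_lt_of_mem_Delta hD hq
  obtain ⟨C₁, N, hC₁, hb⟩ := exists_norm_barnes_le hA hq.1 hs
  choose CR hCR hbR using fun k => exists_norm_Gamma_neg_line_le (hq.2.1 k) (hτR k).le
  choose CI hCI hbI using fun k => exists_norm_Gamma_neg_line_le (hq.2.2.1 k).2 (hq.2.2.1 k).1.le
  -- The constant of `one_add_abs_pow_mul_exp_le` for `δ = π / 2` and degree `N + 1`: `N` from the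
  -- growth in `∑ x_k` and one from the bound of `Γ(-y^R)`.
  set E : ℝ := Nat.factorial (N + 1 + 2) * Real.exp 1 * (1 + (Real.pi / 2)⁻¹) ^ (N + 1 + 2) with hE
  have hE0 : 0 < E := by positivity
  have hCRp : 0 < ∏ k, CR k := Finset.prod_pos fun k _ => hCR k
  have hCIp : 0 < ∏ k, CI k := Finset.prod_pos fun k _ => hCI k
  refine ⟨C₁ * (1 + |D.im / 2|) ^ N * (∏ k, CR k) * (∏ k, CI k) * E ^ Fintype.card KR, N + 1,
    by positivity, fun η => ?_⟩
  have h1 := hb (M.contourX D q k₀ η) (M.contourX_re k₀ η hq)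
  -- The factor at `k₀` belongs to no integration variable and is bounded by 1.
  have hprod : ∏ k, (1 + (M.contourX D q k₀ η k).im ^ 2)⁻¹ ≤ ∏ k, (1 + η.1 k ^ 2)⁻¹ := by
    rw [Fintype.prod_eq_mul_prod_subtype_ne _ k₀]
    simp_rw [contourX_im_of_ne]
    refine mul_le_of_le_one_left (Finset.prod_nonneg fun k _ => by positivity) (inv_le_one_of_one_le₀ ?_)
    nlinarith [sq_nonneg (M.contourX D q k₀ η k₀).im]
  have him : 1 + |(∑ k, M.contourX D q k₀ η k).im| ≤
      (1 + |D.im / 2|) * ((∏ k, (1 + |η.2.1 k|)) * ∏ k, (1 + |η.2.2 k|)) := by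
    rw [sum_contourX_im, abs_neg]
    have e1 := one_add_abs_sum_le Finset.univ η.2.1
    have e2 := one_add_abs_sum_le Finset.univ η.2.2
    have e3 := abs_add_three (D.im / 2) (∑ j, η.2.1 j) (∑ j, η.2.2 j)
    rw [← add_assoc]
    have p1 := abs_nonneg (∑ j, η.2.1 j)
    have p2 := abs_nonneg (∑ j, η.2.2 j)
    calc 1 + |D.im / 2 + ∑ j, η.2.1 j + ∑ j, η.2.2 j|
        ≤ (1 + |D.im / 2|) * ((1 + |∑ j, η.2.1 j|) * (1 + |∑ j, η.2.2 j|)) := by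
          nlinarith [abs_nonneg (D.im / 2), mul_nonneg p1 p2]
      _ ≤ _ := by gcongr
  have hR : ‖∏ k, Complex.Gamma (-line q.2.1 η.2.1 k)‖ ≤
      (∏ k, CR k) * ∏ k, ((1 + |η.2.1 k|) * Real.exp (-(Real.pi / 2 * |η.2.1 k|))) := by
    rw [norm_prod, ← Finset.prod_mul_distrib]
    refine Finset.prod_le_prod (fun _ _ => norm_nonneg _) fun k _ => ?_
    rw [← mul_assoc]; exact hbR k (η.2.1 k)
  have hI : ‖∏ k, Complex.Gamma (-line q.2.2 η.2.2 k)‖ ≤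
      (∏ k, CI k) * ∏ k, ((1 + |η.2.2 k|) * Real.exp (-(Real.pi / 2 * |η.2.2 k|))) := by
    rw [norm_prod, ← Finset.prod_mul_distrib]
    refine Finset.prod_le_prod (fun _ _ => norm_nonneg _) fun k _ => ?_
    rw [← mul_assoc]; exact hbI k (η.2.2 k)
  have hRdec : (∏ k, (1 + |η.2.1 k|)) ^ N *
      ∏ k, ((1 + |η.2.1 k|) * Real.exp (-(Real.pi / 2 * |η.2.1 k|))) ≤
      E ^ Fintype.card KR * ∏ k, (1 + η.2.1 k ^ 2)⁻¹ := by
    rw [← Finset.prod_pow, ← Finset.prod_mul_distrib, ← Finset.card_univ, ← Finset.prod_const,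
      ← Finset.prod_mul_distrib]
    refine Finset.prod_le_prod (fun _ _ => by positivity) fun k _ => ?_
    have := one_add_abs_pow_mul_exp_le (N + 1) (δ := Real.pi / 2) (by positivity) (η.2.1 k)
    rw [← mul_assoc, ← pow_succ]
    exact this
  have hIdec : (∏ k, (1 + |η.2.2 k|)) ^ N *
      ∏ k, ((1 + |η.2.2 k|) * Real.exp (-(Real.pi / 2 * |η.2.2 k|))) =
      ∏ k, ((1 + |η.2.2 k|) ^ (N + 1) * Real.exp (-(Real.pi / 2 * |η.2.2 k|))) := by
    rw [← Finset.prod_pow, ← Finset.prod_mul_distrib]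
    refine Finset.prod_congr rfl fun k _ => ?_
    rw [← mul_assoc, ← pow_succ]
  rw [barnesKernel, norm_mul, norm_mul]
  have pp1 : 0 ≤ ∏ k, (1 + |η.2.1 k|) := Finset.prod_nonneg fun _ _ => by positivity
  have pp2 : 0 ≤ ∏ k, (1 + |η.2.2 k|) := Finset.prod_nonneg fun _ _ => by positivity
  have pp3 : 0 ≤ ∏ k, (1 + η.1 k ^ 2)⁻¹ := Finset.prod_nonneg fun _ _ => by positivity
  have pp4 : 0 ≤ ∏ k, ((1 + |η.2.1 k|) * Real.exp (-(Real.pi / 2 * |η.2.1 k|))) :=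
    Finset.prod_nonneg fun _ _ => by positivity
  have pp5 : 0 ≤ ∏ k, ((1 + |η.2.2 k|) * Real.exp (-(Real.pi / 2 * |η.2.2 k|))) :=
    Finset.prod_nonneg fun _ _ => by positivity
  have pp6 : 0 ≤ ∏ k, (1 + (M.contourX D q k₀ η k).im ^ 2)⁻¹ :=
    Finset.prod_nonneg fun _ _ => by positivity
  calc _ ≤ (C₁ * ((1 + |D.im / 2|) * ((∏ k, (1 + |η.2.1 k|)) * ∏ k, (1 + |η.2.2 k|))) ^ N *
          ∏ k, (1 + η.1 k ^ 2)⁻¹) *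
        (((∏ k, CR k) * ∏ k, ((1 + |η.2.1 k|) * Real.exp (-(Real.pi / 2 * |η.2.1 k|)))) *
        ((∏ k, CI k) * ∏ k, ((1 + |η.2.2 k|) * Real.exp (-(Real.pi / 2 * |η.2.2 k|))))) := by
        refine mul_le_mul (h1.trans ?_) (mul_le_mul hR hI (norm_nonneg _) (by positivity))
          (by positivity) (by positivity)
        gcongr
    _ = C₁ * (1 + |D.im / 2|) ^ N * (∏ k, CR k) * (∏ k, CI k) * (∏ k, (1 + η.1 k ^ 2)⁻¹) *
        (((∏ k, (1 + |η.2.1 k|)) ^ N *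
          ∏ k, ((1 + |η.2.1 k|) * Real.exp (-(Real.pi / 2 * |η.2.1 k|)))) *
        ((∏ k, (1 + |η.2.2 k|)) ^ N *
          ∏ k, ((1 + |η.2.2 k|) * Real.exp (-(Real.pi / 2 * |η.2.2 k|))))) := by
        rw [mul_pow, mul_pow]; ring
    _ ≤ C₁ * (1 + |D.im / 2|) ^ N * (∏ k, CR k) * (∏ k, CI k) * (∏ k, (1 + η.1 k ^ 2)⁻¹) *
        ((E ^ Fintype.card KR * ∏ k, (1 + η.2.1 k ^ 2)⁻¹) *
        ((∏ k, (1 + |η.2.2 k|)) ^ N *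
          ∏ k, ((1 + |η.2.2 k|) * Real.exp (-(Real.pi / 2 * |η.2.2 k|))))) := by
        gcongr
    _ = _ := by rw [hIdec]; ring

lemma continuous_Gamma_comp {X : Type*} [TopologicalSpace X] {g : X → ℂ} (hg : Continuous g)
    (hpos : ∀ η, 0 < (g η).re) : Continuous fun η => Complex.Gamma (g η) := by
  rw [continuous_iff_continuousAt]
  intro η
  refine ContinuousAt.comp (f := g) (Complex.continuousAt_Gamma _ fun m hm => ?_) hg.continuousAt
  have h1 := hpos η
  rw [hm] at h1
  simp at h1
  linarith [(Nat.cast_nonneg m : (0 : ℝ) ≤ m)]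

lemma continuous_contourX (k : KU) : Continuous fun η => M.contourX D q k₀ η k := by
  have hy : Continuous fun η : ({k : KU // k ≠ k₀} → ℝ) × (KR → ℝ) × (KI → ℝ) =>
      (∑ j, line q.2.1 η.2.1 j + ∑ j, line q.2.2 η.2.2 j) := by
    simp only [line]; fun_prop
  by_cases hk : k = k₀
  · subst hk
    simp_rw [contourX, xLine_self]
    refine ((continuous_const.add hy).add ?_).neg
    simp only [line]; fun_prop
  · have : (fun η => M.contourX D q k₀ η k) = fun η =>
        line (fun k : {k : KU // k ≠ k₀} => q.1 k) η.1 ⟨k, hk⟩ := by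
      funext η
      exact M.xLine_of_ne (D := D) k₀ q.1 η.1 (line q.2.1 η.2.1) (line q.2.2 η.2.2) ⟨k, hk⟩
    rw [this]; simp only [line]; fun_prop

lemma measurable_barnesKernel (hq : q ∈ M.Delta D) {A : KU → ℝ} (hA : ∀ k, 0 < A k) :
    Measurable fun η : ({k : KU // k ≠ k₀} → ℝ) × (KR → ℝ) × (KI → ℝ) =>
      barnesKernel A (M.contourX D q k₀ η) (line q.2.1 η.2.1) (line q.2.2 η.2.2) := by
  have : Nonempty KU := ⟨k₀⟩
  refine Continuous.measurable ?_
  unfold barnesKernel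
  refine Continuous.mul (Continuous.div ?_ ?_ fun η => ?_) (Continuous.mul ?_ ?_)
  · refine continuous_finsetProd _ fun k _ => Continuous.mul ?_
      (continuous_Gamma_comp (M.continuous_contourX k₀ k).neg fun η => ?_)
    · exact (M.continuous_contourX k₀ k).const_cpow (Or.inl (by exact_mod_cast (hA k).ne'))
    · rw [Complex.neg_re, contourX_re _ _ _ hq]; linarith [hq.1 k]
  · refine continuous_Gamma_comp (continuous_finsetSum _ fun k _ => M.continuous_contourX k₀ k).neg
      fun η => ?_
    rw [Complex.neg_re, Complex.re_sum]
    simp_rw [M.contourX_re _ _ hq]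
    linarith [Finset.sum_neg (fun k _ => hq.1 k) Finset.univ_nonempty]
  · refine Complex.Gamma_ne_zero_of_re_pos ?_
    rw [Complex.neg_re, Complex.re_sum]
    simp_rw [M.contourX_re _ _ hq]
    linarith [Finset.sum_neg (fun k _ => hq.1 k) Finset.univ_nonempty]
  · refine continuous_finsetProd _ fun k _ => ?_
    exact (continuous_Gamma_neg_line (hq.2.1 k)).comp (by fun_prop :
      Continuous fun η : ({k : KU // k ≠ k₀} → ℝ) × (KR → ℝ) × (KI → ℝ) => η.2.1 k)
  · refine continuous_finsetProd _ fun k _ => ?_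
    exact (continuous_Gamma_neg_line (hq.2.2.1 k).2).comp (by fun_prop :
      Continuous fun η : ({k : KU // k ≠ k₀} → ℝ) × (KR → ℝ) × (KI → ℝ) => η.2.2 k)

lemma integrable_prod_inv_one_add_sq (ι κ κ' : Type*) [Fintype ι] [Fintype κ] [Fintype κ'] :
    Integrable fun η : (ι → ℝ) × (κ → ℝ) × (κ' → ℝ) =>
      (∏ k, (1 + η.1 k ^ 2)⁻¹) * ((∏ k, (1 + η.2.1 k ^ 2)⁻¹) * ∏ k, (1 + η.2.2 k ^ 2)⁻¹) :=
  (Integrable.fintype_prod (f := fun (_ : ι) (x : ℝ) => (1 + x ^ 2)⁻¹)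
    fun _ => integrable_inv_one_add_sq).mul_prod
  ((Integrable.fintype_prod (f := fun (_ : κ) (x : ℝ) => (1 + x ^ 2)⁻¹)
    fun _ => integrable_inv_one_add_sq).mul_prod
  (Integrable.fintype_prod (f := fun (_ : κ') (x : ℝ) => (1 + x ^ 2)⁻¹)
    fun _ => integrable_inv_one_add_sq))

/-- The kernel with powers of numbers `zR > 0` and of complex `zI` in the right half-plane. -/
theorem exists_norm_barnesKernel_mul_cpow_le (hD : D ∈ strip) (hq : q ∈ M.Delta D) {A : KU → ℝ}
    (hA : ∀ k, 0 < A k) : ∃ C : ℝ, ∃ N : ℕ, 0 < C ∧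
      ∀ (η : ({k : KU // k ≠ k₀} → ℝ) × (KR → ℝ) × (KI → ℝ)) (zR : KR → ℝ) (zI : KI → ℂ),
      (∀ k, 0 < zR k) → (∀ k, 0 < (zI k).re) →
      ‖barnesKernel A (M.contourX D q k₀ η) (line q.2.1 η.2.1) (line q.2.2 η.2.2) *
        ((∏ k, (zR k : ℂ) ^ line q.2.1 η.2.1 k) * ∏ k, (zI k) ^ line q.2.2 η.2.2 k)‖ ≤
        C * ((∏ k, zR k ^ q.2.1 k) *
            ∏ k, (‖zI k‖ ^ q.2.2 k * (1 + ‖zI k‖ / (zI k).re) ^ N)) *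
          ((∏ k, (1 + η.1 k ^ 2)⁻¹) * ((∏ k, (1 + η.2.1 k ^ 2)⁻¹) *
          ∏ k, (1 + η.2.2 k ^ 2)⁻¹)) := by
  obtain ⟨C, N, hC, h⟩ := M.exists_norm_barnesKernel_le k₀ hD hq hA
  choose C' hC' h' using fun k => exists_exp_mul_norm_cpow_le (q.2.2 k) N
  have hC'p : 0 < ∏ k, C' k := Finset.prod_pos fun k _ => hC' k
  refine ⟨C * ∏ k, C' k, N + 2, by positivity, fun η zR zI hzR hzI => ?_⟩
  have e1 : ‖∏ k, (zR k : ℂ) ^ line q.2.1 η.2.1 k‖ = ∏ k, zR k ^ q.2.1 k := by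
    rw [norm_prod]
    refine Finset.prod_congr rfl fun k _ => ?_
    rw [Complex.norm_cpow_eq_rpow_re_of_pos (hzR k), line_re]
  have e2 : (∏ k, ((1 + |η.2.2 k|) ^ N * Real.exp (-(Real.pi / 2 * |η.2.2 k|)))) *
      ‖∏ k, (zI k) ^ line q.2.2 η.2.2 k‖ ≤ (∏ k, C' k) *
        (∏ k, (‖zI k‖ ^ q.2.2 k * (1 + ‖zI k‖ / (zI k).re) ^ (N + 2))) *
          ∏ k, (1 + η.2.2 k ^ 2)⁻¹ := by
    rw [norm_prod, ← Finset.prod_mul_distrib, ← Finset.prod_mul_distrib, ← Finset.prod_mul_distrib]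
    exact Finset.prod_le_prod (fun _ _ => by positivity) fun k _ => h' k (zI k) (hzI k) (η.2.2 k)
  have p1 : 0 ≤ ∏ k, zR k ^ q.2.1 k :=
    Finset.prod_nonneg fun k _ => Real.rpow_nonneg (hzR k).le _
  have p2 : 0 ≤ ∏ k, (1 + η.1 k ^ 2)⁻¹ := Finset.prod_nonneg fun _ _ => by positivity
  have p3 : 0 ≤ ∏ k, (1 + η.2.1 k ^ 2)⁻¹ := Finset.prod_nonneg fun _ _ => by positivity
  rw [norm_mul, norm_mul, e1]
  calc _ ≤ C * ((∏ k, (1 + η.1 k ^ 2)⁻¹) * ((∏ k, (1 + η.2.1 k ^ 2)⁻¹) *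
          ∏ k, ((1 + |η.2.2 k|) ^ N * Real.exp (-(Real.pi / 2 * |η.2.2 k|))))) *
          ((∏ k, zR k ^ q.2.1 k) * ‖∏ k, (zI k) ^ line q.2.2 η.2.2 k‖) :=
        mul_le_mul_of_nonneg_right (h η) (by positivity)
    _ = C * (∏ k, zR k ^ q.2.1 k) * ((∏ k, (1 + η.1 k ^ 2)⁻¹) * ((∏ k, (1 + η.2.1 k ^ 2)⁻¹))) *
          ((∏ k, ((1 + |η.2.2 k|) ^ N * Real.exp (-(Real.pi / 2 * |η.2.2 k|)))) *
          ‖∏ k, (zI k) ^ line q.2.2 η.2.2 k‖) := by ring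
    _ ≤ C * (∏ k, zR k ^ q.2.1 k) * ((∏ k, (1 + η.1 k ^ 2)⁻¹) * ((∏ k, (1 + η.2.1 k ^ 2)⁻¹))) *
          _ := mul_le_mul_of_nonneg_left e2 (by positivity)
    _ = _ := by ring

theorem integrable_barnesKernel_mul_cpow (hD : D ∈ strip) (hq : q ∈ M.Delta D) {A : KU → ℝ}
    (hA : ∀ k, 0 < A k) {zR : KR → ℝ} {zI : KI → ℂ} (hzR : ∀ k, 0 < zR k)
    (hzI : ∀ k, 0 < (zI k).re) :
    Integrable fun η : ({k : KU // k ≠ k₀} → ℝ) × (KR → ℝ) × (KI → ℝ) =>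
      barnesKernel A (M.contourX D q k₀ η) (line q.2.1 η.2.1) (line q.2.2 η.2.2) *
        ((∏ k, (zR k : ℂ) ^ line q.2.1 η.2.1 k) * ∏ k, (zI k) ^ line q.2.2 η.2.2 k) := by
  obtain ⟨C, N, -, h⟩ := M.exists_norm_barnesKernel_mul_cpow_le k₀ hD hq hA
  refine ((integrable_prod_inv_one_add_sq _ _ _).const_mul _).mono' ?_
    (ae_of_all _ fun η => h η zR zI hzR hzI)
  refine ((M.measurable_barnesKernel k₀ hq hA).mul (Measurable.mul ?_ ?_)).aestronglyMeasurable
  · refine Finset.measurable_prod _ fun k _ => ?_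
    simp only [line]; fun_prop
  · refine Finset.measurable_prod _ fun k _ => ?_
    simp only [line]; fun_prop

/-- The Mellin-Barnes representation of `U ^ (-D / 2) * exp (-V / U)`, where `U = ∑ k, A k` and
`V = ∑ k, zR k + ∑ k, zI k`. -/
theorem integral_barnesKernel_mul_cpow (hD : D ∈ strip) (hq : q ∈ M.Delta D) {A : KU → ℝ}
    (hA : ∀ k, 0 < A k) {zR : KR → ℝ} {zI : KI → ℂ} (hzR : ∀ k, 0 < zR k)
    (hzI : ∀ k, 0 < (zI k).re) :
    (1 / (2 * (Real.pi : ℂ))) ^ (Fintype.card KU - 1 + Fintype.card KR + Fintype.card KI) *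
      ∫ η : ({k : KU // k ≠ k₀} → ℝ) × (KR → ℝ) × (KI → ℝ),
      barnesKernel A (M.contourX D q k₀ η) (line q.2.1 η.2.1) (line q.2.2 η.2.2) *
        ((∏ k, (zR k : ℂ) ^ line q.2.1 η.2.1 k) * ∏ k, (zI k) ^ line q.2.2 η.2.2 k) =
      ((∑ k, A k : ℝ) : ℂ) ^ (-D / 2) *
        Complex.exp (-(∑ k, (zR k : ℂ) + ∑ k, zI k) / ((∑ k, A k : ℝ) : ℂ)) := by
  have : Nonempty KU := ⟨k₀⟩
  obtain ⟨hs, hτR⟩ := M.neg_one_lt_of_mem_Delta hD hq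
  set c : ℂ := 1 / (2 * (Real.pi : ℂ)) with hc
  set S : ℝ := ∑ k, A k with hS
  have hSpos : 0 < S := Finset.sum_pos (fun k _ => hA k) Finset.univ_nonempty
  have hS0 : (S : ℂ) ≠ 0 := by exact_mod_cast hSpos.ne'
  have hσk : ∀ k, -1 ≤ q.1 k := fun k => by
    linarith [sum_le_of_nonpos (fun j => (hq.1 j).le) k]
  have hcard : Fintype.card {k : KU // k ≠ k₀} = Fintype.card KU - 1 := by
    rw [Fintype.card_subtype_compl, Fintype.card_subtype_eq]
  -- At fixed `y` the integral over the `x` is the Barnes integral with `w = D / 2 + ∑ y`. Since `-∑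
  -- x_k = w`, the Gamma function in the denominator cancels `Γ(w)` and only `S ^ (-w)` is left.
  have hinner : ∀ y : (KR → ℝ) × (KI → ℝ),
      c ^ Fintype.card {k : KU // k ≠ k₀} * ∫ ξ : {k : KU // k ≠ k₀} → ℝ,
        (∏ k, (A k : ℂ) ^ M.contourX D q k₀ (ξ, y) k * Complex.Gamma (-M.contourX D q k₀ (ξ, y) k)) /
          Complex.Gamma (-∑ k, M.contourX D q k₀ (ξ, y) k) =
      (S : ℂ) ^ (-(D / 2 + (∑ j, line q.2.1 y.1 j + ∑ j, line q.2.2 y.2 j))) := by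
    intro y
    set w : ℂ := D / 2 + (∑ j, line q.2.1 y.1 j + ∑ j, line q.2.2 y.2 j) with hw
    have hwre : w.re = -∑ k, q.1 k := by
      have h4 := hq.2.2.2.1
      rw [hw]
      simp [line]
      linarith
    have hw0 : 0 < w.re := by
      rw [hwre]; linarith [Finset.sum_neg (fun k _ => hq.1 k) Finset.univ_nonempty]
    have hG : Complex.Gamma w ≠ 0 := Complex.Gamma_ne_zero_of_re_pos hw0
    have hsplit := Fintype.sum_eq_add_sum_subtype_ne q.1 k₀
    have key := integral_prod_Gamma_mul_cpow (κ := {k : KU // k ≠ k₀}) (A := fun k => A k)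
      (fun k => hA k) (hA k₀) (σ := fun k => q.1 k) (fun k => hq.1 k) (fun k => hσk k) (w := w)
      (by rw [hwre]; linarith [hq.1 k₀])
    have e : ∀ ξ : {k : KU // k ≠ k₀} → ℝ,
        (∏ k, (A k : ℂ) ^ M.contourX D q k₀ (ξ, y) k * Complex.Gamma (-M.contourX D q k₀ (ξ, y) k)) /
          Complex.Gamma (-∑ k, M.contourX D q k₀ (ξ, y) k) = (Complex.Gamma w)⁻¹ *
        ((∏ k : {k : KU // k ≠ k₀}, Complex.Gamma (-(line (fun k : {k : KU // k ≠ k₀} => q.1 k) ξ k)) *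
          (A k : ℂ) ^ line (fun k : {k : KU // k ≠ k₀} => q.1 k) ξ k) *
        (Complex.Gamma (w + ∑ k, line (fun k : {k : KU // k ≠ k₀} => q.1 k) ξ k) *
          (A k₀ : ℂ) ^ (-(w + ∑ k, line (fun k : {k : KU // k ≠ k₀} => q.1 k) ξ k)))) := by
      intro ξ
      rw [sum_xLine, neg_neg, Fintype.prod_eq_mul_prod_subtype_ne _ k₀]
      simp_rw [contourX, xLine_of_ne]
      rw [xLine_self, neg_neg, div_eq_mul_inv, mul_comm]
      congr 1
      rw [mul_comm]
      congr 1
      · exact Finset.prod_congr rfl fun k _ => mul_comm _ _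
      · exact mul_comm _ _
    simp_rw [e]
    rw [integral_const_mul, mul_left_comm, key, inv_mul_cancel_left₀ hG,
      hS, Fintype.sum_eq_add_sum_subtype_ne A k₀]
  have hint := M.integrable_barnesKernel_mul_cpow k₀ hD hq hA hzR hzI
  rw [Measure.volume_eq_prod, integral_prod_symm _ hint, ← hcard, add_assoc, pow_add, mul_right_comm,
    mul_comm, ← integral_const_mul]
  -- The power `S ^ (-w)` splits into `S ^ (-D / 2)` and one factor `S ^ (-y_k)` per variable, which
  -- turns `z_k ^ y_k` into `(z_k / S) ^ y_k`. What remains is a product of one-dimensional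
  -- Cahen-Mellin integrals.
  have e3 : ∀ y : (KR → ℝ) × (KI → ℝ), c ^ Fintype.card {k : KU // k ≠ k₀} *
      ∫ ξ : {k : KU // k ≠ k₀} → ℝ, barnesKernel A (M.contourX D q k₀ (ξ, y)) (line q.2.1 y.1)
        (line q.2.2 y.2) *
        ((∏ k, (zR k : ℂ) ^ line q.2.1 y.1 k) * ∏ k, (zI k) ^ line q.2.2 y.2 k) =
      (S : ℂ) ^ (-D / 2) *
        ((∏ k, Complex.Gamma (-((q.2.1 k : ℂ) + Complex.I * (y.1 k : ℂ))) *
          ((zR k : ℂ) * ((S⁻¹ : ℝ) : ℂ)) ^ ((q.2.1 k : ℂ) + Complex.I * (y.1 k : ℂ))) *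
        (∏ k, Complex.Gamma (-((q.2.2 k : ℂ) + Complex.I * (y.2 k : ℂ))) *
          (zI k * ((S⁻¹ : ℝ) : ℂ)) ^ ((q.2.2 k : ℂ) + Complex.I * (y.2 k : ℂ)))) := by
    intro y
    simp only [barnesKernel]
    simp_rw [mul_assoc]
    rw [integral_mul_const, ← mul_assoc, hinner y]
    have hSi : (0 : ℝ) < S⁻¹ := inv_pos.2 hSpos
    have e4 : ∀ s : ℂ, ((S⁻¹ : ℝ) : ℂ) ^ s = (S : ℂ) ^ (-s) := by
      intro s
      rw [Complex.ofReal_inv, Complex.inv_cpow, Complex.cpow_neg]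
      rw [Complex.arg_ofReal_of_nonneg hSpos.le]; exact Real.pi_pos.ne
    have e5 : (∏ k, Complex.Gamma (-((q.2.1 k : ℂ) + Complex.I * (y.1 k : ℂ))) *
          ((zR k : ℂ) * ((S⁻¹ : ℝ) : ℂ)) ^ ((q.2.1 k : ℂ) + Complex.I * (y.1 k : ℂ))) =
        (∏ k, Complex.Gamma (-line q.2.1 y.1 k)) * (∏ k, (zR k : ℂ) ^ line q.2.1 y.1 k) *
          (S : ℂ) ^ (-∑ k, line q.2.1 y.1 k) := by
      rw [← Finset.sum_neg_distrib, cpow_sum _ hS0, ← Finset.prod_mul_distrib, ← Finset.prod_mul_distrib]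
      refine Finset.prod_congr rfl fun k _ => ?_
      rw [mul_ofReal_cpow (by exact_mod_cast (hzR k).ne') hSi, e4, line, mul_assoc]
    have e6 : (∏ k, Complex.Gamma (-((q.2.2 k : ℂ) + Complex.I * (y.2 k : ℂ))) *
          (zI k * ((S⁻¹ : ℝ) : ℂ)) ^ ((q.2.2 k : ℂ) + Complex.I * (y.2 k : ℂ))) =
        (∏ k, Complex.Gamma (-line q.2.2 y.2 k)) * (∏ k, (zI k) ^ line q.2.2 y.2 k) *
          (S : ℂ) ^ (-∑ k, line q.2.2 y.2 k) := by
      rw [← Finset.sum_neg_distrib, cpow_sum _ hS0, ← Finset.prod_mul_distrib, ← Finset.prod_mul_distrib]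
      refine Finset.prod_congr rfl fun k _ => ?_
      have hz0 : zI k ≠ 0 := by intro h0; have := hzI k; simp [h0] at this
      rw [mul_ofReal_cpow hz0 hSi, e4, line, mul_assoc]
    rw [e5, e6, show -(D / 2 + (∑ j, line q.2.1 y.1 j + ∑ j, line q.2.2 y.2 j)) =
      -D / 2 + (-∑ j, line q.2.1 y.1 j + -∑ j, line q.2.2 y.2 j) by ring,
      Complex.cpow_add _ _ hS0, Complex.cpow_add _ _ hS0]
    ring
  have e7 : ∀ (τ : ℝ) (z : ℂ), τ < 0 → -1 ≤ τ → 0 < z.re →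
      c * ∫ η : ℝ, Complex.Gamma (-((τ : ℂ) + Complex.I * (η : ℂ))) *
        (z * ((S⁻¹ : ℝ) : ℂ)) ^ ((τ : ℂ) + Complex.I * (η : ℂ)) = Complex.exp (-(z / S)) := by
    intro τ z h1 h2 h3
    rw [integral_Gamma_mul_cpow h1 h2, Complex.ofReal_inv, div_eq_mul_inv]
    rw [Complex.re_mul_ofReal]
    exact mul_pos h3 (inv_pos.2 hSpos)
  have e8 : ∫ y : (KR → ℝ) × (KI → ℝ),
      ((∏ k, Complex.Gamma (-((q.2.1 k : ℂ) + Complex.I * (y.1 k : ℂ))) *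
          ((zR k : ℂ) * ((S⁻¹ : ℝ) : ℂ)) ^ ((q.2.1 k : ℂ) + Complex.I * (y.1 k : ℂ))) *
        (∏ k, Complex.Gamma (-((q.2.2 k : ℂ) + Complex.I * (y.2 k : ℂ))) *
          (zI k * ((S⁻¹ : ℝ) : ℂ)) ^ ((q.2.2 k : ℂ) + Complex.I * (y.2 k : ℂ)))) =
      (∏ k, ∫ η : ℝ, Complex.Gamma (-((q.2.1 k : ℂ) + Complex.I * (η : ℂ))) *
          ((zR k : ℂ) * ((S⁻¹ : ℝ) : ℂ)) ^ ((q.2.1 k : ℂ) + Complex.I * (η : ℂ))) *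
        (∏ k, ∫ η : ℝ, Complex.Gamma (-((q.2.2 k : ℂ) + Complex.I * (η : ℂ))) *
          (zI k * ((S⁻¹ : ℝ) : ℂ)) ^ ((q.2.2 k : ℂ) + Complex.I * (η : ℂ))) := by
    rw [Measure.volume_eq_prod, integral_prod_mul
      (fun yR : KR → ℝ => ∏ k, Complex.Gamma (-((q.2.1 k : ℂ) + Complex.I * (yR k : ℂ))) *
          ((zR k : ℂ) * ((S⁻¹ : ℝ) : ℂ)) ^ ((q.2.1 k : ℂ) + Complex.I * (yR k : ℂ)))
      (fun yI : KI → ℝ => ∏ k, Complex.Gamma (-((q.2.2 k : ℂ) + Complex.I * (yI k : ℂ))) *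
          (zI k * ((S⁻¹ : ℝ) : ℂ)) ^ ((q.2.2 k : ℂ) + Complex.I * (yI k : ℂ))),
      integral_fintype_prod_volume_eq_prod (fun k (η : ℝ) =>
        Complex.Gamma (-((q.2.1 k : ℂ) + Complex.I * (η : ℂ))) *
          ((zR k : ℂ) * ((S⁻¹ : ℝ) : ℂ)) ^ ((q.2.1 k : ℂ) + Complex.I * (η : ℂ))),
      integral_fintype_prod_volume_eq_prod (fun k (η : ℝ) =>
        Complex.Gamma (-((q.2.2 k : ℂ) + Complex.I * (η : ℂ))) *
          (zI k * ((S⁻¹ : ℝ) : ℂ)) ^ ((q.2.2 k : ℂ) + Complex.I * (η : ℂ)))]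
  simp_rw [e3]
  rw [integral_const_mul, e8, mul_comm, mul_assoc]
  congr 1
  rw [mul_comm, pow_add, mul_mul_mul_comm, ← Finset.card_univ, ← Finset.card_univ,
    ← Finset.prod_const, ← Finset.prod_const, ← Finset.prod_mul_distrib, ← Finset.prod_mul_distrib]
  rw [Finset.prod_congr rfl fun k _ => e7 (q.2.1 k) (zR k) (hq.2.1 k) (hτR k).le (by simpa using hzR k),
    Finset.prod_congr rfl fun k _ => e7 (q.2.2 k) (zI k) (hq.2.2.1 k).2 (hq.2.2.1 k).1.le (hzI k),
    ← Complex.exp_sum, ← Complex.exp_sum, ← Complex.exp_add]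
  congr 1
  rw [Finset.sum_neg_distrib, Finset.sum_neg_distrib, ← Finset.sum_div, ← Finset.sum_div]
  ring

end MonomialData

/-! ### Integrability of powers of the invariants against Schwartz functions. -/

lemma integrableOn_Ioi_rpow_mul_inv {τ : ℝ} (hτ : -1 < τ) (hτ0 : τ ≤ 0) :
    IntegrableOn (fun s : ℝ => s ^ τ * ((1 + |s|) ^ 2)⁻¹) (Ioi 0) := by
  have hm : Measurable fun s : ℝ => s ^ τ * ((1 + |s|) ^ 2)⁻¹ := by fun_prop
  rw [← Ioc_union_Ioi_eq_Ioi zero_le_one]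
  refine IntegrableOn.union ?_ ?_
  · have h1 : IntegrableOn (fun s : ℝ => s ^ τ) (Ioc 0 1) := by
      have := (intervalIntegral.intervalIntegrable_rpow' (a := 0) (b := 1) hτ).1
      simpa using this
    refine h1.mono' hm.aestronglyMeasurable ?_
    filter_upwards [ae_restrict_mem measurableSet_Ioc] with s hs
    have h0 : 0 ≤ s ^ τ := Real.rpow_nonneg hs.1.le _
    rw [Real.norm_of_nonneg (by positivity)]
    refine mul_le_of_le_one_right h0 (inv_le_one_of_one_le₀ ?_)
    nlinarith [abs_nonneg s]
  · refine (integrable_inv_one_add_sq.integrableOn).mono' hm.aestronglyMeasurable ?_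
    filter_upwards [ae_restrict_mem measurableSet_Ioi] with s hs
    have hs : 1 < s := hs
    have h0 : 0 ≤ s ^ τ := Real.rpow_nonneg (by linarith) _
    rw [Real.norm_of_nonneg (by positivity)]
    have h1 : s ^ τ ≤ 1 := Real.rpow_le_one_of_one_le_of_nonpos hs.le hτ0
    refine (mul_le_of_le_one_left (by positivity) h1).trans ?_
    gcongr
    nlinarith [abs_nonneg s, sq_abs s]

lemma integrable_abs_rpow_mul_inv {τ : ℝ} (hτ : -1 < τ) (hτ0 : τ ≤ 0) :
    Integrable (fun s : ℝ => |s| ^ τ * ((1 + |s|) ^ 2)⁻¹) := by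
  have h := integrableOn_Ioi_rpow_mul_inv hτ hτ0
  have h1 : IntegrableOn (fun s : ℝ => |s| ^ τ * ((1 + |s|) ^ 2)⁻¹) (Ioi 0) := by
    refine h.congr_fun (fun s hs => ?_) measurableSet_Ioi
    have hs : 0 < s := hs
    simp only [abs_of_pos hs]
  have h2 : IntegrableOn (fun s : ℝ => |s| ^ τ * ((1 + |s|) ^ 2)⁻¹) (Iic 0) := by
    have := (integrableOn_Ici_iff_integrableOn_Ioi (by simp)).2 h1
    rw [← neg_zero] at this
    simpa using this.comp_neg_Iic
  rw [← integrableOn_univ, ← Iic_union_Ioi (a := (0 : ℝ))]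
  exact h2.union h1

/-- The decay is put in product form so that integrals over the invariants factorize into integrals
over one variable. -/
lemma exists_norm_schwartz_le {κ κ' : Type*} [Fintype κ] [Fintype κ']
    (f : 𝓢((κ → ℝ) × (κ' → ℝ), ℂ)) (N : ℕ) : ∃ C : ℝ, 0 < C ∧ ∀ s,
      ‖f s‖ ≤ C * ((∏ k, ((1 + |s.1 k|) ^ N)⁻¹) * ∏ k, ((1 + |s.2 k|) ^ N)⁻¹) := by
  set n := N * Fintype.card κ + N * Fintype.card κ' with hn
  have h := fun s => SchwartzMap.one_add_le_sup_seminorm_apply (𝕜 := ℝ) (m := (n, 0)) (le_refl n)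
    (le_refl 0) f s
  set C := 2 ^ n * ((Finset.Iic (n, 0)).sup fun m => SchwartzMap.seminorm ℝ m.1 m.2) f with hC
  refine ⟨C + 1, by have := apply_nonneg ((Finset.Iic (n, 0)).sup fun m => SchwartzMap.seminorm ℝ m.1 m.2) f; positivity, fun s => ?_⟩
  have h1 := h s
  rw [norm_iteratedFDeriv_zero] at h1
  have h2 : (∏ k, (1 + |s.1 k|) ^ N) * (∏ k, (1 + |s.2 k|) ^ N) ≤ (1 + ‖s‖) ^ n := by
    rw [hn, pow_add, pow_mul, pow_mul, ← Finset.card_univ, ← Finset.card_univ, ← Finset.prod_const,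
      ← Finset.prod_const]
    gcongr with k _ k _
    · exact (norm_le_pi_norm s.1 k).trans (norm_fst_le s)
    · exact (norm_le_pi_norm s.2 k).trans (norm_snd_le s)
  have hp1 : 0 < ∏ k, (1 + |s.1 k|) ^ N := Finset.prod_pos fun k _ => by positivity
  have hp2 : 0 < ∏ k, (1 + |s.2 k|) ^ N := Finset.prod_pos fun k _ => by positivity
  rw [Finset.prod_inv_distrib, Finset.prod_inv_distrib, ← mul_inv, ← div_eq_mul_inv,
    le_div_iff₀ (by positivity)]
  calc _ ≤ ‖f s‖ * (1 + ‖s‖) ^ n := by gcongr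
    _ ≤ C := by rw [mul_comm]; exact h1
    _ ≤ C + 1 := by linarith

namespace MonomialData

variable {L KU KR KI : Type*} [Fintype L] [Fintype KU] [Fintype KR] [Fintype KI]
  (M : MonomialData L KU KR KI)

lemma invariantDomain_eq : M.invariantDomain = (univ.pi fun _ => Ioi 0) ×ˢ univ := by
  ext s; simp [invariantDomain]

lemma measurableSet_invariantDomain : MeasurableSet M.invariantDomain := by
  rw [invariantDomain_eq]
  exact (MeasurableSet.univ_pi fun _ => measurableSet_Ioi).prod MeasurableSet.univ

lemma restrict_invariantDomain : (volume.restrict M.invariantDomain) =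
    (Measure.pi fun _ : KR => volume.restrict (Ioi (0 : ℝ))).prod
      (volume : Measure (KI → ℝ)) := by
  rw [invariantDomain_eq, Measure.volume_eq_prod, ← Measure.prod_restrict, Measure.restrict_univ,
    volume_pi, Measure.restrict_pi_pi]

lemma ae_snd_ne_zero : ∀ᵐ s : (KR → ℝ) × (KI → ℝ) ∂(volume.restrict M.invariantDomain),
    ∀ k, s.2 k ≠ 0 := by
  refine ae_restrict_of_ae ?_
  rw [ae_all_iff]
  intro k
  exact Measure.quasiMeasurePreserving_snd.ae (Measure.ae_eval_ne _ k 0)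

/-- Exponents above `-1` are integrable at 0, and Schwartz decay of order `N + 2` pays for the
weight `(1 + |s|) ^ N` with two orders to spare. This function is the common majorant of the smeared
powers and of their regularizations. -/
lemma integrableOn_schwartz_mul_rpow (f : 𝓢((KR → ℝ) × (KI → ℝ), ℂ)) {τR : KR → ℝ} {τI : KI → ℝ}
    (hR : ∀ k, -1 < τR k ∧ τR k ≤ 0) (hI : ∀ k, -1 < τI k ∧ τI k ≤ 0) (N : ℕ) :
    IntegrableOn (fun s => ‖f s‖ * ((∏ k, s.1 k ^ τR k) *
      ∏ k, (|s.2 k| ^ τI k * (1 + |s.2 k|) ^ N))) M.invariantDomain := by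
  obtain ⟨C, hC, h⟩ := exists_norm_schwartz_le f (N + 2)
  rw [IntegrableOn]
  have hint : Integrable (fun s : (KR → ℝ) × (KI → ℝ) => (∏ k, (s.1 k ^ τR k * ((1 + |s.1 k|) ^ 2)⁻¹)) *
      ∏ k, (|s.2 k| ^ τI k * ((1 + |s.2 k|) ^ 2)⁻¹)) (volume.restrict M.invariantDomain) := by
    rw [restrict_invariantDomain]
    exact (Integrable.fintype_prod (f := fun k (x : ℝ) => x ^ τR k * ((1 + |x|) ^ 2)⁻¹)
      fun k => integrableOn_Ioi_rpow_mul_inv (hR k).1 (hR k).2).mul_prod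
      (Integrable.fintype_prod (f := fun k (x : ℝ) => |x| ^ τI k * ((1 + |x|) ^ 2)⁻¹)
      fun k => integrable_abs_rpow_mul_inv (hI k).1 (hI k).2)
  refine (hint.const_mul C).mono' ?_ ?_
  · refine Measurable.aestronglyMeasurable (f.continuous.norm.measurable.mul (Measurable.mul ?_ ?_))
    · exact Finset.measurable_prod _ fun k _ => by fun_prop
    · exact Finset.measurable_prod _ fun k _ => by fun_prop
  · filter_upwards [ae_restrict_mem M.measurableSet_invariantDomain] with s hs
    have hp : 0 ≤ ∏ k, s.1 k ^ τR k := Finset.prod_nonneg fun k _ => Real.rpow_nonneg (hs k).le _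
    have hp' : 0 ≤ ∏ k, (|s.2 k| ^ τI k * (1 + |s.2 k|) ^ N) :=
      Finset.prod_nonneg fun k _ => by positivity
    rw [Real.norm_of_nonneg (by positivity)]
    calc _ ≤ (C * ((∏ k, ((1 + |s.1 k|) ^ (N + 2))⁻¹) * ∏ k, ((1 + |s.2 k|) ^ (N + 2))⁻¹)) *
          ((∏ k, s.1 k ^ τR k) * ∏ k, (|s.2 k| ^ τI k * (1 + |s.2 k|) ^ N)) :=
          mul_le_mul_of_nonneg_right (h s) (by positivity)
      _ = C * ((∏ k, (s.1 k ^ τR k * ((1 + |s.1 k|) ^ (N + 2))⁻¹)) *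
          ∏ k, (|s.2 k| ^ τI k * (((1 + |s.2 k|) ^ N) * ((1 + |s.2 k|) ^ (N + 2))⁻¹))) := by
          simp_rw [Finset.prod_mul_distrib]; ring
      _ ≤ C * ((∏ k, (s.1 k ^ τR k * ((1 + |s.1 k|) ^ 2)⁻¹)) *
          ∏ k, (|s.2 k| ^ τI k * ((1 + |s.2 k|) ^ 2)⁻¹)) := by
          gcongr with k _ k _ k _
          · exact Finset.prod_nonneg fun k _ => by
              have := Real.rpow_nonneg (hs k).le (τR k); positivity
          · intro k _; have := Real.rpow_nonneg (hs k).le (τR k); positivity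
          · exact Real.rpow_nonneg (hs k).le _
          · linarith [abs_nonneg (s.1 k)]
          · omega
          · rw [pow_add, mul_inv, mul_inv_cancel_left₀ (by positivity)]

/-- `smearedPower` with `i s` replaced by `ε + i s`. -/
noncomputable def regularizedPower (ε : ℝ) (f : (KR → ℝ) × (KI → ℝ) → ℂ)
    (yR : KR → ℂ) (yI : KI → ℂ) (s : (KR → ℝ) × (KI → ℝ)) : ℂ :=
  f s * (∏ k, ((s.1 k : ℝ) : ℂ) ^ yR k) * ∏ k, ((ε : ℂ) + Complex.I * ((s.2 k : ℝ) : ℂ)) ^ yI k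

lemma regularizedPower_zero (f : 𝓢((KR → ℝ) × (KI → ℝ), ℂ)) (yR : KR → ℂ) (yI : KI → ℂ) :
    regularizedPower 0 f yR yI = M.smearedPower f yR yI := by
  funext s; simp [regularizedPower, smearedPower]

/-- The bound is uniform in `ε ∈ [0, 1]`, as needed for the limit. Since `|s| ≤ |ε + i s| ≤ 1 +
|s|`, the lower estimate serves negative exponents and the upper one the nonnegative exponents that
integration by parts produces; hence the minimum. The argument is at most `π / 2`, which gives the
exponential. -/
lemma norm_cpow_add_I_mul_le {ε : ℝ} (hε : 0 ≤ ε) (hε1 : ε ≤ 1) {s : ℝ} (hs : s ≠ 0) (y : ℂ)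
    {N : ℕ} (hN : y.re ≤ N) :
    ‖((ε : ℂ) + Complex.I * (s : ℂ)) ^ y‖ ≤
      |s| ^ (min y.re 0) * (1 + |s|) ^ N * Real.exp (Real.pi / 2 * |y.im|) := by
  set z : ℂ := (ε : ℂ) + Complex.I * (s : ℂ) with hz
  have hre : z.re = ε := by simp [hz]
  have him : z.im = s := by simp [hz]
  have hz0 : z ≠ 0 := by intro h; rw [h] at him; exact hs (by simpa using him.symm)
  have h1 : |s| ≤ ‖z‖ := by rw [← him]; exact Complex.abs_im_le_norm z
  have h2 : ‖z‖ ≤ 1 + |s| := by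
    refine (Complex.norm_le_abs_re_add_abs_im z).trans ?_
    rw [hre, him, abs_of_nonneg hε]; linarith
  have hs0 : 0 < |s| := abs_pos.2 hs
  have harg : |z.arg| ≤ Real.pi / 2 := Complex.abs_arg_le_pi_div_two_iff.2 (by rw [hre]; exact hε)
  rw [Complex.norm_cpow_of_ne_zero hz0, div_eq_mul_inv, ← Real.exp_neg]
  have e1 : Real.exp (-(z.arg * y.im)) ≤ Real.exp (Real.pi / 2 * |y.im|) := by
    rw [Real.exp_le_exp]
    exact (neg_arg_mul_le z y.im).trans (by gcongr)
  have e2 : ‖z‖ ^ y.re ≤ |s| ^ (min y.re 0) * (1 + |s|) ^ N := by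
    rcases le_total y.re 0 with h | h
    · rw [min_eq_left h]
      refine (Real.rpow_le_rpow_of_nonpos hs0 h1 h).trans (le_mul_of_one_le_right (by positivity) ?_)
      exact one_le_pow₀ (by linarith)
    · rw [min_eq_right h, Real.rpow_zero, one_mul]
      calc ‖z‖ ^ y.re ≤ (1 + |s|) ^ y.re := Real.rpow_le_rpow (norm_nonneg _) h2 h
        _ ≤ (1 + |s|) ^ (N : ℝ) := Real.rpow_le_rpow_of_exponent_le (by linarith) hN
        _ = _ := Real.rpow_natCast _ _
  gcongr

lemma norm_regularizedPower_le {ε : ℝ} (hε : 0 ≤ ε) (hε1 : ε ≤ 1)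
    (f : (KR → ℝ) × (KI → ℝ) → ℂ) (yR : KR → ℂ) (yI : KI → ℂ) {N : ℕ} (hN : ∀ k, (yI k).re ≤ N)
    {s : (KR → ℝ) × (KI → ℝ)} (hs : s ∈ M.invariantDomain) (hs0 : ∀ k, s.2 k ≠ 0) :
    ‖regularizedPower ε f yR yI s‖ ≤ (∏ k, Real.exp (Real.pi / 2 * |(yI k).im|)) *
      (‖f s‖ * ((∏ k, s.1 k ^ (yR k).re) *
        ∏ k, (|s.2 k| ^ (min (yI k).re 0) * (1 + |s.2 k|) ^ N))) := by
  have e1 : ‖∏ k, ((s.1 k : ℝ) : ℂ) ^ yR k‖ = ∏ k, s.1 k ^ (yR k).re := by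
    rw [norm_prod]
    exact Finset.prod_congr rfl fun k _ => Complex.norm_cpow_eq_rpow_re_of_pos (hs k) _
  have e2 : ‖∏ k, ((ε : ℂ) + Complex.I * ((s.2 k : ℝ) : ℂ)) ^ yI k‖ ≤
      (∏ k, (|s.2 k| ^ (min (yI k).re 0) * (1 + |s.2 k|) ^ N)) *
        ∏ k, Real.exp (Real.pi / 2 * |(yI k).im|) := by
    rw [norm_prod, ← Finset.prod_mul_distrib]
    exact Finset.prod_le_prod (fun _ _ => norm_nonneg _) fun k _ =>
      norm_cpow_add_I_mul_le hε hε1 (hs0 k) _ (hN k)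
  have hp : 0 ≤ ∏ k, s.1 k ^ (yR k).re :=
    Finset.prod_nonneg fun k _ => Real.rpow_nonneg (hs k).le _
  rw [regularizedPower, norm_mul, norm_mul, e1]
  calc _ ≤ ‖f s‖ * (∏ k, s.1 k ^ (yR k).re) * _ := mul_le_mul_of_nonneg_left e2 (by positivity)
    _ = _ := by ring

lemma measurable_regularizedPower (ε : ℝ) (f : 𝓢((KR → ℝ) × (KI → ℝ), ℂ)) (yR : KR → ℂ)
    (yI : KI → ℂ) : Measurable (regularizedPower ε f yR yI) := by
  unfold regularizedPower
  refine (f.continuous.measurable.mul ?_).mul ?_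
  · exact Finset.measurable_prod _ fun k _ => by fun_prop
  · exact Finset.measurable_prod _ fun k _ => by fun_prop

lemma exists_nat_re_le (yI : KI → ℂ) : ∃ N : ℕ, ∀ k, (yI k).re ≤ N := by
  obtain ⟨B, hB⟩ := (Set.finite_range fun k => (yI k).re).bddAbove
  obtain ⟨N, hN⟩ := exists_nat_ge B
  exact ⟨N, fun k => (hB ⟨k, rfl⟩).trans hN⟩

theorem integrableOn_regularizedPower {ε : ℝ} (hε : 0 ≤ ε) (hε1 : ε ≤ 1)
    (f : 𝓢((KR → ℝ) × (KI → ℝ), ℂ)) {yR : KR → ℂ} {yI : KI → ℂ}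
    (hR : ∀ k, -1 < (yR k).re ∧ (yR k).re ≤ 0) (hI : ∀ k, -1 < (yI k).re) :
    IntegrableOn (regularizedPower ε f yR yI) M.invariantDomain := by
  obtain ⟨N, hN⟩ := exists_nat_re_le yI
  refine ((M.integrableOn_schwartz_mul_rpow f hR (τI := fun k => min (yI k).re 0)
    (fun k => ⟨lt_min (hI k) (by norm_num), min_le_right _ _⟩) N).const_mul
    (∏ k, Real.exp (Real.pi / 2 * |(yI k).im|))).mono'
    (measurable_regularizedPower _ _ _ _).aestronglyMeasurable ?_
  filter_upwards [ae_restrict_mem M.measurableSet_invariantDomain, M.ae_snd_ne_zero] with s hs hs0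
  exact M.norm_regularizedPower_le hε hε1 f yR yI hN hs hs0

end MonomialData

/-! ### Integration by parts in the invariants `s^I` and removal of the regularization. -/

namespace MonomialData

variable {L KU KR KI : Type*} [Fintype L] [Fintype KU] [Fintype KR] [Fintype KI]
  (M : MonomialData L KU KR KI)

/-- For `ε > 0` the base stays in the right half-plane, so the power is differentiable even across
`s = 0`, where the unregularized one is singular. -/
lemma hasDerivAt_cpow_add_I_mul {ε : ℝ} (hε : 0 < ε) (s : ℝ) (y : ℂ) :
    HasDerivAt (fun t : ℝ => ((ε : ℂ) + Complex.I * ((s + t : ℝ) : ℂ)) ^ (y + 1))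
      ((y + 1) * ((ε : ℂ) + Complex.I * (s : ℂ)) ^ y * Complex.I) 0 := by
  have h1 : HasDerivAt (fun t : ℝ => (ε : ℂ) + Complex.I * ((s + t : ℝ) : ℂ)) Complex.I 0 := by
    have := (((hasDerivAt_id (0 : ℝ)).const_add s).ofReal_comp.const_mul Complex.I).const_add (ε : ℂ)
    simpa using this
  have h2 : ((ε : ℂ) + Complex.I * ((s + 0 : ℝ) : ℂ)) ∈ Complex.slitPlane := by
    left; simpa using hε
  have h3 := (hasDerivAt_id ((ε : ℂ) + Complex.I * ((s + 0 : ℝ) : ℂ))).cpow_const (c := y + 1) h2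
  have h4 := HasDerivAt.comp (0 : ℝ) h3 h1
  simpa [Function.comp_def] using h4

open Classical in
/-- Integration by parts in the invariant `s^I_k`. -/
theorem integral_regularizedPower_eq {ε : ℝ} (hε : 0 < ε) (hε1 : ε ≤ 1)
    (f : 𝓢((KR → ℝ) × (KI → ℝ), ℂ)) {yR : KR → ℂ} {yI : KI → ℂ}
    (hR : ∀ k, -1 < (yR k).re ∧ (yR k).re ≤ 0) (hI : ∀ k, -1 < (yI k).re) (k : KI) :
    ∫ s in M.invariantDomain, regularizedPower ε f yR yI s =
      Complex.I / (yI k + 1) * ∫ s in M.invariantDomain,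
        regularizedPower ε (LineDeriv.lineDerivOp ((0, Pi.single k 1) : (KR → ℝ) × (KI → ℝ)) f)
          yR (yI + Pi.single k 1) s := by
  set v : (KR → ℝ) × (KI → ℝ) := (0, Pi.single k 1) with hv
  set f' : 𝓢((KR → ℝ) × (KI → ℝ), ℂ) := LineDeriv.lineDerivOp v f with hf'
  have hy0 : yI k + 1 ≠ 0 := by
    intro h
    have := congrArg Complex.re h
    simp at this
    linarith [hI k]
  have hI' : ∀ j, -1 < ((yI + Pi.single k 1 : KI → ℂ) j).re := by
    intro j
    by_cases hj : j = k
    · subst hj; simp; linarith [hI j]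
    · simpa [hj] using hI j
  -- The direction `v` moves only `s^I_k`, on which the domain puts no condition. The indicator is
  -- constant along `v`, and no boundary term appears.
  set g : (KR → ℝ) × (KI → ℝ) → ℂ :=
    M.invariantDomain.indicator (regularizedPower ε (fun _ => 1) yR (yI + Pi.single k 1)) with hg
  set g' : (KR → ℝ) × (KI → ℝ) → ℂ := M.invariantDomain.indicator
    (fun s => (yI k + 1) * Complex.I * regularizedPower ε (fun _ => 1) yR yI s) with hg'
  have hmul : ∀ (h : (KR → ℝ) × (KI → ℝ) → ℂ) (y : KI → ℂ) s,
      h s * regularizedPower ε (fun _ => 1) yR y s = regularizedPower ε h yR y s := by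
    intro h y s; simp [regularizedPower, mul_assoc]
  have hfg : ∀ h : (KR → ℝ) × (KI → ℝ) → ℂ, (fun s => h s * g s) =
      M.invariantDomain.indicator (regularizedPower ε h yR (yI + Pi.single k 1)) := by
    intro h; funext s
    simp only [hg, indicator]
    split_ifs <;> simp [hmul]
  have hfg' : (fun s => f s * g' s) = M.invariantDomain.indicator
      (fun s => (yI k + 1) * Complex.I * regularizedPower ε f yR yI s) := by
    funext s
    simp only [hg', indicator]
    split_ifs
    · rw [mul_left_comm, hmul]
    · simp
  have hms := M.measurableSet_invariantDomain
  have hhaar : (volume : Measure ((KR → ℝ) × (KI → ℝ))).IsAddHaarMeasure :=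
    Measure.prod.instIsAddHaarMeasure _ _
  have key := integral_bilinear_hasLineDerivAt_right_eq_neg_left_of_integrable
    (μ := (volume : Measure ((KR → ℝ) × (KI → ℝ)))) (f := f) (f' := f') (g := g) (g' := g') (v := v)
    (B := ContinuousLinearMap.mul ℝ ℂ) ?_ ?_ ?_ ?_ ?_
  · simp only [ContinuousLinearMap.mul_apply'] at key
    rw [hfg, hfg', integral_indicator hms, integral_indicator hms, integral_const_mul] at key
    rw [div_mul_eq_mul_div, eq_div_iff hy0]
    linear_combination (-Complex.I) * key + (yI k + 1) * (∫ s in M.invariantDomain,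
      regularizedPower ε f yR yI s) * Complex.I_sq
  · simp only [ContinuousLinearMap.mul_apply']
    rw [hfg]
    exact (M.integrableOn_regularizedPower hε.le hε1 f' hR hI').integrable_indicator hms
  · simp only [ContinuousLinearMap.mul_apply']
    rw [hfg']
    exact IntegrableOn.integrable_indicator
      ((M.integrableOn_regularizedPower hε.le hε1 f hR hI).const_mul _) hms
  · simp only [ContinuousLinearMap.mul_apply']
    rw [hfg]
    exact (M.integrableOn_regularizedPower hε.le hε1 f hR hI').integrable_indicator hms
  · intro s _
    have := f.differentiableAt (x := s) |>.hasFDerivAt.hasLineDerivAt v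
    exact this
  · intro s _
    rw [HasLineDerivAt]
    by_cases hs : s ∈ M.invariantDomain
    · have hs' : ∀ t : ℝ, s + t • v ∈ M.invariantDomain := by
        intro t j; simpa [hv] using hs j
      have e1 : (fun t : ℝ => g (s + t • v)) = fun t : ℝ =>
          ((∏ j, ((s.1 j : ℝ) : ℂ) ^ yR j) *
            ∏ j ∈ Finset.univ.erase k, ((ε : ℂ) + Complex.I * ((s.2 j : ℝ) : ℂ)) ^ yI j) *
            ((ε : ℂ) + Complex.I * ((s.2 k + t : ℝ) : ℂ)) ^ (yI k + 1) := by
        funext t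
        simp only [hg, indicator_of_mem (hs' t), regularizedPower]
        rw [← Finset.mul_prod_erase Finset.univ _ (Finset.mem_univ k)]
        have : ∏ j ∈ Finset.univ.erase k, ((ε : ℂ) + Complex.I * (((s + t • v).2 j : ℝ) : ℂ)) ^
            (yI + Pi.single k 1 : KI → ℂ) j =
            ∏ j ∈ Finset.univ.erase k, ((ε : ℂ) + Complex.I * ((s.2 j : ℝ) : ℂ)) ^ yI j := by
          refine Finset.prod_congr rfl fun j hj => ?_
          have hj' := Finset.ne_of_mem_erase hj
          simp [hv, hj']
        rw [this]
        simp [hv]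
        ring
      have e2 : g' s = ((∏ j, ((s.1 j : ℝ) : ℂ) ^ yR j) *
            ∏ j ∈ Finset.univ.erase k, ((ε : ℂ) + Complex.I * ((s.2 j : ℝ) : ℂ)) ^ yI j) *
            ((yI k + 1) * ((ε : ℂ) + Complex.I * (s.2 k : ℂ)) ^ yI k * Complex.I) := by
        simp only [hg', indicator_of_mem hs, regularizedPower]
        rw [← Finset.mul_prod_erase Finset.univ _ (Finset.mem_univ k)]
        ring
      rw [e1, e2]
      exact (hasDerivAt_cpow_add_I_mul hε (s.2 k) (yI k)).const_mul _
    · have hs' : ∀ t : ℝ, s + t • v ∉ M.invariantDomain := by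
        intro t h
        exact hs fun j => by simpa [hv] using h j
      have e1 : (fun t : ℝ => g (s + t • v)) = fun _ => 0 := by
        funext t; simp only [hg, indicator_of_notMem (hs' t)]
      have e2 : g' s = 0 := by simp only [hg', indicator_of_notMem hs]
      rw [e1, e2]
      exact hasDerivAt_const _ _

/-- The factor produced by one integration by parts: it gains one power of the imaginary part, with
a constant that depends only on the distance of the abscissa from `-1`. -/
lemma norm_I_div_le {d : ℝ} (hd : 0 < d) {y : ℂ} (hy : d ≤ (y + 1).re) :
    ‖Complex.I / (y + 1)‖ ≤ (1 + d⁻¹) * (1 + |y.im|)⁻¹ := by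
  have h1 : d ≤ ‖y + 1‖ := hy.trans (Complex.re_le_norm _)
  have h2 : |y.im| ≤ ‖y + 1‖ := by simpa using Complex.abs_im_le_norm (y + 1)
  have h3 : 0 < ‖y + 1‖ := lt_of_lt_of_le hd h1
  rw [norm_div, Complex.norm_I, ← div_eq_mul_inv, div_le_div_iff₀ h3 (by positivity), one_mul]
  have : 1 ≤ d⁻¹ * ‖y + 1‖ := by rw [inv_mul_eq_div, one_le_div hd]; exact h1
  linarith

-- Induction on a multiset whose multiplicity at `k` counts the integrations by parts in `s^I_k`.
-- Each one differentiates the Schwartz function, raises the exponent of that variable by one and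
-- gains a factor `(1 + |η_k|)⁻¹`. The function `g` is thus an iterated derivative of `f`,
-- independent of `ε` and `η`.
open Classical in
lemma exists_norm_integral_regularizedPower_le_multiset (f : 𝓢((KR → ℝ) × (KI → ℝ), ℂ)) {τR : KR → ℝ}
    {τI : KI → ℝ} (hR : ∀ k, -1 < τR k ∧ τR k ≤ 0) (hI : ∀ k, -1 < τI k) (m : Multiset KI) :
    ∃ g : 𝓢((KR → ℝ) × (KI → ℝ), ℂ), ∃ C : ℝ, 0 < C ∧ ∀ ε : ℝ, 0 < ε → ε ≤ 1 →
      ∀ (ηR : KR → ℝ) (ηI : KI → ℝ),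
      ‖∫ s in M.invariantDomain, regularizedPower ε f (line τR ηR) (line τI ηI) s‖ ≤
        C * (∏ k, ((1 + |ηI k|) ^ m.count k)⁻¹) *
        ‖∫ s in M.invariantDomain, regularizedPower ε g (line τR ηR)
          (line (fun k => τI k + m.count k) ηI) s‖ := by
  induction m using Multiset.induction_on with
  | empty => exact ⟨f, 1, one_pos, fun ε _ _ ηR ηI => by simp⟩
  | cons a m ih =>
    obtain ⟨g, C, hC, h⟩ := ih
    have hd : 0 < τI a + 1 := by linarith [hI a]
    refine ⟨LineDeriv.lineDerivOp ((0, Pi.single a 1) : (KR → ℝ) × (KI → ℝ)) g,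
      C * (1 + (τI a + 1)⁻¹), by positivity, fun ε hε hε1 ηR ηI => ?_⟩
    have hy : line (fun k => τI k + m.count k) ηI + Pi.single a 1 =
        line (fun k => τI k + (a ::ₘ m).count k) ηI := by
      funext k
      by_cases hk : k = a
      · subst hk; simp [line]; ring
      · simp [line, hk, Multiset.count_cons_of_ne hk]
    have hibp := M.integral_regularizedPower_eq hε hε1 g (yR := line τR ηR)
      (yI := line (fun k => τI k + m.count k) ηI) (fun k => by rw [line_re]; exact hR k)
      (fun k => by rw [line_re]; linarith [hI k, (Nat.cast_nonneg (m.count k) : (0 : ℝ) ≤ m.count k)]) a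
    rw [hy] at hibp
    have hfac : ‖Complex.I / (line (fun k => τI k + m.count k) ηI a + 1)‖ ≤
        (1 + (τI a + 1)⁻¹) * (1 + |ηI a|)⁻¹ := by
      have := norm_I_div_le (y := line (fun k => τI k + (m.count k : ℝ)) ηI a) hd
        (by rw [Complex.add_re, line_re, Complex.one_re]
            linarith [(Nat.cast_nonneg (m.count a) : (0 : ℝ) ≤ m.count a)])
      rwa [line_im] at this
    have hprod : (∏ k, ((1 + |ηI k|) ^ (a ::ₘ m).count k)⁻¹) =
        (∏ k, ((1 + |ηI k|) ^ m.count k)⁻¹) * (1 + |ηI a|)⁻¹ := by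
      rw [← Finset.mul_prod_erase Finset.univ _ (Finset.mem_univ a),
        ← Finset.mul_prod_erase Finset.univ (fun k => ((1 + |ηI k|) ^ m.count k)⁻¹)
          (Finset.mem_univ a), Multiset.count_cons_self, pow_succ, mul_inv]
      have : ∏ x ∈ Finset.univ.erase a, ((1 + |ηI x|) ^ (a ::ₘ m).count x)⁻¹ =
          ∏ x ∈ Finset.univ.erase a, ((1 + |ηI x|) ^ m.count x)⁻¹ :=
        Finset.prod_congr rfl fun k hk => by
          rw [Multiset.count_cons_of_ne (Finset.ne_of_mem_erase hk)]
      rw [this]; ring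
    have hp : 0 ≤ ∏ k, ((1 + |ηI k|) ^ m.count k)⁻¹ := Finset.prod_nonneg fun k _ => by positivity
    refine (h ε hε hε1 ηR ηI).trans ?_
    rw [hibp, norm_mul, hprod]
    calc _ ≤ C * (∏ k, ((1 + |ηI k|) ^ m.count k)⁻¹) * (((1 + (τI a + 1)⁻¹) * (1 + |ηI a|)⁻¹) * _) :=
          mul_le_mul_of_nonneg_left (mul_le_mul_of_nonneg_right hfac (norm_nonneg _)) (by positivity)
      _ = _ := by ring

/-- The smeared powers decay rapidly in the imaginary parts `ηI`, up to `exp (π |ηI| / 2)`, uniformly in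
the regularization. -/
theorem exists_norm_integral_regularizedPower_le (f : 𝓢((KR → ℝ) × (KI → ℝ), ℂ)) {τR : KR → ℝ}
    {τI : KI → ℝ} (hR : ∀ k, -1 < τR k ∧ τR k ≤ 0) (hI : ∀ k, -1 < τI k) (N : ℕ) :
    ∃ C : ℝ, 0 < C ∧ ∀ ε : ℝ, 0 < ε → ε ≤ 1 → ∀ (ηR : KR → ℝ) (ηI : KI → ℝ),
      ‖∫ s in M.invariantDomain, regularizedPower ε f (line τR ηR) (line τI ηI) s‖ ≤
        C * ∏ k, (((1 + |ηI k|) ^ N)⁻¹ * Real.exp (Real.pi / 2 * |ηI k|)) := by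
  classical
  -- Every index is taken `N` times.
  obtain ⟨g, C, hC, h⟩ := M.exists_norm_integral_regularizedPower_le_multiset f hR hI
    (N • (Finset.univ : Finset KI).val)
  have hcount : ∀ k, (N • (Finset.univ : Finset KI).val).count k = N := by
    intro k
    rw [Multiset.count_nsmul, Multiset.count_eq_one_of_mem Finset.univ.nodup (Finset.mem_univ k),
      mul_one]
  simp only [hcount] at h
  -- The raised exponents may be positive, in which case the powers grow in `s`; `N'` bounds this
  -- growth, and the decay of `g` compensates it.
  set τ' : KI → ℝ := fun k => τI k + N with hτ'
  obtain ⟨N', hN'⟩ := exists_nat_re_le (line τ' (fun _ => 0))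
  set w : (KR → ℝ) × (KI → ℝ) → ℝ := fun s => ‖g s‖ * ((∏ k, s.1 k ^ τR k) *
      ∏ k, (|s.2 k| ^ (min (τ' k) 0) * (1 + |s.2 k|) ^ N')) with hw
  have hwint : IntegrableOn w M.invariantDomain :=
    M.integrableOn_schwartz_mul_rpow g hR (fun k => ⟨lt_min (by
      simp only [hτ']; linarith [hI k, (Nat.cast_nonneg N : (0 : ℝ) ≤ N)]) (by norm_num),
      min_le_right _ _⟩) N'
  refine ⟨C * ((∫ s in M.invariantDomain, w s) + 1), ?_, fun ε hε hε1 ηR ηI => ?_⟩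
  · have : 0 ≤ ∫ s in M.invariantDomain, w s :=
      setIntegral_nonneg M.measurableSet_invariantDomain fun s hs => by
        have : 0 ≤ ∏ k, s.1 k ^ τR k := Finset.prod_nonneg fun k _ => Real.rpow_nonneg (hs k).le _
        have : 0 ≤ ∏ k, (|s.2 k| ^ (min (τ' k) 0) * (1 + |s.2 k|) ^ N') :=
          Finset.prod_nonneg fun k _ => by positivity
        positivity
    positivity
  have hb : ‖∫ s in M.invariantDomain, regularizedPower ε g (line τR ηR) (line τ' ηI) s‖ ≤
      (∏ k, Real.exp (Real.pi / 2 * |ηI k|)) * ∫ s in M.invariantDomain, w s := by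
    rw [← integral_const_mul]
    refine norm_integral_le_of_norm_le (hwint.const_mul _) ?_
    filter_upwards [ae_restrict_mem M.measurableSet_invariantDomain, M.ae_snd_ne_zero] with s hs hs0
    have := M.norm_regularizedPower_le hε.le hε1 g (line τR ηR) (line τ' ηI) (N := N')
      (fun k => by have := hN' k; rw [line_re] at this ⊢; exact this) hs hs0
    simpa only [line_re, line_im] using this
  have hp : 0 ≤ ∏ k, ((1 + |ηI k|) ^ N)⁻¹ := Finset.prod_nonneg fun k _ => by positivity
  have hp' : 0 ≤ ∏ k, Real.exp (Real.pi / 2 * |ηI k|) := Finset.prod_nonneg fun k _ => by positivity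
  refine (h ε hε hε1 ηR ηI).trans ?_
  rw [Finset.prod_mul_distrib]
  calc _ ≤ C * (∏ k, ((1 + |ηI k|) ^ N)⁻¹) *
        ((∏ k, Real.exp (Real.pi / 2 * |ηI k|)) * ∫ s in M.invariantDomain, w s) :=
        mul_le_mul_of_nonneg_left hb (by positivity)
    _ ≤ C * (∏ k, ((1 + |ηI k|) ^ N)⁻¹) *
        ((∏ k, Real.exp (Real.pi / 2 * |ηI k|)) * ((∫ s in M.invariantDomain, w s) + 1)) := by
        gcongr; linarith
    _ = _ := by ring

/-- The regularization of the smeared powers can be removed. -/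
theorem tendsto_integral_regularizedPower (f : 𝓢((KR → ℝ) × (KI → ℝ), ℂ)) {yR : KR → ℂ}
    {yI : KI → ℂ} (hR : ∀ k, -1 < (yR k).re ∧ (yR k).re ≤ 0) (hI : ∀ k, -1 < (yI k).re) :
    Tendsto (fun ε : ℝ => ∫ s in M.invariantDomain, regularizedPower ε f yR yI s) (𝓝[>] 0)
      (𝓝 (∫ s in M.invariantDomain, M.smearedPower f yR yI s)) := by
  obtain ⟨N, hN⟩ := exists_nat_re_le yI
  have hint := (M.integrableOn_schwartz_mul_rpow f hR (τI := fun k => min (yI k).re 0)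
    (fun k => ⟨lt_min (hI k) (by norm_num), min_le_right _ _⟩) N).const_mul
    (∏ k, Real.exp (Real.pi / 2 * |(yI k).im|))
  have hmem : ∀ᶠ ε : ℝ in 𝓝[>] 0, ε ∈ Ioc (0 : ℝ) 1 := Ioc_mem_nhdsGT one_pos
  rw [← M.regularizedPower_zero]
  refine tendsto_integral_filter_of_dominated_convergence _ (Eventually.of_forall fun ε =>
    (measurable_regularizedPower _ _ _ _).aestronglyMeasurable) ?_ hint ?_
  · filter_upwards [hmem] with ε hε
    filter_upwards [ae_restrict_mem M.measurableSet_invariantDomain, M.ae_snd_ne_zero] with s hs hs0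
    exact M.norm_regularizedPower_le hε.1.le hε.2 f yR yI hN hs hs0
  · filter_upwards [M.ae_snd_ne_zero] with s hs0
    simp only [regularizedPower]
    refine Tendsto.const_mul _ (tendsto_finsetProd _ fun k _ => ?_)
    -- For `s ≠ 0`, hence almost everywhere, the limit point `i s` lies off the cut of the principal
    -- branch, so the power is continuous at `ε = 0`.
    have hslit : ((0 : ℝ) : ℂ) + Complex.I * (s.2 k : ℂ) ∈ Complex.slitPlane := by
      right; simpa using hs0 k
    have : ContinuousAt (fun ε : ℝ => ((ε : ℂ) + Complex.I * (s.2 k : ℂ)) ^ yI k) 0 :=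
      ContinuousAt.cpow (by fun_prop) continuousAt_const hslit
    exact this.tendsto.mono_left nhdsWithin_le_nhds

end MonomialData

/-! ### The Beta integral in the variable `t²`. -/

section Beta

variable {z w : ℂ}

/-- The substitution `x = t²` in the Beta integral, pointwise. The indicators extend the integrands
to the half-line, where the change of variables for powers applies. -/
lemma beta_integrand_comp_sq {t : ℝ} (ht : t ∈ Ioi (0 : ℝ)) :
    (2 * t ^ ((2 : ℝ) - 1)) • (Ioo (0 : ℝ) 1).indicator
      (fun x : ℝ => (x : ℂ) ^ (z / 2 - 1) * (1 - (x : ℂ)) ^ (w - 1)) (t ^ (2 : ℝ)) =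
    (Ioo (0 : ℝ) 1).indicator
      (fun t : ℝ => 2 * ((t : ℂ) ^ (z - 1) * ((1 - t ^ 2 : ℝ) : ℂ) ^ (w - 1))) t := by
  have ht : 0 < t := ht
  have ht0 : (t : ℂ) ≠ 0 := by exact_mod_cast ht.ne'
  have hmem : t ^ (2 : ℝ) ∈ Ioo (0 : ℝ) 1 ↔ t ∈ Ioo (0 : ℝ) 1 := by
    rw [Real.rpow_two]
    simp only [mem_Ioo, ht, true_and, pow_pos ht]
    exact pow_lt_one_iff_of_nonneg ht.le two_ne_zero
  by_cases h : t ∈ Ioo (0 : ℝ) 1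
  · rw [indicator_of_mem h, indicator_of_mem (hmem.2 h)]
    have e1 : (((t ^ (2 : ℝ)) : ℝ) : ℂ) ^ (z / 2 - 1) = (t : ℂ) ^ (z - 1) * (t : ℂ)⁻¹ := by
      rw [Real.rpow_two, pow_two, ofReal_mul_cpow ht ht, ← Complex.cpow_add _ _ ht0,
        show z / 2 - 1 + (z / 2 - 1) = (z - 1) - 1 by ring, Complex.cpow_sub _ _ ht0,
        Complex.cpow_one, div_eq_mul_inv]
    rw [e1, show (2 : ℝ) - 1 = 1 by norm_num, Real.rpow_one, Complex.real_smul, Real.rpow_two]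
    push_cast
    field_simp
  · rw [indicator_of_notMem h, indicator_of_notMem (fun h' => h (hmem.1 h')), smul_zero]

lemma integrableOn_indicator_beta (hz : 0 < z.re) (hw : 0 < w.re) :
    IntegrableOn ((Ioo (0 : ℝ) 1).indicator
      (fun x : ℝ => (x : ℂ) ^ (z / 2 - 1) * (1 - (x : ℂ)) ^ (w - 1))) (Ioi 0) := by
  have h := Complex.betaIntegral_convergent (u := z / 2) (v := w) (by simpa using hz) hw
  rw [intervalIntegrable_iff_integrableOn_Ioo_of_le zero_le_one] at h
  exact (h.integrable_indicator measurableSet_Ioo).integrableOn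

lemma integrableOn_cpow_mul_one_sub_sq_cpow (hz : 0 < z.re) (hw : 0 < w.re) :
    IntegrableOn (fun t : ℝ => (t : ℂ) ^ (z - 1) * ((1 - t ^ 2 : ℝ) : ℂ) ^ (w - 1)) (Ioo 0 1) := by
  have h := (integrableOn_Ioi_comp_rpow_iff _ two_ne_zero).2 (integrableOn_indicator_beta hz hw)
  rw [abs_of_pos (by norm_num : (0 : ℝ) < 2)] at h
  have h2 := h.congr_fun (fun t ht => beta_integrand_comp_sq ht) measurableSet_Ioi
  rw [IntegrableOn, integrable_indicator_iff measurableSet_Ioo, IntegrableOn,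
    Measure.restrict_restrict measurableSet_Ioo, inter_eq_left.2 Ioo_subset_Ioi_self] at h2
  have h3 := h2.const_mul (2⁻¹ : ℂ)
  refine h3.congr (ae_of_all _ fun t => ?_)
  simp only
  rw [inv_mul_cancel_left₀ two_ne_zero]

/-- The Beta integral in the variable `t²`. -/
lemma integral_cpow_mul_one_sub_sq_cpow (hz : 0 < z.re) (hw : 0 < w.re) :
    ∫ t : ℝ in Ioo 0 1, (t : ℂ) ^ (z - 1) * ((1 - t ^ 2 : ℝ) : ℂ) ^ (w - 1) =
      Complex.Gamma (z / 2) * Complex.Gamma w / (2 * Complex.Gamma (z / 2 + w)) := by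
  have h := integral_comp_rpow_Ioi_of_pos (g := (Ioo (0 : ℝ) 1).indicator
      (fun x : ℝ => (x : ℂ) ^ (z / 2 - 1) * (1 - (x : ℂ)) ^ (w - 1))) (p := 2) two_pos
  rw [setIntegral_congr_fun measurableSet_Ioi (fun t ht => beta_integrand_comp_sq ht),
    setIntegral_indicator measurableSet_Ioo, setIntegral_indicator measurableSet_Ioo,
    inter_eq_right.2 Ioo_subset_Ioi_self, integral_const_mul] at h
  have hG : Complex.Gamma (z / 2 + w) ≠ 0 :=
    Complex.Gamma_ne_zero_of_re_pos (by simp; positivity)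
  rw [Complex.Gamma_mul_Gamma_eq_betaIntegral (by simpa using hz) hw, Complex.betaIntegral,
    intervalIntegral.integral_of_le zero_le_one, integral_Ioc_eq_integral_Ioo, ← h,
    eq_div_iff (mul_ne_zero two_ne_zero hG)]
  ring

lemma norm_cpow_mul_one_sub_sq_cpow {t : ℝ} (ht : t ∈ Ioo (0 : ℝ) 1) :
    ‖(t : ℂ) ^ (z - 1) * ((1 - t ^ 2 : ℝ) : ℂ) ^ (w - 1)‖ =
      t ^ (z.re - 1) * (1 - t ^ 2) ^ (w.re - 1) := by
  have h1 : 0 < 1 - t ^ 2 := by nlinarith [ht.1, ht.2]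
  rw [norm_mul, Complex.norm_cpow_eq_rpow_re_of_pos ht.1, Complex.norm_cpow_eq_rpow_re_of_pos h1]
  simp

lemma integrableOn_rpow_mul_one_sub_sq_rpow {ρ σ : ℝ} (hρ : 0 < ρ) (hσ : 0 < σ) :
    IntegrableOn (fun t : ℝ => t ^ (ρ - 1) * (1 - t ^ 2) ^ (σ - 1)) (Ioo 0 1) := by
  have h := (integrableOn_cpow_mul_one_sub_sq_cpow (z := ρ) (w := σ) (by simpa) (by simpa)).norm
  refine h.congr ?_
  filter_upwards [ae_restrict_mem measurableSet_Ioo] with t ht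
  rw [norm_cpow_mul_one_sub_sq_cpow ht]; simp

end Beta

/-- The domain of the parameters `t`. -/
abbrev cube (L : Type*) : Set (L → ℝ) := univ.pi fun _ : L => Ioo (0 : ℝ) 1

lemma measurableSet_cube (L : Type*) [Fintype L] : MeasurableSet (cube L) :=
  MeasurableSet.univ_pi fun _ => measurableSet_Ioo

lemma restrict_cube (L : Type*) [Fintype L] : (volume.restrict (cube L)) =
    Measure.pi fun _ : L => volume.restrict (Ioo (0 : ℝ) 1) := by
  rw [volume_pi, Measure.restrict_pi_pi]

lemma one_sub_sq_pos {L : Type*} {t : L → ℝ} (ht : t ∈ cube L) (l : L) : 0 < 1 - t l ^ 2 := by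
  have := ht l (mem_univ _)
  nlinarith [this.1, this.2]

lemma pos_of_mem_cube {L : Type*} {t : L → ℝ} (ht : t ∈ cube L) (l : L) : 0 < t l :=
  (ht l (mem_univ _)).1

/-! ### Convergence of the parametric integral and analyticity in `D`. -/

namespace MonomialData

variable {L KU KR KI : Type*} [Fintype L] [Fintype KU] [Fintype KR] [Fintype KI]
  (M : MonomialData L KU KR KI)

/-- The coefficients of `HU` are positive and some monomial of `HU` is square-free. -/
structure Admissible : Prop where
  pos : ∀ k, 0 < M.a k
  exists_squarefree : ∃ k, ∀ l, M.u k l ≤ 1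

variable {M}

/-- On the cube a square-free monomial is at least `∏ t_l`, and the other terms of `U` are
nonnegative. No other power counting is used. -/
lemma Admissible.exists_mul_prod_le_U (hM : M.Admissible) :
    ∃ c : ℝ, 0 < c ∧ ∀ t ∈ cube L, c * ∏ l, t l ≤ M.U t := by
  obtain ⟨k, hk⟩ := hM.exists_squarefree
  refine ⟨M.a k, hM.pos k, fun t ht => ?_⟩
  have h1 : M.a k * ∏ l, t l ^ M.u k l ≤ M.U t := by
    refine Finset.single_le_sum (f := fun k => M.a k * ∏ l, t l ^ M.u k l) (fun j _ => ?_)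
      (Finset.mem_univ k)
    exact mul_nonneg (hM.pos j).le (Finset.prod_nonneg fun l _ => pow_nonneg (pos_of_mem_cube ht l).le _)
  refine le_trans (mul_le_mul_of_nonneg_left (Finset.prod_le_prod
    (fun l _ => (pos_of_mem_cube ht l).le) fun l _ => ?_) (hM.pos k).le) h1
  calc t l = t l ^ 1 := (pow_one _).symm
    _ ≤ t l ^ M.u k l := pow_le_pow_of_le_one (pos_of_mem_cube ht l).le (ht l (mem_univ _)).2.le (hk l)

lemma Admissible.U_pos (hM : M.Admissible) {t : L → ℝ} (ht : t ∈ cube L) : 0 < M.U t := by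
  obtain ⟨c, hc, h⟩ := hM.exists_mul_prod_le_U
  exact lt_of_lt_of_le (mul_pos hc (Finset.prod_pos fun l _ => pos_of_mem_cube ht l)) (h t ht)

variable (M) in
lemma continuous_U : Continuous M.U := by unfold U; fun_prop

variable (M) in
/-- The absolute value of the integrand without the exponential, for `ρ = Re D`. -/
noncomputable def weight (ρ : ℝ) (t : L → ℝ) : ℝ :=
  (∏ l, (1 - t l ^ 2) ^ (ρ / 2 - 1)) * M.U t ^ (-ρ / 2)

variable (M) in
lemma measurable_weight (ρ : ℝ) : Measurable (M.weight ρ) := by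
  unfold weight
  have := M.continuous_U.measurable
  exact (Finset.measurable_prod _ fun l _ => by fun_prop).mul (by fun_prop)

lemma Admissible.weight_nonneg (hM : M.Admissible) (ρ : ℝ) {t : L → ℝ} (ht : t ∈ cube L) :
    0 ≤ M.weight ρ t :=
  mul_nonneg (Finset.prod_nonneg fun l _ => Real.rpow_nonneg (one_sub_sq_pos ht l).le _)
    (Real.rpow_nonneg (hM.U_pos ht).le _)

/-- The majorant is a product of functions `t ^ (-ρ / 2) (1 - t²) ^ (ρ / 2 - 1)`: the end `t = 0`
asks for `ρ < 2`, the end `t = 1` for `ρ > 0`. -/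
theorem Admissible.integrableOn_weight (hM : M.Admissible) {ρ : ℝ} (h0 : 0 < ρ) (h2 : ρ < 2) :
    IntegrableOn (M.weight ρ) (cube L) := by
  obtain ⟨c, hc, h⟩ := hM.exists_mul_prod_le_U
  have hint : Integrable (fun t : L → ℝ => ∏ l, (t l ^ ((1 - ρ / 2) - 1) * (1 - t l ^ 2) ^ (ρ / 2 - 1)))
      (volume.restrict (cube L)) := by
    rw [restrict_cube]
    exact Integrable.fintype_prod (f := fun _ (x : ℝ) => x ^ ((1 - ρ / 2) - 1) * (1 - x ^ 2) ^ (ρ / 2 - 1))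
      fun l => integrableOn_rpow_mul_one_sub_sq_rpow (by linarith) (by linarith)
  refine (hint.const_mul (c ^ (-ρ / 2))).mono' (M.measurable_weight ρ).aestronglyMeasurable ?_
  filter_upwards [ae_restrict_mem (measurableSet_cube L)] with t ht
  rw [Real.norm_of_nonneg (hM.weight_nonneg ρ ht), weight]
  have hp : 0 < ∏ l, t l := Finset.prod_pos fun l _ => pos_of_mem_cube ht l
  have h1 : M.U t ^ (-ρ / 2) ≤ c ^ (-ρ / 2) * ∏ l, t l ^ ((1 - ρ / 2) - 1) := by
    refine (Real.rpow_le_rpow_of_nonpos (mul_pos hc hp) (h t ht) (by linarith)).trans (le_of_eq ?_)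
    rw [Real.mul_rpow hc.le hp.le, ← Real.finsetProd_rpow _ _ fun l _ => (pos_of_mem_cube ht l).le]
    congr 1
    exact Finset.prod_congr rfl fun l _ => by congr 1; ring
  have h3 : 0 ≤ ∏ l, (1 - t l ^ 2) ^ (ρ / 2 - 1) :=
    Finset.prod_nonneg fun l _ => Real.rpow_nonneg (one_sub_sq_pos ht l).le _
  calc _ ≤ (∏ l, (1 - t l ^ 2) ^ (ρ / 2 - 1)) * (c ^ (-ρ / 2) * ∏ l, t l ^ ((1 - ρ / 2) - 1)) := by
        gcongr
    _ = _ := by rw [Finset.prod_mul_distrib]; ring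

variable (M) in
/-- The complex power of the parametric integrand. -/
noncomputable def complexWeight (D : ℂ) (t : L → ℝ) : ℂ :=
  (∏ l, ((1 - t l ^ 2 : ℝ) : ℂ) ^ (D / 2 - 1)) * ((M.U t : ℝ) : ℂ) ^ (-D / 2)

variable (M) in
lemma measurable_complexWeight (D : ℂ) : Measurable (M.complexWeight D) := by
  unfold complexWeight
  have := M.continuous_U.measurable
  exact (Finset.measurable_prod _ fun l _ => by fun_prop).mul (by fun_prop)

lemma Admissible.norm_complexWeight (hM : M.Admissible) (D : ℂ) {t : L → ℝ} (ht : t ∈ cube L) :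
    ‖M.complexWeight D t‖ = M.weight D.re t := by
  rw [complexWeight, weight, norm_mul, norm_prod, Complex.norm_cpow_eq_rpow_re_of_pos (hM.U_pos ht)]
  congr 1
  · refine Finset.prod_congr rfl fun l _ => ?_
    rw [Complex.norm_cpow_eq_rpow_re_of_pos (one_sub_sq_pos ht l)]
    simp
  · simp

/-- Analyticity in `D` of integrals of the parametric kind. -/
theorem Admissible.analyticOnNhd_integral (hM : M.Admissible) {β : Type*} [MeasurableSpace β]
    {ν : Measure β} {π : β → L → ℝ} (hπ : Measurable π) (hcube : ∀ᵐ b ∂ν, π b ∈ cube L) {E : β → ℂ}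
    (hE : AEStronglyMeasurable E ν)
    (hint : ∀ ρ ∈ Ioo (0 : ℝ) 2, Integrable (fun b => M.weight ρ (π b) * ‖E b‖) ν) :
    (∀ D ∈ strip, Integrable (fun b => M.complexWeight D (π b) * E b) ν) ∧
    AnalyticOnNhd ℂ (fun D => ∫ b, M.complexWeight D (π b) * E b ∂ν) strip := by
  refine ⟨fun D hD => ?_, ?_⟩
  · refine (hint D.re hD).mono' (((M.measurable_complexWeight D).comp hπ).aestronglyMeasurable.mul hE) ?_
    filter_upwards [hcube] with b hb
    rw [norm_mul, hM.norm_complexWeight D hb]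
  have hUm := M.continuous_U.measurable
  -- The integrand is `g exp (D h)`: the powers `-1` of the factors `1 - t_l²` do not involve `D`
  -- and go into `g`, and `h` is half the logarithm of `∏ (1 - t_l²) / U`. The map `π` lets the same
  -- argument serve the cube alone and its product with the invariants.
  set g : β → ℂ := fun b => ((∏ l, (1 - π b l ^ 2)⁻¹ : ℝ) : ℂ) * E b with hg
  set h : β → ℝ := fun b => 2⁻¹ * (∑ l, Real.log (1 - π b l ^ 2) - Real.log (M.U (π b))) with hh
  have hgm : AEStronglyMeasurable g ν := by
    refine (Measurable.aestronglyMeasurable ?_).mul hE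
    exact Complex.measurable_ofReal.comp (Finset.measurable_prod _ fun l _ => by fun_prop)
  have hhm : Measurable h := by
    refine Measurable.const_mul (Measurable.sub ?_ ?_) _
    · exact Finset.measurable_sum _ fun l _ => by fun_prop
    · exact Real.measurable_log.comp (hUm.comp hπ)
  have hre : ∀ b, π b ∈ cube L → ∀ ρ : ℝ, (∏ l, (1 - π b l ^ 2)⁻¹) * Real.exp (ρ * h b) =
      M.weight ρ (π b) := by
    intro b hb ρ
    have e1 : ρ * h b = ∑ l, Real.log (1 - π b l ^ 2) * (ρ / 2) + Real.log (M.U (π b)) * (-ρ / 2) := by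
      rw [← Finset.sum_mul]; simp only [hh]; ring
    rw [e1, Real.exp_add, Real.exp_sum, weight, ← mul_assoc, ← Finset.prod_mul_distrib,
      Real.rpow_def_of_pos (hM.U_pos hb)]
    congr 1
    refine Finset.prod_congr rfl fun l _ => ?_
    rw [Real.rpow_sub (one_sub_sq_pos hb l), Real.rpow_one, Real.rpow_def_of_pos (one_sub_sq_pos hb l)]
    ring
  have hco : ∀ b, π b ∈ cube L → ∀ D : ℂ, M.complexWeight D (π b) * E b =
      g b * Complex.exp (D * h b) := by
    intro b hb D
    have e1 : D * h b = ∑ l, (Real.log (1 - π b l ^ 2) : ℂ) * (D / 2) +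
        (Real.log (M.U (π b)) : ℂ) * (-D / 2) := by
      rw [← Finset.sum_mul]; simp only [hh]; push_cast; ring
    rw [e1, Complex.exp_add, Complex.exp_sum, complexWeight]
    have hU0 : ((M.U (π b) : ℝ) : ℂ) ≠ 0 := by exact_mod_cast (hM.U_pos hb).ne'
    rw [Complex.cpow_def_of_ne_zero hU0, ← Complex.ofReal_log (hM.U_pos hb).le]
    have e2 : ∏ l, ((1 - π b l ^ 2 : ℝ) : ℂ) ^ (D / 2 - 1) = ((∏ l, (1 - π b l ^ 2)⁻¹ : ℝ) : ℂ) *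
        ∏ l, Complex.exp ((Real.log (1 - π b l ^ 2) : ℂ) * (D / 2)) := by
      rw [Complex.ofReal_prod, ← Finset.prod_mul_distrib]
      refine Finset.prod_congr rfl fun l _ => ?_
      have h1 := one_sub_sq_pos hb l
      have h10 : ((1 - π b l ^ 2 : ℝ) : ℂ) ≠ 0 := by exact_mod_cast h1.ne'
      rw [Complex.cpow_sub _ _ h10, Complex.cpow_one, Complex.cpow_def_of_ne_zero h10,
        ← Complex.ofReal_log h1.le, div_eq_mul_inv, Complex.ofReal_inv, mul_comm]
    rw [e2]; simp only [hg]; ring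
  have key := analyticOnNhd_integral_mul_exp (μ := ν) hgm hhm.aemeasurable (s := Ioo 0 2) isOpen_Ioo
    fun ρ hρ => by
      refine (hint ρ hρ).congr ?_
      filter_upwards [hcube] with b hb
      rw [← hre b hb ρ]
      simp only [hg]
      rw [norm_mul, Complex.norm_real, Real.norm_of_nonneg]
      · ring
      · exact Finset.prod_nonneg fun l _ => inv_nonneg.2 (one_sub_sq_pos hb l).le
  have heq : (fun D => ∫ b, M.complexWeight D (π b) * E b ∂ν) =
      fun D => ∫ b, g b * Complex.exp (D * h b) ∂ν := by
    funext D
    refine integral_congr_ae ?_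
    filter_upwards [hcube] with b hb using hco b hb D
  rw [heq]
  exact key

end MonomialData

/-! ### The parameter integrals and the uniform bound of the Mellin integrand. -/

lemma prod_pow_cpow {L : Type*} [Fintype L] {t : L → ℝ} (ht : ∀ l, 0 < t l) (n : L → ℕ) (x : ℂ) :
    ((∏ l, t l ^ n l : ℝ) : ℂ) ^ x = ∏ l, (t l : ℂ) ^ ((n l : ℂ) * x) := by
  have hpos : 0 < ∏ l, t l ^ n l := Finset.prod_pos fun l _ => pow_pos (ht l) _
  rw [Complex.cpow_def_of_ne_zero (by exact_mod_cast hpos.ne'), ← Complex.ofReal_log hpos.le,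
    Real.log_prod fun l _ => (pow_pos (ht l) _).ne', Complex.ofReal_sum, Finset.sum_mul,
    Complex.exp_sum]
  refine Finset.prod_congr rfl fun l _ => ?_
  rw [Complex.cpow_def_of_ne_zero (by exact_mod_cast (ht l).ne'), Real.log_pow,
    ← Complex.ofReal_log (ht l).le]
  congr 1; push_cast; ring

lemma prod_cpow_sum_mul {L κ : Type*} [Fintype L] [Fintype κ] {t : L → ℝ} (ht : ∀ l, 0 < t l)
    (n : κ → L → ℕ) (x : κ → ℂ) :
    ∏ l, (t l : ℂ) ^ (∑ k, (n k l : ℂ) * x k) = ∏ k, ((∏ l, t l ^ n k l : ℝ) : ℂ) ^ x k := by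
  simp_rw [prod_pow_cpow ht]
  rw [Finset.prod_comm]
  exact Finset.prod_congr rfl fun l _ => cpow_sum _ (by exact_mod_cast (ht l).ne') _

namespace MonomialData

variable {L KU KR KI : Type*} [Fintype L] [Fintype KU] [Fintype KR] [Fintype KI]
  (M : MonomialData L KU KR KI)

/-- The reason for `φ_l`: `φ_l - 1` is the total exponent of `t_l` in the product of the powers of
all monomials. -/
lemma prod_cpow_phi {t : L → ℝ} (ht : ∀ l, 0 < t l) (x : KU → ℂ) (yR : KR → ℂ) (yI : KI → ℂ) :
    ∏ l, (t l : ℂ) ^ (M.phi x yR yI l - 1) = (∏ k, ((∏ l, t l ^ M.u k l : ℝ) : ℂ) ^ x k) *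
      ((∏ k, ((∏ l, t l ^ M.vR k l : ℝ) : ℂ) ^ yR k) *
        ∏ k, ((∏ l, t l ^ M.vI k l : ℝ) : ℂ) ^ yI k) := by
  rw [← prod_cpow_sum_mul ht, ← prod_cpow_sum_mul ht, ← prod_cpow_sum_mul ht,
    ← Finset.prod_mul_distrib, ← Finset.prod_mul_distrib]
  refine Finset.prod_congr rfl fun l _ => ?_
  have h0 : (t l : ℂ) ≠ 0 := by exact_mod_cast (ht l).ne'
  rw [← Complex.cpow_add _ _ h0, ← Complex.cpow_add _ _ h0, phi]
  congr 1; ring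

/-- The value of the parameter integrals in the Mellin representation. -/
noncomputable def betaFactor (D : ℂ) (x : KU → ℂ) (yR : KR → ℂ) (yI : KI → ℂ) : ℂ :=
  ∏ l, Complex.Gamma (M.phi x yR yI l / 2) * Complex.Gamma (D / 2) /
      (2 * Complex.Gamma ((M.phi x yR yI l + D) / 2))

lemma integral_cube_eq_betaFactor {D : ℂ} (hD : 0 < D.re) {x : KU → ℂ} {yR : KR → ℂ} {yI : KI → ℂ}
    (hφ : ∀ l, 0 < (M.phi x yR yI l).re) :
    ∫ t in cube L, ∏ l, ((t l : ℂ) ^ (M.phi x yR yI l - 1) *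
      ((1 - t l ^ 2 : ℝ) : ℂ) ^ (D / 2 - 1)) = M.betaFactor D x yR yI := by
  rw [restrict_cube, integral_fintype_prod_eq_prod (fun l (t : ℝ) =>
    (t : ℂ) ^ (M.phi x yR yI l - 1) * ((1 - t ^ 2 : ℝ) : ℂ) ^ (D / 2 - 1)), betaFactor]
  refine Finset.prod_congr rfl fun l _ => ?_
  rw [integral_cpow_mul_one_sub_sq_cpow (hφ l) (by simpa using hD), add_div]

variable [DecidableEq KU]

/-- The integrand of the Mellin representation with `i s` replaced by `ε + i s`. -/
noncomputable def regularizedContour (D : ℂ) (f : 𝓢((KR → ℝ) × (KI → ℝ), ℂ))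
    (q : (KU → ℝ) × (KR → ℝ) × (KI → ℝ)) (k₀ : KU) (ε : ℝ)
    (η : ({k : KU // k ≠ k₀} → ℝ) × (KR → ℝ) × (KI → ℝ)) : ℂ :=
  (1 / (2 * (Real.pi : ℂ))) ^ (Fintype.card KU - 1 + Fintype.card KR + Fintype.card KI) *
    (barnesKernel M.a (M.contourX D q k₀ η) (line q.2.1 η.2.1) (line q.2.2 η.2.2) *
      (∫ s in M.invariantDomain, regularizedPower ε f (line q.2.1 η.2.1) (line q.2.2 η.2.2) s) *
      M.betaFactor D (M.contourX D q k₀ η) (line q.2.1 η.2.1) (line q.2.2 η.2.2))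

lemma contourIntegrand_eq (D : ℂ) (f : 𝓢((KR → ℝ) × (KI → ℝ), ℂ))
    (q : (KU → ℝ) × (KR → ℝ) × (KI → ℝ)) (k₀ : KU) :
    M.contourIntegrand D f q k₀ = M.regularizedContour D f q k₀ 0 := by
  funext η
  simp only [contourIntegrand, regularizedContour, mellinIntegrand, barnesKernel, betaFactor, contourX,
    M.regularizedPower_zero]
  ring

variable {D : ℂ} {q : (KU → ℝ) × (KR → ℝ) × (KI → ℝ)} (k₀ : KU)

/-- The real part of `φ_l` on the contour through `q`. -/
noncomputable def phiRe (q : (KU → ℝ) × (KR → ℝ) × (KI → ℝ)) (l : L) : ℝ :=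
  ∑ k, (M.u k l : ℝ) * q.1 k + (∑ k, (M.vR k l : ℝ) * q.2.1 k + ∑ k, (M.vI k l : ℝ) * q.2.2 k) + 1

lemma phi_re (hq : q ∈ M.Delta D) (η : ({k : KU // k ≠ k₀} → ℝ) × (KR → ℝ) × (KI → ℝ)) (l : L) :
    (M.phi (M.contourX D q k₀ η) (line q.2.1 η.2.1) (line q.2.2 η.2.2) l).re = M.phiRe q l := by
  have h : ∀ (n : ℕ) (z : ℂ), ((n : ℂ) * z).re = n * z.re := by intro n z; simp
  simp only [phi, phiRe, Complex.add_re, Complex.re_sum, h, line_re, M.contourX_re k₀ η hq,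
    Complex.one_re]

lemma continuous_phi (l : L) : Continuous fun η : ({k : KU // k ≠ k₀} → ℝ) × (KR → ℝ) × (KI → ℝ) =>
    M.phi (M.contourX D q k₀ η) (line q.2.1 η.2.1) (line q.2.2 η.2.2) l := by
  unfold phi
  refine ((continuous_finsetSum _ fun k _ => continuous_const.mul (M.continuous_contourX k₀ k)).add
    (Continuous.add ?_ ?_)).add continuous_const
  · simp only [line]; fun_prop
  · simp only [line]; fun_prop

lemma integrable_cube_rpow (hD : 0 < D.re) (hq : q ∈ M.Delta D) :
    IntegrableOn (fun t : L → ℝ => ∏ l, (t l ^ (M.phiRe q l - 1) * (1 - t l ^ 2) ^ (D.re / 2 - 1)))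
      (cube L) := by
  rw [IntegrableOn, restrict_cube]
  exact Integrable.fintype_prod (f := fun l (x : ℝ) =>
    x ^ (M.phiRe q l - 1) * (1 - x ^ 2) ^ (D.re / 2 - 1))
    fun l => integrableOn_rpow_mul_one_sub_sq_rpow (hq.2.2.2.2 l) (by linarith)

lemma norm_cube_integrand (hq : q ∈ M.Delta D)
    (η : ({k : KU // k ≠ k₀} → ℝ) × (KR → ℝ) × (KI → ℝ)) {t : L → ℝ} (ht : t ∈ cube L) :
    ‖∏ l, ((t l : ℂ) ^ (M.phi (M.contourX D q k₀ η) (line q.2.1 η.2.1) (line q.2.2 η.2.2) l - 1) *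
      ((1 - t l ^ 2 : ℝ) : ℂ) ^ (D / 2 - 1))‖ =
      ∏ l, (t l ^ (M.phiRe q l - 1) * (1 - t l ^ 2) ^ (D.re / 2 - 1)) := by
  rw [norm_prod]
  refine Finset.prod_congr rfl fun l _ => ?_
  rw [norm_cpow_mul_one_sub_sq_cpow (ht l (mem_univ _)), M.phi_re k₀ hq]
  simp

/-- No estimate of Gamma quotients is needed. The factor is an integral over the cube whose
integrand has a modulus independent of the imaginary parts, so the integral of that modulus bounds
it on the whole contour. -/
lemma exists_norm_betaFactor_le (hD : D ∈ strip) (hq : q ∈ M.Delta D) : ∃ C : ℝ, 0 < C ∧ ∀ η,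
    ‖M.betaFactor D (M.contourX D q k₀ η) (line q.2.1 η.2.1) (line q.2.2 η.2.2)‖ ≤ C := by
  set C := ∫ t in cube L, ∏ l, (t l ^ (M.phiRe q l - 1) * (1 - t l ^ 2) ^ (D.re / 2 - 1)) with hC
  refine ⟨|C| + 1, by positivity, fun η => ?_⟩
  rw [← M.integral_cube_eq_betaFactor hD.1 fun l => by rw [M.phi_re k₀ hq]; exact hq.2.2.2.2 l]
  refine (norm_integral_le_of_norm_le (M.integrable_cube_rpow hD.1 hq) ?_).trans
    ((le_abs_self C).trans (by linarith))
  filter_upwards [ae_restrict_mem (measurableSet_cube L)] with t ht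
  exact (M.norm_cube_integrand k₀ hq η ht).le

lemma continuous_betaFactor (hD : D ∈ strip) (hq : q ∈ M.Delta D) : Continuous fun η =>
    M.betaFactor D (M.contourX D q k₀ η) (line q.2.1 η.2.1) (line q.2.2 η.2.2) := by
  have hpos : ∀ l, 0 < M.phiRe q l := hq.2.2.2.2
  have hre : ∀ η l, ((M.phi (M.contourX D q k₀ η) (line q.2.1 η.2.1) (line q.2.2 η.2.2) l + D) / 2).re =
      (M.phiRe q l + D.re) / 2 := by
    intro η l
    rw [← M.phi_re k₀ hq η l]; simp
  unfold betaFactor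
  refine continuous_finsetProd _ fun l _ => Continuous.div (Continuous.mul ?_ continuous_const)
    (continuous_const.mul ?_) fun η => mul_ne_zero two_ne_zero ?_
  · refine continuous_Gamma_comp ((M.continuous_phi k₀ l).div_const 2) fun η => ?_
    have h := M.phi_re k₀ hq η l
    simp only [Complex.div_ofNat_re, h]
    linarith [hpos l]
  · refine continuous_Gamma_comp (((M.continuous_phi k₀ l).add continuous_const).div_const 2) fun η => ?_
    rw [hre]; linarith [hpos l, hD.1]
  · refine Complex.Gamma_ne_zero_of_re_pos ?_
    rw [hre]; linarith [hpos l, hD.1]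

lemma stronglyMeasurable_integral_regularizedPower (f : 𝓢((KR → ℝ) × (KI → ℝ), ℂ)) (ε : ℝ) :
    StronglyMeasurable fun η : ({k : KU // k ≠ k₀} → ℝ) × (KR → ℝ) × (KI → ℝ) =>
      ∫ s in M.invariantDomain, regularizedPower ε f (line q.2.1 η.2.1) (line q.2.2 η.2.2) s := by
  refine StronglyMeasurable.integral_prod_right' (f := fun p : (({k : KU // k ≠ k₀} → ℝ) ×
    (KR → ℝ) × (KI → ℝ)) × ((KR → ℝ) × (KI → ℝ)) =>
    regularizedPower ε f (line q.2.1 p.1.2.1) (line q.2.2 p.1.2.2) p.2)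
    (Measurable.stronglyMeasurable ?_)
  unfold regularizedPower
  simp only [line]
  refine ((f.continuous.measurable.comp measurable_snd).mul ?_).mul ?_
  · exact Finset.measurable_prod _ fun k _ => by fun_prop
  · exact Finset.measurable_prod _ fun k _ => by fun_prop

lemma aestronglyMeasurable_regularizedContour (hD : D ∈ strip) (hq : q ∈ M.Delta D)
    (ha : ∀ k, 0 < M.a k) (f : 𝓢((KR → ℝ) × (KI → ℝ), ℂ)) (ε : ℝ) :
    AEStronglyMeasurable (M.regularizedContour D f q k₀ ε) := by
  unfold regularizedContour
  exact ((((M.measurable_barnesKernel k₀ hq ha).mul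
    (M.stronglyMeasurable_integral_regularizedPower k₀ f ε).measurable).mul
    (M.continuous_betaFactor k₀ hD hq).measurable).const_mul _).aestronglyMeasurable

lemma one_add_sq_inv_ge (x : ℝ) : ((1 + |x|) ^ 2)⁻¹ ≤ (1 + x ^ 2)⁻¹ := by
  gcongr
  nlinarith [abs_nonneg x, sq_abs x]

lemma exponents_of_mem_Delta (hD : D ∈ strip) (hq : q ∈ M.Delta D) :
    (∀ k, -1 < q.2.1 k ∧ q.2.1 k ≤ 0) ∧ (∀ k, -1 < q.2.2 k) :=
  ⟨fun k => ⟨(M.neg_one_lt_of_mem_Delta hD hq).2 k, (hq.2.1 k).le⟩, fun k => (hq.2.2.1 k).1⟩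

lemma tendsto_regularizedContour (hD : D ∈ strip) (hq : q ∈ M.Delta D)
    (f : 𝓢((KR → ℝ) × (KI → ℝ), ℂ)) (η : ({k : KU // k ≠ k₀} → ℝ) × (KR → ℝ) × (KI → ℝ)) :
    Tendsto (fun ε => M.regularizedContour D f q k₀ ε η) (𝓝[>] 0)
      (𝓝 (M.regularizedContour D f q k₀ 0 η)) := by
  obtain ⟨hR, hI⟩ := M.exponents_of_mem_Delta hD hq
  have := M.tendsto_integral_regularizedPower f (yR := line q.2.1 η.2.1) (yI := line q.2.2 η.2.2)
    (fun k => by rw [line_re]; exact hR k) (fun k => by rw [line_re]; exact hI k)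
  rw [← M.regularizedPower_zero] at this
  unfold regularizedContour
  exact ((this.const_mul _).mul_const _).const_mul _

/-- An integrable bound of the Mellin integrand, uniform in the regularization. -/
theorem exists_norm_regularizedContour_le (hD : D ∈ strip) (hq : q ∈ M.Delta D)
    (ha : ∀ k, 0 < M.a k) (f : 𝓢((KR → ℝ) × (KI → ℝ), ℂ)) : ∃ C : ℝ, ∀ ε : ℝ, 0 < ε → ε ≤ 1 → ∀ η,
      ‖M.regularizedContour D f q k₀ ε η‖ ≤ C * ((∏ k, (1 + η.1 k ^ 2)⁻¹) *
        ((∏ k, (1 + η.2.1 k ^ 2)⁻¹) * ∏ k, (1 + η.2.2 k ^ 2)⁻¹)) := by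
  obtain ⟨hR, hI⟩ := M.exponents_of_mem_Delta hD hq
  obtain ⟨C₁, N, hC₁, h₁⟩ := M.exists_norm_barnesKernel_le k₀ hD hq ha
  -- Integrating by parts `N + 2` times cancels the growth of degree `N` of the kernel and leaves a
  -- quadratic decay. The exponentials from `Γ(-y^I)` and from the powers of `ε + i s` cancel
  -- exactly.
  obtain ⟨C₂, hC₂, h₂⟩ := M.exists_norm_integral_regularizedPower_le f hR hI (N + 2)
  obtain ⟨C₃, hC₃, h₃⟩ := M.exists_norm_betaFactor_le k₀ hD hq
  set c : ℂ := (1 / (2 * (Real.pi : ℂ))) ^ (Fintype.card KU - 1 + Fintype.card KR + Fintype.card KI)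
  refine ⟨‖c‖ * (C₁ * C₂ * C₃), fun ε hε hε1 η => ?_⟩
  have p1 : 0 ≤ ∏ k, (1 + η.1 k ^ 2)⁻¹ := Finset.prod_nonneg fun _ _ => by positivity
  have p2 : 0 ≤ ∏ k, (1 + η.2.1 k ^ 2)⁻¹ := Finset.prod_nonneg fun _ _ => by positivity
  have p3 : 0 ≤ ∏ k, ((1 + |η.2.2 k|) ^ N * Real.exp (-(Real.pi / 2 * |η.2.2 k|))) :=
    Finset.prod_nonneg fun _ _ => by positivity
  have p4 : 0 ≤ ∏ k, (((1 + |η.2.2 k|) ^ (N + 2))⁻¹ * Real.exp (Real.pi / 2 * |η.2.2 k|)) :=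
    Finset.prod_nonneg fun _ _ => by positivity
  have e : (∏ k, ((1 + |η.2.2 k|) ^ N * Real.exp (-(Real.pi / 2 * |η.2.2 k|)))) *
      ∏ k, (((1 + |η.2.2 k|) ^ (N + 2))⁻¹ * Real.exp (Real.pi / 2 * |η.2.2 k|)) ≤
      ∏ k, (1 + η.2.2 k ^ 2)⁻¹ := by
    rw [← Finset.prod_mul_distrib]
    refine Finset.prod_le_prod (fun _ _ => by positivity) fun k _ => ?_
    refine le_trans (le_of_eq ?_) (one_add_sq_inv_ge (η.2.2 k))
    have hexp : Real.exp (-(Real.pi / 2 * |η.2.2 k|)) * Real.exp (Real.pi / 2 * |η.2.2 k|) = 1 := by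
      rw [← Real.exp_add]; simp
    rw [pow_add, mul_inv]
    have hne : (1 + |η.2.2 k|) ^ N ≠ 0 := by positivity
    calc _ = ((1 + |η.2.2 k|) ^ N * ((1 + |η.2.2 k|) ^ N)⁻¹) *
          (Real.exp (-(Real.pi / 2 * |η.2.2 k|)) * Real.exp (Real.pi / 2 * |η.2.2 k|)) *
          ((1 + |η.2.2 k|) ^ 2)⁻¹ := by ring
      _ = _ := by rw [hexp, mul_inv_cancel₀ hne]; ring
  rw [regularizedContour, norm_mul, norm_mul, norm_mul, mul_assoc ‖c‖]
  refine mul_le_mul_of_nonneg_left ?_ (norm_nonneg _)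
  calc _ ≤ (C₁ * ((∏ k, (1 + η.1 k ^ 2)⁻¹) * ((∏ k, (1 + η.2.1 k ^ 2)⁻¹) *
          ∏ k, ((1 + |η.2.2 k|) ^ N * Real.exp (-(Real.pi / 2 * |η.2.2 k|)))))) *
        (C₂ * ∏ k, (((1 + |η.2.2 k|) ^ (N + 2))⁻¹ * Real.exp (Real.pi / 2 * |η.2.2 k|))) * C₃ := by
        refine mul_le_mul (mul_le_mul (h₁ η) (h₂ ε hε hε1 _ _) (norm_nonneg _) (by positivity)) (h₃ η)
          (norm_nonneg _) (by positivity)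
    _ = C₁ * C₂ * C₃ * ((∏ k, (1 + η.1 k ^ 2)⁻¹) * (∏ k, (1 + η.2.1 k ^ 2)⁻¹)) *
        ((∏ k, ((1 + |η.2.2 k|) ^ N * Real.exp (-(Real.pi / 2 * |η.2.2 k|)))) *
        ∏ k, (((1 + |η.2.2 k|) ^ (N + 2))⁻¹ * Real.exp (Real.pi / 2 * |η.2.2 k|))) := by ring
    _ ≤ C₁ * C₂ * C₃ * ((∏ k, (1 + η.1 k ^ 2)⁻¹) * (∏ k, (1 + η.2.1 k ^ 2)⁻¹)) *
        ∏ k, (1 + η.2.2 k ^ 2)⁻¹ := by gcongr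
    _ = _ := by ring

/-- Integration by parts is only performed for `ε > 0`. The resulting bound does not depend on `ε`,
so it passes to the limit `ε → 0`. -/
theorem integrable_contourIntegrand (hD : D ∈ strip) (hq : q ∈ M.Delta D)
    (ha : ∀ k, 0 < M.a k) (f : 𝓢((KR → ℝ) × (KI → ℝ), ℂ)) :
    Integrable (M.contourIntegrand D f q k₀) := by
  rw [contourIntegrand_eq]
  obtain ⟨C, h⟩ := M.exists_norm_regularizedContour_le k₀ hD hq ha f
  refine ((integrable_prod_inv_one_add_sq _ _ _).const_mul C).mono'
    (M.aestronglyMeasurable_regularizedContour k₀ hD hq ha f 0) (ae_of_all _ fun η => ?_)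
  refine le_of_tendsto (M.tendsto_regularizedContour k₀ hD hq f η).norm ?_
  filter_upwards [Ioc_mem_nhdsGT one_pos] with ε hε
  exact h ε hε.1 hε.2 η

theorem tendsto_integral_regularizedContour (hD : D ∈ strip) (hq : q ∈ M.Delta D)
    (ha : ∀ k, 0 < M.a k) (f : 𝓢((KR → ℝ) × (KI → ℝ), ℂ)) :
    Tendsto (fun ε => ∫ η, M.regularizedContour D f q k₀ ε η) (𝓝[>] 0)
      (𝓝 (∫ η, M.contourIntegrand D f q k₀ η)) := by
  rw [contourIntegrand_eq]
  obtain ⟨C, h⟩ := M.exists_norm_regularizedContour_le k₀ hD hq ha f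
  refine tendsto_integral_filter_of_dominated_convergence _ (Eventually.of_forall fun ε =>
    M.aestronglyMeasurable_regularizedContour k₀ hD hq ha f ε) ?_
    ((integrable_prod_inv_one_add_sq _ _ _).const_mul C)
    (ae_of_all _ fun η => M.tendsto_regularizedContour k₀ hD hq f η)
  filter_upwards [Ioc_mem_nhdsGT one_pos] with ε hε
  exact ae_of_all _ fun η => h ε hε.1 hε.2 η

end MonomialData

/-! ### Fubini between the contour and the pair of invariants and parameters. -/

namespace MonomialData

variable {L KU KR KI : Type*} [Fintype L] [Fintype KU] [Fintype KR] [Fintype KI]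
  {M : MonomialData L KU KR KI}

variable (M) in
/-- The measure on the invariants and the parameters. -/
noncomputable abbrev jointMeasure : Measure (((KR → ℝ) × (KI → ℝ)) × (L → ℝ)) :=
  (volume.restrict M.invariantDomain).prod (volume.restrict (cube L))

variable (M) in
lemma ae_jointMeasure : ∀ᵐ p ∂M.jointMeasure,
    p.1 ∈ M.invariantDomain ∧ (∀ k, p.1.2 k ≠ 0) ∧ p.2 ∈ cube L := by
  filter_upwards [Measure.quasiMeasurePreserving_fst.ae
      (ae_restrict_mem M.measurableSet_invariantDomain),
    Measure.quasiMeasurePreserving_fst.ae M.ae_snd_ne_zero,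
    Measure.quasiMeasurePreserving_snd.ae (ae_restrict_mem (measurableSet_cube L))] with p h1 h2 h3
  exact ⟨h1, h2, h3⟩

variable (M) in
/-- The exponential of the parametric representation, with `i s` replaced by `ε + i s`. -/
noncomputable def expFactor (ε : ℝ) (s : (KR → ℝ) × (KI → ℝ)) (t : L → ℝ) : ℂ :=
  Complex.exp (-(M.V s t + ε * ∑ k, ((∏ l, t l ^ M.vI k l : ℝ) : ℂ)) / ((M.U t : ℝ) : ℂ))

variable (M) in
lemma measurable_expFactor (ε : ℝ) :
    Measurable fun p : ((KR → ℝ) × (KI → ℝ)) × (L → ℝ) => M.expFactor ε p.1 p.2 := by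
  have hU : Measurable fun p : ((KR → ℝ) × (KI → ℝ)) × (L → ℝ) => ((M.U p.2 : ℝ) : ℂ) :=
    Complex.measurable_ofReal.comp (M.continuous_U.measurable.comp measurable_snd)
  have hV : Continuous fun p : ((KR → ℝ) × (KI → ℝ)) × (L → ℝ) =>
      -(M.V p.1 p.2 + ε * ∑ k, ((∏ l, p.2 l ^ M.vI k l : ℝ) : ℂ)) := by
    unfold V; fun_prop
  exact Complex.measurable_exp.comp (hV.measurable.div hU)

/-- Only the whole sum is assumed nonnegative, not each invariant: for the invariants of an external
configuration this is what `sum_HVR_dot_nonneg` provides. -/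
lemma Admissible.norm_expFactor_le (hM : M.Admissible) {ε : ℝ} (hε : 0 ≤ ε)
    {s : (KR → ℝ) × (KI → ℝ)} {t : L → ℝ} (ht : t ∈ cube L)
    (hs : 0 ≤ ∑ k, s.1 k * ∏ l, t l ^ M.vR k l) : ‖M.expFactor ε s t‖ ≤ 1 := by
  rw [expFactor, Complex.norm_exp, Real.exp_le_one_iff, Complex.div_ofReal_re]
  refine div_nonpos_of_nonpos_of_nonneg ?_ (hM.U_pos ht).le
  have h2 : 0 ≤ ε * ∑ k, ∏ l, t l ^ M.vI k l := mul_nonneg hε (Finset.sum_nonneg fun k _ =>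
    Finset.prod_nonneg fun l _ => pow_nonneg (pos_of_mem_cube ht l).le _)
  have h3 : (M.V s t + ε * ∑ k, ((∏ l, t l ^ M.vI k l : ℝ) : ℂ)).re =
      (∑ k, s.1 k * ∏ l, t l ^ M.vR k l) + ε * ∑ k, ∏ l, t l ^ M.vI k l := by
    rw [V, ← Complex.ofReal_sum, ← Complex.ofReal_mul, Complex.add_re, Complex.add_re,
      Complex.ofReal_re, Complex.ofReal_re, Complex.I_mul_re, Complex.ofReal_im, neg_zero, add_zero]
  rw [Complex.neg_re, h3]
  linarith

lemma sum_monomial_nonneg {s : (KR → ℝ) × (KI → ℝ)} (hs : s ∈ M.invariantDomain) {t : L → ℝ}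
    (ht : t ∈ cube L) : 0 ≤ ∑ k, s.1 k * ∏ l, t l ^ M.vR k l :=
  Finset.sum_nonneg fun k _ => mul_nonneg (hs k).le
    (Finset.prod_nonneg fun l _ => pow_nonneg (pos_of_mem_cube ht l).le _)

lemma amplitude_eq (K D : ℂ) (s : (KR → ℝ) × (KI → ℝ)) : M.amplitude K D s =
    K * ∫ t in cube L, M.complexWeight D t * M.expFactor 0 s t := by
  simp [amplitude, complexWeight, expFactor]

lemma integrable_schwartz_mul_weight (hM : M.Admissible) {ρ : ℝ} (hρ : ρ ∈ Ioo (0 : ℝ) 2)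
    (f : 𝓢((KR → ℝ) × (KI → ℝ), ℂ)) :
    Integrable (fun p => ‖f p.1‖ * M.weight ρ p.2) M.jointMeasure := by
  have hf : IntegrableOn (fun s => ‖f s‖) M.invariantDomain := by
    simpa using M.integrableOn_schwartz_mul_rpow f (τR := fun _ => 0) (τI := fun _ => 0)
      (fun _ => by norm_num) (fun _ => by norm_num) 0
  exact Integrable.mul_prod hf (hM.integrableOn_weight hρ.1 hρ.2)

lemma norm_joint_le (hM : M.Admissible) (D : ℂ) {ε : ℝ} (hε : 0 ≤ ε) (f : 𝓢((KR → ℝ) × (KI → ℝ), ℂ)) :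
    ∀ᵐ p ∂M.jointMeasure, ‖f p.1 * (M.complexWeight D p.2 * M.expFactor ε p.1 p.2)‖ ≤
      ‖f p.1‖ * M.weight D.re p.2 := by
  filter_upwards [M.ae_jointMeasure] with p hp
  rw [norm_mul, norm_mul, hM.norm_complexWeight D hp.2.2]
  exact mul_le_mul_of_nonneg_left (mul_le_of_le_one_right (hM.weight_nonneg _ hp.2.2)
    (hM.norm_expFactor_le hε hp.2.2 (sum_monomial_nonneg hp.1 hp.2.2))) (norm_nonneg _)

lemma measurable_joint (D : ℂ) (ε : ℝ) (f : 𝓢((KR → ℝ) × (KI → ℝ), ℂ)) :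
    Measurable fun p : ((KR → ℝ) × (KI → ℝ)) × (L → ℝ) =>
      f p.1 * (M.complexWeight D p.2 * M.expFactor ε p.1 p.2) :=
  (f.continuous.measurable.comp measurable_fst).mul
    (((M.measurable_complexWeight D).comp measurable_snd).mul (M.measurable_expFactor ε))

lemma integrable_joint (hM : M.Admissible) {D : ℂ} (hD : D ∈ strip) {ε : ℝ} (hε : 0 ≤ ε)
    (f : 𝓢((KR → ℝ) × (KI → ℝ), ℂ)) :
    Integrable (fun p => f p.1 * (M.complexWeight D p.2 * M.expFactor ε p.1 p.2)) M.jointMeasure :=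
  (integrable_schwartz_mul_weight hM hD f).mono' (measurable_joint D ε f).aestronglyMeasurable
    (norm_joint_le hM D hε f)

lemma tendsto_integral_joint (hM : M.Admissible) {D : ℂ} (hD : D ∈ strip)
    (f : 𝓢((KR → ℝ) × (KI → ℝ), ℂ)) :
    Tendsto (fun ε : ℝ => ∫ p, f p.1 * (M.complexWeight D p.2 * M.expFactor ε p.1 p.2) ∂M.jointMeasure)
      (𝓝[>] 0)
      (𝓝 (∫ p, f p.1 * (M.complexWeight D p.2 * M.expFactor 0 p.1 p.2) ∂M.jointMeasure)) := by
  refine tendsto_integral_filter_of_dominated_convergence _ (Eventually.of_forall fun ε =>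
    (measurable_joint D ε f).aestronglyMeasurable) ?_ (integrable_schwartz_mul_weight hM hD f)
    (ae_of_all _ fun p => ?_)
  · filter_upwards [self_mem_nhdsWithin] with ε hε
    exact norm_joint_le hM D (le_of_lt hε) f
  · refine Tendsto.const_mul _ (Tendsto.const_mul _ ?_)
    have : Continuous fun ε : ℝ => M.expFactor ε p.1 p.2 := by unfold expFactor; fun_prop
    exact (this.tendsto 0).mono_left nhdsWithin_le_nhds

variable [DecidableEq KU]

/-- The kernel with the powers of the invariants and of the parameters. -/
lemma barnesKernel_mul_prod (ha : ∀ k, 0 < M.a k) {t : L → ℝ} (ht : t ∈ cube L) (x : KU → ℂ)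
    (yR : KR → ℂ) (yI : KI → ℂ) {ε : ℝ} (hε : 0 < ε) {s : (KR → ℝ) × (KI → ℝ)}
    (hs : s ∈ M.invariantDomain) :
    barnesKernel M.a x yR yI * ((∏ k, ((s.1 k : ℝ) : ℂ) ^ yR k) *
        ∏ k, ((ε : ℂ) + Complex.I * ((s.2 k : ℝ) : ℂ)) ^ yI k) *
        ∏ l, (t l : ℂ) ^ (M.phi x yR yI l - 1) =
      barnesKernel (fun k => M.a k * ∏ l, t l ^ M.u k l) x yR yI *
        ((∏ k, ((s.1 k * ∏ l, t l ^ M.vR k l : ℝ) : ℂ) ^ yR k) *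
        ∏ k, (((ε : ℂ) + Complex.I * ((s.2 k : ℝ) : ℂ)) * ((∏ l, t l ^ M.vI k l : ℝ) : ℂ)) ^ yI k) := by
  have hp : ∀ n : L → ℕ, 0 < ∏ l, t l ^ n l := fun n =>
    Finset.prod_pos fun l _ => pow_pos (pos_of_mem_cube ht l) _
  rw [M.prod_cpow_phi (pos_of_mem_cube ht)]
  have e1 : ∏ k, ((s.1 k * ∏ l, t l ^ M.vR k l : ℝ) : ℂ) ^ yR k =
      (∏ k, ((s.1 k : ℝ) : ℂ) ^ yR k) * ∏ k, ((∏ l, t l ^ M.vR k l : ℝ) : ℂ) ^ yR k := by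
    rw [← Finset.prod_mul_distrib]
    exact Finset.prod_congr rfl fun k _ => ofReal_mul_cpow (hs k) (hp _) _
  have e2 : ∏ k, (((ε : ℂ) + Complex.I * ((s.2 k : ℝ) : ℂ)) * ((∏ l, t l ^ M.vI k l : ℝ) : ℂ)) ^ yI k =
      (∏ k, ((ε : ℂ) + Complex.I * ((s.2 k : ℝ) : ℂ)) ^ yI k) *
        ∏ k, ((∏ l, t l ^ M.vI k l : ℝ) : ℂ) ^ yI k := by
    rw [← Finset.prod_mul_distrib]
    refine Finset.prod_congr rfl fun k _ => mul_ofReal_cpow (fun h => ?_) (hp _) _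
    have := congrArg Complex.re h
    simp at this
    exact hε.ne' this
  have e3 : ∏ k, ((M.a k * ∏ l, t l ^ M.u k l : ℝ) : ℂ) ^ x k * Complex.Gamma (-x k) =
      (∏ k, (M.a k : ℂ) ^ x k * Complex.Gamma (-x k)) *
        ∏ k, ((∏ l, t l ^ M.u k l : ℝ) : ℂ) ^ x k := by
    rw [← Finset.prod_mul_distrib]
    refine Finset.prod_congr rfl fun k _ => ?_
    rw [ofReal_mul_cpow (ha k) (hp _)]; ring
  rw [e1, e2, barnesKernel, barnesKernel, e3]
  ring

variable {D : ℂ} {q : (KU → ℝ) × (KR → ℝ) × (KI → ℝ)} (k₀ : KU)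

variable (M) in
/-- The complete integrand, as a function of invariants, parameters and contour variables. -/
noncomputable def fullIntegrand (D : ℂ) (f : 𝓢((KR → ℝ) × (KI → ℝ), ℂ))
    (q : (KU → ℝ) × (KR → ℝ) × (KI → ℝ)) (k₀ : KU) (ε : ℝ) (p : ((KR → ℝ) × (KI → ℝ)) × (L → ℝ))
    (η : ({k : KU // k ≠ k₀} → ℝ) × (KR → ℝ) × (KI → ℝ)) : ℂ :=
  barnesKernel M.a (M.contourX D q k₀ η) (line q.2.1 η.2.1) (line q.2.2 η.2.2) *
    (regularizedPower ε f (line q.2.1 η.2.1) (line q.2.2 η.2.2) p.1 *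
    ∏ l, ((p.2 l : ℂ) ^ (M.phi (M.contourX D q k₀ η) (line q.2.1 η.2.1) (line q.2.2 η.2.2) l - 1) *
      ((1 - p.2 l ^ 2 : ℝ) : ℂ) ^ (D / 2 - 1)))

/-- Here `ε > 0` is essential. The kernel bound involves `‖ε + i s‖ / ε ≤ ε⁻¹ (1 + |s|)`, polynomial
in `s` and absorbed by the Schwartz function, with a constant that blows up as `ε → 0`. The modulus
is dominated by a product of functions of `s`, `t` and `η` separately. -/
theorem integrable_fullIntegrand (hM : M.Admissible) (hD : D ∈ strip) (hq : q ∈ M.Delta D)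
    (f : 𝓢((KR → ℝ) × (KI → ℝ), ℂ)) {ε : ℝ} (hε : 0 < ε) (hε1 : ε ≤ 1) :
    Integrable (Function.uncurry (M.fullIntegrand D f q k₀ ε)) (M.jointMeasure.prod volume) := by
  obtain ⟨hR, hI⟩ := M.exponents_of_mem_Delta hD hq
  obtain ⟨C, N, hC, h⟩ := M.exists_norm_barnesKernel_mul_cpow_le k₀ hD hq hM.pos
  have hs := M.integrableOn_schwartz_mul_rpow f hR (τI := q.2.2)
    (fun k => ⟨hI k, (hq.2.2.1 k).2.le⟩) N
  have hint := ((hs.mul_prod (M.integrable_cube_rpow hD.1 hq)).mul_prod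
    (integrable_prod_inv_one_add_sq {k : KU // k ≠ k₀} KR KI)).const_mul
    (C * (1 + ε⁻¹) ^ (N * Fintype.card KI))
  refine hint.mono' (Measurable.aestronglyMeasurable ?_) ?_
  · have hk := M.measurable_barnesKernel k₀ hq hM.pos
    unfold Function.uncurry fullIntegrand regularizedPower
    refine (hk.comp measurable_snd).mul (Measurable.mul (Measurable.mul (Measurable.mul ?_ ?_) ?_) ?_)
    · exact f.continuous.measurable.comp (measurable_fst.comp measurable_fst)
    · simp only [line]; exact Finset.measurable_prod _ fun k _ => by fun_prop
    · simp only [line]; exact Finset.measurable_prod _ fun k _ => by fun_prop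
    · refine Finset.measurable_prod _ fun l _ => Measurable.mul (Measurable.pow ?_ ?_) ?_
      · fun_prop
      · exact ((M.continuous_phi k₀ l).measurable.comp measurable_snd).sub_const 1
      · fun_prop
  · filter_upwards [Measure.quasiMeasurePreserving_fst.ae M.ae_jointMeasure] with x hx
    obtain ⟨⟨s, t⟩, η⟩ := x
    obtain ⟨hs, hs0, ht⟩ := hx
    simp only at hs hs0 ht
    have h1 := h η s.1 (fun k => (ε : ℂ) + Complex.I * ((s.2 k : ℝ) : ℂ)) hs (fun k => by simpa using hε)
    have hnorm : ∀ k, ‖(ε : ℂ) + Complex.I * ((s.2 k : ℝ) : ℂ)‖ ^ q.2.2 k *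
        (1 + ‖(ε : ℂ) + Complex.I * ((s.2 k : ℝ) : ℂ)‖ /
          ((ε : ℂ) + Complex.I * ((s.2 k : ℝ) : ℂ)).re) ^ N ≤
        (1 + ε⁻¹) ^ N * (|s.2 k| ^ q.2.2 k * (1 + |s.2 k|) ^ N) := by
      intro k
      set z : ℂ := (ε : ℂ) + Complex.I * ((s.2 k : ℝ) : ℂ) with hz
      have hre : z.re = ε := by simp [hz]
      have him : z.im = s.2 k := by simp [hz]
      have b1 : |s.2 k| ≤ ‖z‖ := by rw [← him]; exact Complex.abs_im_le_norm z
      have b2 : ‖z‖ ≤ 1 + |s.2 k| := by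
        refine (Complex.norm_le_abs_re_add_abs_im z).trans ?_
        rw [hre, him, abs_of_pos hε]; linarith
      have b3 : 1 + ‖z‖ / ε ≤ (1 + ε⁻¹) * (1 + |s.2 k|) := by
        rw [div_eq_inv_mul]
        have : ε⁻¹ * ‖z‖ ≤ ε⁻¹ * (1 + |s.2 k|) := by gcongr
        nlinarith [abs_nonneg (s.2 k)]
      rw [hre]
      calc _ ≤ |s.2 k| ^ q.2.2 k * ((1 + ε⁻¹) * (1 + |s.2 k|)) ^ N := by
            refine mul_le_mul (Real.rpow_le_rpow_of_nonpos (abs_pos.2 (hs0 k)) b1 (hq.2.2.1 k).2.le)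
              (pow_le_pow_left₀ (by positivity) b3 N) (by positivity) (by positivity)
        _ = _ := by rw [mul_pow]; ring
    have hprod : ∏ k, (‖(ε : ℂ) + Complex.I * ((s.2 k : ℝ) : ℂ)‖ ^ q.2.2 k *
        (1 + ‖(ε : ℂ) + Complex.I * ((s.2 k : ℝ) : ℂ)‖ /
          ((ε : ℂ) + Complex.I * ((s.2 k : ℝ) : ℂ)).re) ^ N) ≤
        (1 + ε⁻¹) ^ (N * Fintype.card KI) * ∏ k, (|s.2 k| ^ q.2.2 k * (1 + |s.2 k|) ^ N) := by
      rw [pow_mul, ← Finset.card_univ, ← Finset.prod_const, ← Finset.prod_mul_distrib]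
      refine Finset.prod_le_prod (fun k _ => ?_) fun k _ => hnorm k
      have : 0 ≤ ‖(ε : ℂ) + Complex.I * ((s.2 k : ℝ) : ℂ)‖ /
          ((ε : ℂ) + Complex.I * ((s.2 k : ℝ) : ℂ)).re := by simp; positivity
      positivity
    have hn := M.norm_cube_integrand k₀ hq η ht
    have hsplit : ‖Function.uncurry (M.fullIntegrand D f q k₀ ε) ((s, t), η)‖ =
        ‖barnesKernel M.a (M.contourX D q k₀ η) (line q.2.1 η.2.1) (line q.2.2 η.2.2) *
          ((∏ k, (s.1 k : ℂ) ^ line q.2.1 η.2.1 k) *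
            ∏ k, ((ε : ℂ) + Complex.I * ((s.2 k : ℝ) : ℂ)) ^ line q.2.2 η.2.2 k)‖ * ‖f s‖ *
        ∏ l, (t l ^ (M.phiRe q l - 1) * (1 - t l ^ 2) ^ (D.re / 2 - 1)) := by
      rw [← hn]
      simp only [Function.uncurry, fullIntegrand, regularizedPower, norm_mul]
      ring
    rw [hsplit]
    have p0 : 0 ≤ ∏ k, s.1 k ^ q.2.1 k := Finset.prod_nonneg fun k _ => Real.rpow_nonneg (hs k).le _
    have p1 : 0 ≤ ∏ l, (t l ^ (M.phiRe q l - 1) * (1 - t l ^ 2) ^ (D.re / 2 - 1)) := by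
      rw [← hn]; exact norm_nonneg _
    have p2 : 0 ≤ (∏ k, (1 + η.1 k ^ 2)⁻¹) * ((∏ k, (1 + η.2.1 k ^ 2)⁻¹) *
          ∏ k, (1 + η.2.2 k ^ 2)⁻¹) := by
      refine mul_nonneg ?_ (mul_nonneg ?_ ?_) <;> exact Finset.prod_nonneg fun _ _ => by positivity
    calc _ ≤ (C * ((∏ k, s.1 k ^ q.2.1 k) * ((1 + ε⁻¹) ^ (N * Fintype.card KI) *
            ∏ k, (|s.2 k| ^ q.2.2 k * (1 + |s.2 k|) ^ N))) *
            ((∏ k, (1 + η.1 k ^ 2)⁻¹) * ((∏ k, (1 + η.2.1 k ^ 2)⁻¹) *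
            ∏ k, (1 + η.2.2 k ^ 2)⁻¹))) * ‖f s‖ *
            ∏ l, (t l ^ (M.phiRe q l - 1) * (1 - t l ^ 2) ^ (D.re / 2 - 1)) := by
          refine mul_le_mul_of_nonneg_right (mul_le_mul_of_nonneg_right (h1.trans ?_)
            (norm_nonneg _)) p1
          refine mul_le_mul_of_nonneg_right (mul_le_mul_of_nonneg_left
            (mul_le_mul_of_nonneg_left hprod p0) hC.le) p2
      _ = _ := by ring

/-- The Mellin representation with `i s` replaced by `ε + i s`. -/
theorem integral_joint_eq (hM : M.Admissible) (hD : D ∈ strip) (hq : q ∈ M.Delta D)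
    (f : 𝓢((KR → ℝ) × (KI → ℝ), ℂ)) {ε : ℝ} (hε : 0 < ε) (hε1 : ε ≤ 1) :
    ∫ p, f p.1 * (M.complexWeight D p.2 * M.expFactor ε p.1 p.2) ∂M.jointMeasure =
      ∫ η, M.regularizedContour D f q k₀ ε η := by
  set c : ℂ := (1 / (2 * (Real.pi : ℂ))) ^ (Fintype.card KU - 1 + Fintype.card KR + Fintype.card KI)
    with hc
  have hswap := integral_integral_swap (integrable_fullIntegrand k₀ hM hD hq f hε hε1)
  -- At fixed `η` the invariants and the parameters separate: the former give the smeared power, the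
  -- latter the Beta factors.
  have hright : ∀ η, ∫ p, M.fullIntegrand D f q k₀ ε p η ∂M.jointMeasure =
      barnesKernel M.a (M.contourX D q k₀ η) (line q.2.1 η.2.1) (line q.2.2 η.2.2) *
      (∫ s in M.invariantDomain, regularizedPower ε f (line q.2.1 η.2.1) (line q.2.2 η.2.2) s) *
      M.betaFactor D (M.contourX D q k₀ η) (line q.2.1 η.2.1) (line q.2.2 η.2.2) := by
    intro η
    simp only [fullIntegrand]
    rw [integral_const_mul, mul_assoc, integral_prod_mul
      (fun s => regularizedPower ε f (line q.2.1 η.2.1) (line q.2.2 η.2.2) s)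
      (fun t : L → ℝ => ∏ l, ((t l : ℂ) ^
        (M.phi (M.contourX D q k₀ η) (line q.2.1 η.2.1) (line q.2.2 η.2.2) l - 1) *
        ((1 - t l ^ 2 : ℝ) : ℂ) ^ (D / 2 - 1))),
      M.integral_cube_eq_betaFactor hD.1 fun l => by rw [M.phi_re k₀ hq]; exact hq.2.2.2.2 l]
  -- At fixed invariants and parameters, the powers of `t` are absorbed into the monomials, and the
  -- contour integral is the Mellin-Barnes formula for the parametric integrand.
  have hleft : ∀ᵐ p ∂M.jointMeasure, f p.1 * (M.complexWeight D p.2 * M.expFactor ε p.1 p.2) =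
      c * ∫ η, M.fullIntegrand D f q k₀ ε p η := by
    filter_upwards [M.ae_jointMeasure] with p hp
    obtain ⟨s, t⟩ := p
    obtain ⟨hs, hs0, ht⟩ := hp
    simp only at hs hs0 ht
    have hpos : ∀ n : L → ℕ, 0 < ∏ l, t l ^ n l := fun n =>
      Finset.prod_pos fun l _ => pow_pos (pos_of_mem_cube ht l) _
    have key := M.integral_barnesKernel_mul_cpow k₀ hD hq
      (A := fun k => M.a k * ∏ l, t l ^ M.u k l) (fun k => mul_pos (hM.pos k) (hpos _))
      (zR := fun k => s.1 k * ∏ l, t l ^ M.vR k l)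
      (zI := fun k => ((ε : ℂ) + Complex.I * ((s.2 k : ℝ) : ℂ)) * ((∏ l, t l ^ M.vI k l : ℝ) : ℂ))
      (fun k => mul_pos (hs k) (hpos _)) (fun k => by
        rw [Complex.re_mul_ofReal]; exact mul_pos (by simpa using hε) (hpos _))
    have e1 : ∀ η, M.fullIntegrand D f q k₀ ε (s, t) η =
        (f s * ∏ l, ((1 - t l ^ 2 : ℝ) : ℂ) ^ (D / 2 - 1)) *
        (barnesKernel (fun k => M.a k * ∏ l, t l ^ M.u k l) (M.contourX D q k₀ η)
          (line q.2.1 η.2.1) (line q.2.2 η.2.2) *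
        ((∏ k, ((s.1 k * ∏ l, t l ^ M.vR k l : ℝ) : ℂ) ^ line q.2.1 η.2.1 k) *
        ∏ k, (((ε : ℂ) + Complex.I * ((s.2 k : ℝ) : ℂ)) *
          ((∏ l, t l ^ M.vI k l : ℝ) : ℂ)) ^ line q.2.2 η.2.2 k)) := by
      intro η
      rw [← barnesKernel_mul_prod hM.pos ht _ _ _ hε hs]
      simp only [fullIntegrand, regularizedPower, Finset.prod_mul_distrib]
      ring
    simp_rw [e1]
    rw [integral_const_mul, mul_left_comm c, key, complexWeight, expFactor]
    have e2 : (∑ k, M.a k * ∏ l, t l ^ M.u k l) = M.U t := rfl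
    have e3 : ∑ k, ((s.1 k * ∏ l, t l ^ M.vR k l : ℝ) : ℂ) + ∑ k,
        ((ε : ℂ) + Complex.I * ((s.2 k : ℝ) : ℂ)) * ((∏ l, t l ^ M.vI k l : ℝ) : ℂ) =
        M.V s t + ε * ∑ k, ((∏ l, t l ^ M.vI k l : ℝ) : ℂ) := by
      rw [V, Complex.ofReal_sum, Complex.ofReal_sum, Finset.mul_sum, Finset.mul_sum, add_assoc,
        ← Finset.sum_add_distrib]
      congr 1
      refine Finset.sum_congr rfl fun k _ => ?_
      rw [Complex.ofReal_mul]; ring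
    rw [e2, e3]
    ring
  rw [integral_congr_ae hleft, integral_const_mul, hswap, ← integral_const_mul]
  refine integral_congr_ae (ae_of_all _ fun η => ?_)
  simp only
  rw [hright η, regularizedContour]

end MonomialData

/-! ### The tempered distribution and the domain `Δ`. -/

lemma isOpen_strip : IsOpen strip :=
  (isOpen_lt continuous_const Complex.continuous_re).inter
    (isOpen_lt Complex.continuous_re continuous_const)

/-- Integration against a bounded measurable function on a measurable set, as a tempered
distribution. -/
lemma exists_temperedDistribution_of_bound {E : Type*} [NormedAddCommGroup E] [NormedSpace ℝ E]
    [MeasureSpace E] [BorelSpace E] [SecondCountableTopology E]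
    [(volume : Measure E).HasTemperateGrowth] {S : Set E} (hS : MeasurableSet S) {g : E → ℂ}
    (hg : Measurable g) {C : ℝ} (hC : ∀ s ∈ S, ‖g s‖ ≤ C) :
    ∃ T : 𝓢'(E, ℂ), ∀ f : 𝓢(E, ℂ), T f = ∫ s in S, f s * g s := by
  -- Extended by zero outside `S`, the function is essentially bounded, and such functions define
  -- tempered distributions.
  have hmem : MemLp (S.indicator g) ⊤ (volume : Measure E) := by
    refine memLp_top_of_bound (hg.indicator hS).aestronglyMeasurable |C| (ae_of_all _ fun s => ?_)
    by_cases hs : s ∈ S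
    · rw [indicator_of_mem hs]; exact (hC s hs).trans (le_abs_self C)
    · rw [indicator_of_notMem hs, norm_zero]; exact abs_nonneg C
  refine ⟨Lp.toTemperedDistribution hmem.toLp, fun f => ?_⟩
  rw [Lp.toTemperedDistribution_apply, ← integral_indicator hS]
  refine integral_congr_ae ?_
  filter_upwards [hmem.coeFn_toLp] with s hs
  rw [hs, smul_eq_mul]
  by_cases h : s ∈ S <;> simp [h]

namespace MonomialData

variable {L KU KR KI : Type*} [Fintype L] [Fintype KU] [Fintype KR] [Fintype KI]
  {M : MonomialData L KU KR KI}

variable (M) in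
lemma convex_Delta (D : ℂ) : Convex ℝ (M.Delta D) := by
  rintro ⟨σ, τ, κ⟩ ⟨h1, h2, h3, h4, h5⟩ ⟨σ', τ', κ'⟩ ⟨h1', h2', h3', h4', h5'⟩ a b ha hb hab
  simp only at h1 h2 h3 h4 h5 h1' h2' h3' h4' h5'
  have hneg : ∀ {x y : ℝ}, 0 < x → 0 < y → 0 < a * x + b * y := fun hx hy => by
    rcases ha.lt_or_eq with h | h
    · exact add_pos_of_pos_of_nonneg (mul_pos h hx) (mul_nonneg hb hy.le)
    · subst h; rw [zero_add] at hab; subst hab; simpa using hy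
  refine ⟨fun k => ?_, fun k => ?_, fun k => ⟨?_, ?_⟩, ?_, fun l => ?_⟩
  · have := hneg (neg_pos.2 (h1 k)) (neg_pos.2 (h1' k))
    simp; linarith
  · have := hneg (neg_pos.2 (h2 k)) (neg_pos.2 (h2' k))
    simp; linarith
  · have := hneg (x := κ k + 1) (y := κ' k + 1) (by linarith [(h3 k).1]) (by linarith [(h3' k).1])
    simp; linarith
  · have := hneg (neg_pos.2 (h3 k).2) (neg_pos.2 (h3' k).2)
    simp; linarith
  · simp only [Prod.smul_mk, Prod.mk_add_mk, Pi.add_apply, Pi.smul_apply, smul_eq_mul,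
      Finset.sum_add_distrib, ← Finset.mul_sum]
    linear_combination a * h4 + b * h4' - D.re / 2 * hab
  · simp only [Prod.smul_mk, Prod.mk_add_mk, Pi.add_apply, Pi.smul_apply, smul_eq_mul, mul_add,
      Finset.sum_add_distrib, mul_left_comm _ a, mul_left_comm _ b, ← Finset.mul_sum]
    have := hneg (h5 l) (h5' l)
    linarith

/-- Almost all of the total `-Re D / 2` is put on the square-free monomial, so no `t_l` receives
from it an exponent below `-Re D / 2 > -1`. All coordinates are lowered by a small `δ`, and the term
`N δ` restores the sum. -/
lemma Admissible.nonempty_Delta (hM : M.Admissible) {D : ℂ} (hD : D ∈ strip) :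
    (M.Delta D).Nonempty := by
  classical
  obtain ⟨k₁, hk₁⟩ := hM.exists_squarefree
  have h0 : 0 < D.re := hD.1
  have h2 : D.re < 2 := hD.2
  set S : ℝ := ∑ l, (∑ k, (M.u k l : ℝ) + (∑ k, (M.vR k l : ℝ) + ∑ k, (M.vI k l : ℝ))) with hS
  have hSl : ∀ l, ∑ k, (M.u k l : ℝ) + (∑ k, (M.vR k l : ℝ) + ∑ k, (M.vI k l : ℝ)) ≤ S := fun l =>
    Finset.single_le_sum (f := fun l => ∑ k, (M.u k l : ℝ) + (∑ k, (M.vR k l : ℝ) +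
      ∑ k, (M.vI k l : ℝ))) (fun _ _ => by positivity) (Finset.mem_univ l)
  have hS0 : 0 ≤ S := Finset.sum_nonneg fun _ _ => by positivity
  set N : ℝ := (Fintype.card KU : ℝ) + ((Fintype.card KR : ℝ) + (Fintype.card KI : ℝ)) with hN
  have hN0 : 0 ≤ N := by positivity
  -- The two margins: `Re D / 2` keeps the distinguished `σ` negative, and `1 - Re D / 2` keeps
  -- every `φ_l` positive.
  set c : ℝ := min (D.re / 2) (1 - D.re / 2) with hc
  have hc0 : 0 < c := lt_min (by linarith) (by linarith)
  have hc1 : c ≤ D.re / 2 := min_le_left _ _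
  have hc2 : c ≤ 1 - D.re / 2 := min_le_right _ _
  obtain ⟨δ, hδ0, hδN, hδS, hδ1⟩ : ∃ δ : ℝ, 0 < δ ∧ δ * N < c ∧ δ * S < c ∧ δ < 1 := by
    refine ⟨c / (N + S + 2), by positivity, ?_, ?_, ?_⟩
    · rw [div_mul_eq_mul_div, div_lt_iff₀ (by positivity)]; nlinarith
    · rw [div_mul_eq_mul_div, div_lt_iff₀ (by positivity)]; nlinarith
    · rw [div_lt_iff₀ (by positivity)]; nlinarith
  refine ⟨(fun k => -δ + if k = k₁ then -(D.re / 2) + N * δ else 0, fun _ => -δ, fun _ => -δ),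
    fun k => ?_, fun _ => by simpa using hδ0, fun _ => ⟨by simpa using hδ1, by simpa using hδ0⟩, ?_,
    fun l => ?_⟩
  · simp only
    split_ifs <;> nlinarith
  · simp only [Finset.sum_add_distrib, Finset.sum_ite_eq', Finset.mem_univ, if_true, Finset.sum_const,
      Finset.card_univ, nsmul_eq_mul]
    rw [hN]; ring
  · simp only [mul_add, Finset.sum_add_distrib, mul_ite, mul_zero, Finset.sum_ite_eq', Finset.mem_univ,
      if_true, ← Finset.sum_mul]
    have h3 := hSl l
    have h4 : -(D.re / 2) ≤ (M.u k₁ l : ℝ) * -(D.re / 2) + (M.u k₁ l : ℝ) * (N * δ) := by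
      have h5 : (M.u k₁ l : ℝ) ≤ 1 := by exact_mod_cast hk₁ l
      have h6 : (0 : ℝ) ≤ M.u k₁ l := by positivity
      have h7 : 0 ≤ (M.u k₁ l : ℝ) * (N * δ) := by positivity
      nlinarith
    nlinarith

variable (M) in
lemma measurable_amplitude (K D : ℂ) : Measurable (M.amplitude K D) := by
  have h : StronglyMeasurable fun s => ∫ t in cube L, M.complexWeight D t * M.expFactor 0 s t :=
    StronglyMeasurable.integral_prod_right'
      (f := fun p : ((KR → ℝ) × (KI → ℝ)) × (L → ℝ) => M.complexWeight D p.2 * M.expFactor 0 p.1 p.2)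
      (((M.measurable_complexWeight D).comp measurable_snd).mul
        (M.measurable_expFactor 0)).stronglyMeasurable
  have e : M.amplitude K D = fun s =>
      K * ∫ t in cube L, M.complexWeight D t * M.expFactor 0 s t := funext (amplitude_eq K D)
  rw [e]
  exact h.measurable.const_mul K

lemma Admissible.norm_amplitude_le (hM : M.Admissible) (K : ℂ) {D : ℂ} (hD : D ∈ strip)
    {s : (KR → ℝ) × (KI → ℝ)} (hs : s ∈ M.invariantDomain) :
    ‖M.amplitude K D s‖ ≤ ‖K‖ * ∫ t in cube L, M.weight D.re t := by
  rw [amplitude_eq, norm_mul]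
  refine mul_le_mul_of_nonneg_left (norm_integral_le_of_norm_le
    (hM.integrableOn_weight hD.1 hD.2) ?_) (norm_nonneg _)
  filter_upwards [ae_restrict_mem (measurableSet_cube L)] with t ht
  rw [norm_mul, hM.norm_complexWeight D ht]
  exact mul_le_of_le_one_right (hM.weight_nonneg _ ht)
    (hM.norm_expFactor_le le_rfl ht (sum_monomial_nonneg hs ht))

lemma Admissible.setIntegral_amplitude (hM : M.Admissible) (K : ℂ) {D : ℂ} (hD : D ∈ strip)
    (f : 𝓢((KR → ℝ) × (KI → ℝ), ℂ)) :
    IntegrableOn (fun s => f s * M.amplitude K D s) M.invariantDomain ∧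
    ∫ s in M.invariantDomain, f s * M.amplitude K D s =
      K * ∫ p, f p.1 * (M.complexWeight D p.2 * M.expFactor 0 p.1 p.2) ∂M.jointMeasure := by
  have hint := integrable_joint hM hD le_rfl f
  have e : (fun s => f s * M.amplitude K D s) = fun s =>
      K * ∫ t in cube L, f s * (M.complexWeight D t * M.expFactor 0 s t) := by
    funext s
    rw [amplitude_eq, integral_const_mul]; ring
  refine ⟨?_, ?_⟩
  · rw [e]; exact hint.integral_prod_left.const_mul K
  · rw [e, integral_const_mul, integral_prod _ hint]

lemma Admissible.analyticOnNhd_joint (hM : M.Admissible) (f : 𝓢((KR → ℝ) × (KI → ℝ), ℂ)) :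
    AnalyticOnNhd ℂ (fun D => ∫ p, f p.1 * (M.complexWeight D p.2 * M.expFactor 0 p.1 p.2)
      ∂M.jointMeasure) strip := by
  have hm : Measurable fun p : ((KR → ℝ) × (KI → ℝ)) × (L → ℝ) => f p.1 * M.expFactor 0 p.1 p.2 :=
    (f.continuous.measurable.comp measurable_fst).mul (M.measurable_expFactor 0)
  have h := (hM.analyticOnNhd_integral (ν := M.jointMeasure) measurable_snd
    (M.ae_jointMeasure.mono fun p hp => hp.2.2) hm.aestronglyMeasurable fun ρ hρ => ?_).2
  · simpa only [mul_left_comm] using h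
  · refine (integrable_schwartz_mul_weight hM hρ f).mono'
      (((M.measurable_weight ρ).comp measurable_snd).mul hm.norm).aestronglyMeasurable ?_
    filter_upwards [M.ae_jointMeasure] with p hp
    have hw := hM.weight_nonneg ρ hp.2.2
    rw [Real.norm_of_nonneg (mul_nonneg hw (norm_nonneg _)), norm_mul, mul_comm ‖f p.1‖ (M.weight ρ p.2)]
    exact mul_le_mul_of_nonneg_left (mul_le_of_le_one_right (norm_nonneg _)
      (hM.norm_expFactor_le le_rfl hp.2.2 (sum_monomial_nonneg hp.1 hp.2.2))) hw

/-- The regularized identity `integral_joint_eq` holds for all small `ε > 0`; both of its sides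
converge, and limits are unique. -/
lemma Admissible.integral_joint_eq_contour (hM : M.Admissible) {D : ℂ} (hD : D ∈ strip)
    {q : (KU → ℝ) × (KR → ℝ) × (KI → ℝ)} (hq : q ∈ M.Delta D) [DecidableEq KU] (k₀ : KU)
    (f : 𝓢((KR → ℝ) × (KI → ℝ), ℂ)) :
    ∫ p, f p.1 * (M.complexWeight D p.2 * M.expFactor 0 p.1 p.2) ∂M.jointMeasure =
      ∫ η, M.contourIntegrand D f q k₀ η := by
  have h1 := tendsto_integral_joint hM hD f
  have h2 := M.tendsto_integral_regularizedContour k₀ hD hq hM.pos f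
  refine tendsto_nhds_unique (h1.congr' ?_) h2
  filter_upwards [Ioc_mem_nhdsGT one_pos] with ε hε
  exact integral_joint_eq k₀ hM hD hq f hε.1 hε.2

/-- The amplitude as a tempered distribution of the external invariants and its Mellin
representation. -/
theorem Admissible.mellin_representation (hM : M.Admissible) [DecidableEq KU] (K : ℂ) :
    ∃ T : ℂ → 𝓢'((KR → ℝ) × (KI → ℝ), ℂ),
      (∀ D ∈ strip, ∀ f, IntegrableOn (fun s => f s * M.amplitude K D s) M.invariantDomain ∧
        T D f = ∫ s in M.invariantDomain, f s * M.amplitude K D s) ∧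
      (∀ f, AnalyticOnNhd ℂ (fun D => T D f) strip) ∧
      ∀ D ∈ strip, (M.Delta D).Nonempty ∧ Convex ℝ (M.Delta D) ∧
        ∀ q ∈ M.Delta D, ∀ k₀ : KU, ∀ f,
          (∀ (ηR : KR → ℝ) (ηI : KI → ℝ),
            IntegrableOn (M.smearedPower f (line q.2.1 ηR) (line q.2.2 ηI)) M.invariantDomain) ∧
          Integrable (M.contourIntegrand D f q k₀) ∧
          T D f = K * ∫ η, M.contourIntegrand D f q k₀ η := by
  classical
  have : (volume : Measure ((KR → ℝ) × (KI → ℝ))).IsAddHaarMeasure :=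
    Measure.prod.instIsAddHaarMeasure _ _
  -- Outside the strip the distribution is set to 0; nothing is claimed about it there.
  have hex : ∀ D : ℂ, ∃ T : 𝓢'((KR → ℝ) × (KI → ℝ), ℂ), D ∈ strip →
      ∀ f, T f = ∫ s in M.invariantDomain, f s * M.amplitude K D s := by
    intro D
    by_cases hD : D ∈ strip
    · obtain ⟨T, hT⟩ := exists_temperedDistribution_of_bound M.measurableSet_invariantDomain
        (M.measurable_amplitude K D) fun s hs => hM.norm_amplitude_le K hD hs
      exact ⟨T, fun _ => hT⟩
    · exact ⟨0, fun h => absurd h hD⟩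
  choose T hT using hex
  have hTj : ∀ D ∈ strip, ∀ f, T D f = K * ∫ p, f p.1 *
      (M.complexWeight D p.2 * M.expFactor 0 p.1 p.2) ∂M.jointMeasure := fun D hD f => by
    rw [hT D hD, (hM.setIntegral_amplitude K hD f).2]
  refine ⟨T, fun D hD f => ⟨(hM.setIntegral_amplitude K hD f).1, hT D hD f⟩, fun f => ?_,
    fun D hD => ⟨hM.nonempty_Delta hD, M.convex_Delta D, fun q hq k₀ f => ⟨fun ηR ηI => ?_, ?_, ?_⟩⟩⟩
  · exact (analyticOnNhd_const.mul (hM.analyticOnNhd_joint f)).congr isOpen_strip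
      fun D hD => (hTj D hD f).symm
  · obtain ⟨hR, hI⟩ := M.exponents_of_mem_Delta hD hq
    rw [← M.regularizedPower_zero]
    exact M.integrableOn_regularizedPower le_rfl zero_le_one f
      (fun k => by rw [line_re]; exact hR k) (fun k => by rw [line_re]; exact hI k)
  · exact M.integrable_contourIntegrand k₀ hD hq hM.pos f
  · rw [hTj D hD, hM.integral_joint_eq_contour hD hq k₀ f]

end MonomialData

/-! ### Determinants of a diagonal matrix plus an antisymmetric one. -/

section Determinant

variable {n R : Type*} [Fintype n] [DecidableEq n] [CommRing R]

/-- Expansion of a determinant whose rows are combinations of rows of the identity and of `B`. -/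
lemma det_diagonal_add_mul (d ρ : n → R) (B : Matrix n n R) :
    (Matrix.diagonal d + Matrix.of fun a b => ρ a * B a b).det =
      ∑ S : Finset n, (∏ a, S.piecewise d ρ a) *
        (Matrix.of fun a => S.piecewise (fun a => (1 : Matrix n n R) a) (fun a => B a) a).det := by
  have h := MultilinearMap.map_add_univ (Matrix.detRowAlternating (n := n) (R := R)).toMultilinearMap
    (fun a => d a • (1 : Matrix n n R) a) (fun a => ρ a • B a)
  have e : (Matrix.diagonal d + Matrix.of fun a b => ρ a * B a b).det =
      (Matrix.detRowAlternating (n := n) (R := R)).toMultilinearMap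
        ((fun a => d a • (1 : Matrix n n R) a) + fun a => ρ a • B a) := by
    change Matrix.det _ = Matrix.det _
    congr 1
    ext a b
    by_cases hab : a = b
    · subst hab; simp
    · simp [hab]
  rw [e, h]
  refine Finset.sum_congr rfl fun S _ => ?_
  have e2 : (S.piecewise (fun a => d a • (1 : Matrix n n R) a) fun a => ρ a • B a) =
      fun a => S.piecewise d ρ a • S.piecewise (fun a => (1 : Matrix n n R) a) (fun a => B a) a := by
    funext a
    by_cases ha : a ∈ S <;> simp [ha]
  rw [e2, MultilinearMap.map_smul_univ, smul_eq_mul]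
  rfl

lemma dotProduct_mulVec_self_of_antisymm {B : Matrix n n ℝ} (hB : ∀ a b, B a b = -B b a)
    (z : n → ℝ) : ∑ a, z a * (B.mulVec z) a = 0 := by
  have h : ∑ a, z a * (B.mulVec z) a = -∑ a, z a * (B.mulVec z) a := by
    simp only [Matrix.mulVec, dotProduct, Finset.mul_sum]
    conv_lhs => rw [Finset.sum_comm]
    rw [← Finset.sum_neg_distrib]
    refine Finset.sum_congr rfl fun a _ => ?_
    rw [← Finset.sum_neg_distrib]
    refine Finset.sum_congr rfl fun b _ => ?_
    rw [hB b a]; ring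
  linarith

/-- Replacing some rows of an antisymmetric matrix by rows of the identity gives a matrix of
nonnegative determinant. -/
lemma det_piecewise_one_nonneg {B : Matrix n n ℝ} (hB : ∀ a b, B a b = -B b a) (S : Finset n) :
    0 ≤ (Matrix.of fun a => S.piecewise (fun a => (1 : Matrix n n ℝ) a) (fun a => B a) a).det := by
  -- A path from the given matrix at `c = 0` to the identity at `c = 1`. It is invertible for `0 < c
  -- ≤ 1`, so a negative determinant at `c = 0` would contradict the intermediate value theorem.
  set N : ℝ → Matrix n n ℝ := fun c => Matrix.of fun a => S.piecewise (fun a => (1 : Matrix n n ℝ) a)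
    (fun a => (1 - c) • B a + c • (1 : Matrix n n ℝ) a) a with hN
  have hcont : Continuous fun c => (N c).det := by
    refine Continuous.matrix_det (continuous_matrix fun a b => ?_)
    by_cases ha : a ∈ S <;> simp only [hN, Matrix.of_apply, Finset.piecewise, ha, if_true, if_false,
      Pi.add_apply, Pi.smul_apply, smul_eq_mul] <;> fun_prop
  have h0 : N 0 = Matrix.of fun a => S.piecewise (fun a => (1 : Matrix n n ℝ) a) (fun a => B a) a := by
    simp [hN]
  have h1 : (N 1).det = 1 := by
    have : N 1 = 1 := by
      ext a b
      by_cases ha : a ∈ S <;> simp [hN, ha]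
    rw [this, Matrix.det_one]
  -- A kernel vector vanishes on the rows in `S`. Pairing the other rows with it kills the
  -- antisymmetric part and leaves `c ∑ z_a² = 0`.
  have hne : ∀ c ∈ Ioc (0 : ℝ) 1, (N c).det ≠ 0 := by
    intro c hc hdet
    obtain ⟨z, hz, hz0⟩ := Matrix.exists_mulVec_eq_zero_iff.2 hdet
    refine hz ?_
    have hone : ∀ a, (1 : Matrix n n ℝ) a ⬝ᵥ z = z a := fun a => by
      rw [← Matrix.mulVec, Matrix.one_mulVec]
    have hS : ∀ a ∈ S, z a = 0 := fun a ha => by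
      have := congrFun hz0 a
      simp only [hN, Matrix.mulVec, Matrix.of_apply, Finset.piecewise_eq_of_mem _ _ _ ha, hone] at this
      simpa using this
    have hS' : ∀ a ∉ S, (1 - c) * (B.mulVec z) a + c * z a = 0 := fun a ha => by
      have := congrFun hz0 a
      simp only [hN, Matrix.mulVec, Matrix.of_apply, Finset.piecewise_eq_of_notMem _ _ _ ha,
        add_dotProduct, smul_dotProduct, hone] at this
      simpa [Matrix.mulVec] using this
    have hsum : ∑ a, c * z a ^ 2 = 0 := by
      have e : ∑ a, (z a * ((1 - c) * (B.mulVec z) a + c * z a)) = 0 := by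
        refine Finset.sum_eq_zero fun a _ => ?_
        by_cases ha : a ∈ S
        · rw [hS a ha, zero_mul]
        · rw [hS' a ha, mul_zero]
      have e2 : ∑ a, (z a * ((1 - c) * (B.mulVec z) a + c * z a)) =
          (1 - c) * ∑ a, z a * (B.mulVec z) a + ∑ a, c * z a ^ 2 := by
        rw [Finset.mul_sum, ← Finset.sum_add_distrib]
        exact Finset.sum_congr rfl fun a _ => by ring
      rw [dotProduct_mulVec_self_of_antisymm hB, mul_zero, zero_add] at e2
      rw [← e2, e]
    funext a
    have := (Finset.sum_eq_zero_iff_of_nonneg fun a _ =>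
      mul_nonneg hc.1.le (sq_nonneg (z a))).1 hsum a (Finset.mem_univ a)
    simpa [hc.1.ne'] using this
  rw [← h0]
  by_contra hlt
  rw [not_le] at hlt
  obtain ⟨c, hc, hc0⟩ := intermediate_value_Icc zero_le_one hcont.continuousOn
    (show (0 : ℝ) ∈ Icc (N 0).det (N 1).det from ⟨hlt.le, by rw [h1]; exact zero_le_one⟩)
  rcases hc.1.eq_or_lt with h | h
  · rw [← h] at hc0
    exact hlt.ne hc0
  · exact hne c ⟨h, hc.2⟩ hc0

lemma mulVec_diagonal_add_mul (d ρ : n → R) (B : Matrix n n R) (z : n → R) (a : n) :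
    (Matrix.diagonal d + Matrix.of fun a b => ρ a * B a b).mulVec z a =
      d a * z a + ρ a * (B.mulVec z) a := by
  rw [Matrix.add_mulVec, Pi.add_apply, Matrix.mulVec_diagonal]
  congr 1
  simp only [Matrix.mulVec, dotProduct, Finset.mul_sum, Matrix.of_apply, mul_assoc]

/-- If `diag d + diag ρ * B` is invertible, some term of the expansion of its determinant does not
vanish. -/
lemma exists_piecewise_ne_zero {d ρ : n → ℝ} {B : Matrix n n ℝ}
    (h : ∀ z : n → ℝ, (∀ a, d a * z a + ρ a * (B.mulVec z) a = 0) → z = 0) :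
    ∃ S : Finset n, (∀ a, S.piecewise d ρ a ≠ 0) ∧
      (Matrix.of fun a => S.piecewise (fun a => (1 : Matrix n n ℝ) a) (fun a => B a) a).det ≠ 0 := by
  have hdet : (Matrix.diagonal d + Matrix.of fun a b => ρ a * B a b).det ≠ 0 := by
    intro h0
    obtain ⟨z, hz, hz0⟩ := Matrix.exists_mulVec_eq_zero_iff.2 h0
    exact hz (h z fun a => by rw [← mulVec_diagonal_add_mul, hz0, Pi.zero_apply])
  rw [det_diagonal_add_mul] at hdet
  obtain ⟨S, -, hS⟩ := Finset.exists_ne_zero_of_sum_ne_zero hdet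
  refine ⟨S, fun a => ?_, right_ne_zero_of_mul hS⟩
  exact Finset.prod_ne_zero_iff.1 (left_ne_zero_of_mul hS) a (Finset.mem_univ a)

/-- The quadratic form of the inverse of `A + B`, `A` diagonal nonnegative and `B` antisymmetric, is
nonnegative. -/
lemma adjugate_quadratic_nonneg {d ρ : n → ℝ} (hd : ∀ a, 0 ≤ d a) (hρ : ∀ a, 0 < ρ a)
    {B : Matrix n n ℝ} (hB : ∀ a b, B a b = -B b a)
    (hdet : 0 < (Matrix.diagonal d + Matrix.of fun a b => ρ a * B a b).det) (w : n → ℝ) :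
    0 ≤ ∑ a, ∑ b, w a * ((Matrix.diagonal d + Matrix.of fun a b => ρ a * B a b).adjugate a b * ρ b) *
      w b := by
  set N := Matrix.diagonal d + Matrix.of fun a b => ρ a * B a b with hN
  -- This `z` solves `N z = det N • ρ w`. Dividing row `a` by `ρ_a` and pairing with `z`, the
  -- antisymmetric part drops out and a sum of squares with weights `d_a / ρ_a` remains.
  set z := N.adjugate.mulVec (fun a => ρ a * w a) with hz
  have e : ∑ a, ∑ b, w a * (N.adjugate a b * ρ b) * w b = ∑ a, w a * z a := by
    refine Finset.sum_congr rfl fun a _ => ?_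
    simp only [hz, Matrix.mulVec, dotProduct, Finset.mul_sum]
    exact Finset.sum_congr rfl fun b _ => by ring
  rw [e]
  have hrow : ∀ a, d a * z a + ρ a * (B.mulVec z) a = N.det * (ρ a * w a) := by
    intro a
    have h := congrFun (show N.mulVec z = N.det • fun a => ρ a * w a by
      rw [hz, Matrix.mulVec_mulVec, Matrix.mul_adjugate, Matrix.smul_mulVec, Matrix.one_mulVec]) a
    rw [Pi.smul_apply, smul_eq_mul] at h
    rw [← h, hN, mulVec_diagonal_add_mul]
  have hsum : N.det * ∑ a, w a * z a = ∑ a, d a / ρ a * z a ^ 2 := by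
    have h1 : ∀ a, N.det * (w a * z a) = d a / ρ a * z a ^ 2 + z a * (B.mulVec z) a := by
      intro a
      have := hrow a
      have hr := (hρ a).ne'
      field_simp
      linear_combination -z a * this
    rw [Finset.mul_sum, Finset.sum_congr rfl fun a _ => h1 a, Finset.sum_add_distrib,
      dotProduct_mulVec_self_of_antisymm hB, add_zero]
  have hnn : 0 ≤ N.det * ∑ a, w a * z a := by
    rw [hsum]
    exact Finset.sum_nonneg fun a _ => mul_nonneg (div_nonneg (hd a) (hρ a).le) (sq_nonneg _)
  exact nonneg_of_mul_nonneg_right hnn hdet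

end Determinant

/-! ### Polynomials with nonnegative coefficients. -/

section Coefficients

variable {σ ι : Type*}

/-- All coefficients of the polynomial are nonnegative. -/
def CoeffNonneg (p : MvPolynomial σ ℝ) : Prop := ∀ k, 0 ≤ p.coeff k

lemma CoeffNonneg.add {p q : MvPolynomial σ ℝ} (hp : CoeffNonneg p) (hq : CoeffNonneg q) :
    CoeffNonneg (p + q) := fun k => by
  rw [MvPolynomial.coeff_add]; exact add_nonneg (hp k) (hq k)

lemma CoeffNonneg.mul {p q : MvPolynomial σ ℝ} (hp : CoeffNonneg p) (hq : CoeffNonneg q) :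
    CoeffNonneg (p * q) := fun k => by
  classical
  rw [MvPolynomial.coeff_mul]
  exact Finset.sum_nonneg fun x _ => mul_nonneg (hp _) (hq _)

lemma coeffNonneg_C {c : ℝ} (hc : 0 ≤ c) : CoeffNonneg (MvPolynomial.C c : MvPolynomial σ ℝ) :=
  fun k => by
    classical
    rw [MvPolynomial.coeff_C]; split_ifs <;> simp [hc]

lemma coeffNonneg_one : CoeffNonneg (1 : MvPolynomial σ ℝ) := by
  rw [← MvPolynomial.C_1]; exact coeffNonneg_C zero_le_one

lemma coeffNonneg_zero : CoeffNonneg (0 : MvPolynomial σ ℝ) := fun k => by simp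

lemma coeffNonneg_X (i : σ) : CoeffNonneg (MvPolynomial.X i : MvPolynomial σ ℝ) := fun k => by
  classical
  rw [MvPolynomial.coeff_X]; split_ifs <;> simp

lemma coeffNonneg_prod {s : Finset ι} {p : ι → MvPolynomial σ ℝ} (hp : ∀ i ∈ s, CoeffNonneg (p i)) :
    CoeffNonneg (∏ i ∈ s, p i) :=
  Finset.prod_induction _ CoeffNonneg (fun _ _ => CoeffNonneg.mul) coeffNonneg_one hp

lemma coeff_mul_pos {p q : MvPolynomial σ ℝ} (hp : CoeffNonneg p) (hq : CoeffNonneg q)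
    {j k : σ →₀ ℕ} (hj : 0 < p.coeff j) (hk : 0 < q.coeff k) : 0 < (p * q).coeff (j + k) := by
  classical
  rw [MvPolynomial.coeff_mul]
  exact Finset.sum_pos' (fun x _ => mul_nonneg (hp _) (hq _))
    ⟨(j, k), by simp, mul_pos hj hk⟩

lemma coeff_prod_pos {s : Finset ι} {p : ι → MvPolynomial σ ℝ} (hp : ∀ i, CoeffNonneg (p i))
    {e : ι → σ →₀ ℕ} (he : ∀ i, 0 < (p i).coeff (e i)) :
    0 < (∏ i ∈ s, p i).coeff (∑ i ∈ s, e i) := by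
  classical
  induction s using Finset.induction_on with
  | empty => simp
  | insert i s hi ih =>
    rw [Finset.prod_insert hi, Finset.sum_insert hi]
    exact coeff_mul_pos (hp i) (coeffNonneg_prod fun j _ => hp j) (he i) ih

end Coefficients

/-- The transfer relation along the corners of a vertex preserves vanishing. -/
lemma transfer_eq_zero_iff {Ω ε T T' : ℝ} (hΩ : 0 < Ω) (hΩ1 : Ω ≠ 1) (hε : ε = 1 ∨ ε = -1)
    (h : T' = T ∨ T' * (1 - Ω * ε) = -T * (1 + Ω * ε)) : T = 0 ↔ T' = 0 := by
  rcases h with h | h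
  · rw [h]
  -- The one place that needs `Ω ≠ 1`: in some order, the two factors are `1 - Ω` and `1 + Ω`.
  have h1 : 1 - Ω * ε ≠ 0 := by
    rcases hε with rfl | rfl <;> intro h0
    · exact hΩ1 (by linarith)
    · linarith
  have h2 : 1 + Ω * ε ≠ 0 := by
    rcases hε with rfl | rfl <;> intro h0
    · linarith
    · exact hΩ1 (by linarith)
  constructor
  · intro hT
    rw [hT, neg_zero, zero_mul] at h
    exact (mul_eq_zero.1 h).resolve_right h1
  · intro hT
    rw [hT, zero_mul] at h
    exact neg_eq_zero.1 ((mul_eq_zero.1 h.symm).resolve_right h2)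

/-! ### The phase matrix as a system of stationarity equations on the graph. -/

namespace FeynmanGraph

variable {V L : Type*} [Fintype V] [DecidableEq V] [Fintype L] [DecidableEq L]
  (G : FeynmanGraph V L) (r : V)

lemma src_ne_tgt (l l' : L) : G.src l ≠ G.tgt l' := fun h => by
  have h1 := G.src_even l
  rw [h] at h1
  exact (Nat.not_even_iff_odd.2 (G.tgt_odd l')) h1

/-- The position of a corner in the configuration `z` of the integrated variables. -/
noncomputable def cornerValue (z : G.IntVar r → ℝ) (c : V × Fin 4) : ℝ :=
  ∑ a, G.position r c (Sum.inl a) * z a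

/-- The hypermomentum of a vertex in the configuration `z` of the integrated variables. -/
noncomputable def momentumValue (z : G.IntVar r → ℝ) (w : V) : ℝ :=
  ∑ a, G.hypermomentum r w (Sum.inl a) * z a

/-- The derivative of the vertex phases with respect to the position of a corner. -/
noncomputable def force (Ω : ℝ) (z : G.IntVar r → ℝ) (c : V × Fin 4) : ℝ :=
  (-1) ^ (c.2 : ℕ) * (Ω⁻¹ * (∑ j, (if c.2 < j then (-1) ^ (j : ℕ) * G.cornerValue r z (c.1, j) else 0) -
    ∑ j, (if j < c.2 then (-1) ^ (j : ℕ) * G.cornerValue r z (c.1, j) else 0)) -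
    G.momentumValue r z c.1)

lemma sum_phaseCoeff_mul (m : Model) (Ω : ℝ) (z : G.IntVar r → ℝ) (a : G.IntVar r) :
    ∑ b, G.phaseCoeff m Ω r (Sum.inl a) (Sum.inl b) * z b =
      ∑ w, (Ω⁻¹ * ∑ i : Fin 4, ∑ j : Fin 4, (if i < j then (-1 : ℝ) ^ ((i : ℕ) + (j : ℕ)) *
          G.position r (w, i) (Sum.inl a) * G.cornerValue r z (w, j) else 0) +
        ∑ i : Fin 4, (-1 : ℝ) ^ (i : ℕ) * G.hypermomentum r w (Sum.inl a) *
          G.cornerValue r z (w, i)) +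
        ∑ b, G.propagatorPhase r m (Sum.inl a) (Sum.inl b) * z b := by
  simp only [phaseCoeff, add_mul, Finset.sum_add_distrib, Finset.mul_sum, Finset.sum_mul, ite_mul,
    mul_ite, zero_mul, mul_zero]
  congr 1
  congr 1
  · rw [Finset.sum_comm]
    refine Finset.sum_congr rfl fun w _ => ?_
    rw [Finset.sum_comm]
    refine Finset.sum_congr rfl fun i _ => ?_
    rw [Finset.sum_comm]
    refine Finset.sum_congr rfl fun j _ => ?_
    split_ifs
    · rw [cornerValue, Finset.mul_sum, Finset.mul_sum]
      exact Finset.sum_congr rfl fun _ _ => by ring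
    · simp
  · rw [Finset.sum_comm]
    refine Finset.sum_congr rfl fun w _ => ?_
    rw [Finset.sum_comm]
    refine Finset.sum_congr rfl fun i _ => ?_
    rw [cornerValue, Finset.mul_sum]
    exact Finset.sum_congr rfl fun _ _ => by ring

lemma sum_phaseCoeff_mul' (m : Model) (Ω : ℝ) (z : G.IntVar r → ℝ) (a : G.IntVar r) :
    ∑ b, G.phaseCoeff m Ω r (Sum.inl b) (Sum.inl a) * z b =
      ∑ w, (Ω⁻¹ * ∑ i : Fin 4, ∑ j : Fin 4, (if i < j then (-1 : ℝ) ^ ((i : ℕ) + (j : ℕ)) *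
          G.cornerValue r z (w, i) * G.position r (w, j) (Sum.inl a) else 0) +
        ∑ i : Fin 4, (-1 : ℝ) ^ (i : ℕ) * G.momentumValue r z w *
          G.position r (w, i) (Sum.inl a)) +
        ∑ b, G.propagatorPhase r m (Sum.inl b) (Sum.inl a) * z b := by
  simp only [phaseCoeff, add_mul, Finset.sum_add_distrib, Finset.mul_sum, Finset.sum_mul, ite_mul,
    mul_ite, zero_mul, mul_zero]
  congr 1
  congr 1
  · rw [Finset.sum_comm]
    refine Finset.sum_congr rfl fun w _ => ?_
    rw [Finset.sum_comm]
    refine Finset.sum_congr rfl fun i _ => ?_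
    rw [Finset.sum_comm]
    refine Finset.sum_congr rfl fun j _ => ?_
    split_ifs
    · rw [cornerValue, Finset.mul_sum, Finset.sum_mul, Finset.mul_sum]
      exact Finset.sum_congr rfl fun _ _ => by ring
    · simp
  · rw [Finset.sum_comm]
    refine Finset.sum_congr rfl fun w _ => ?_
    rw [Finset.sum_comm]
    refine Finset.sum_congr rfl fun i _ => ?_
    rw [momentumValue, Finset.mul_sum, Finset.sum_mul]
    exact Finset.sum_congr rfl fun _ _ => by ring

/-- The block of the phase matrix on the integrated variables. -/
noncomputable def internalPhase (m : Model) (Ω : ℝ) : Matrix (G.IntVar r) (G.IntVar r) ℝ :=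
  Matrix.of fun a b => G.phaseMatrix m Ω r (Sum.inl a) (Sum.inl b)

lemma phaseMatrix_antisymm (m : Model) (Ω : ℝ) (a b : G.Var r) :
    G.phaseMatrix m Ω r a b = -G.phaseMatrix m Ω r b a := by
  simp [phaseMatrix]

/-- A chain rule: a variable acts on the vertex phases through the positions of the corners, where
it meets the forces, and through the hypermomenta, where it meets the alternating sums of positions.
The last bracket is the phase of the propagators. -/
lemma internalPhase_mulVec (m : Model) (Ω : ℝ) (z : G.IntVar r → ℝ) (a : G.IntVar r) :
    (G.internalPhase r m Ω).mulVec z a =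
      ∑ c, G.position r c (Sum.inl a) * G.force r Ω z c +
      ∑ w, G.hypermomentum r w (Sum.inl a) * ∑ i : Fin 4, (-1) ^ (i : ℕ) * G.cornerValue r z (w, i) +
      (∑ b, G.propagatorPhase r m (Sum.inl a) (Sum.inl b) * z b -
        ∑ b, G.propagatorPhase r m (Sum.inl b) (Sum.inl a) * z b) := by
  have e : (G.internalPhase r m Ω).mulVec z a =
      ∑ b, G.phaseCoeff m Ω r (Sum.inl a) (Sum.inl b) * z b -
      ∑ b, G.phaseCoeff m Ω r (Sum.inl b) (Sum.inl a) * z b := by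
    rw [← Finset.sum_sub_distrib]
    refine Finset.sum_congr rfl fun b _ => ?_
    simp only [internalPhase, phaseMatrix, Matrix.of_apply]
    ring
  rw [e, sum_phaseCoeff_mul, sum_phaseCoeff_mul', add_sub_add_comm, Fintype.sum_prod_type,
    ← Finset.sum_sub_distrib, ← Finset.sum_add_distrib]
  congr 1
  refine Finset.sum_congr rfl fun w _ => ?_
  simp [force, Fin.sum_univ_four]
  ring

lemma sum_position_u_mul (l : L) (F : V × Fin 4 → ℝ) :
    ∑ c, G.position r c (Sum.inl (Sum.inl l)) * F c = (F (G.src l) - F (G.tgt l)) / √2 := by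
  have h : ∀ c, G.position r c (Sum.inl (Sum.inl l)) * F c =
      (if G.src l = c then F c / √2 else 0) - (if G.tgt l = c then F c / √2 else 0) := by
    intro c
    simp only [position]
    by_cases h1 : G.src l = c
    · have h2 : G.tgt l ≠ c := fun h2 => G.src_ne_tgt l l (h1.trans h2.symm)
      simp [h1, h2]; ring
    · by_cases h2 : G.tgt l = c <;> simp [h1, h2]; ring
  simp only [h, Finset.sum_sub_distrib, Finset.sum_ite_eq, Finset.mem_univ, if_true, sub_div]

lemma sum_position_v_mul (l : L) (F : V × Fin 4 → ℝ) :
    ∑ c, G.position r c (Sum.inl (Sum.inr (Sum.inl l))) * F c = (F (G.src l) + F (G.tgt l)) / √2 := by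
  have h : ∀ c, G.position r c (Sum.inl (Sum.inr (Sum.inl l))) * F c =
      (if G.src l = c then F c / √2 else 0) + (if G.tgt l = c then F c / √2 else 0) := by
    intro c
    simp only [position]
    by_cases h1 : G.src l = c
    · have h2 : G.tgt l ≠ c := fun h2 => G.src_ne_tgt l l (h1.trans h2.symm)
      simp [h1, h2]; ring
    · by_cases h2 : G.tgt l = c <;> simp [h1, h2]; ring
  simp only [h, Finset.sum_add_distrib, Finset.sum_ite_eq, Finset.mem_univ, if_true, add_div]

lemma internalPhase_mulVec_u (Ω : ℝ) (z : G.IntVar r → ℝ) (l : L) :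
    (G.internalPhase r .lsz Ω).mulVec z (Sum.inl l) =
      (G.force r Ω z (G.src l) - G.force r Ω z (G.tgt l)) / √2 + z (Sum.inr (Sum.inl l)) := by
  rw [internalPhase_mulVec, sum_position_u_mul]
  simp [hypermomentum, Fintype.sum_sum_type, propagatorPhase]

lemma internalPhase_mulVec_v (m : Model) (Ω : ℝ) (z : G.IntVar r → ℝ)
    (hz : ∀ l, z (Sum.inl l) = 0) (l : L) :
    (G.internalPhase r m Ω).mulVec z (Sum.inr (Sum.inl l)) =
      (G.force r Ω z (G.src l) + G.force r Ω z (G.tgt l)) / √2 := by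
  rw [internalPhase_mulVec, sum_position_v_mul]
  cases m <;> simp [hypermomentum, Fintype.sum_sum_type, propagatorPhase, hz]

lemma internalPhase_mulVec_p (m : Model) (Ω : ℝ) (z : G.IntVar r → ℝ) (w : {w : V // w ≠ r}) :
    (G.internalPhase r m Ω).mulVec z (Sum.inr (Sum.inr w)) =
      ∑ i : Fin 4, (-1) ^ (i : ℕ) * G.cornerValue r z (w, i) := by
  rw [internalPhase_mulVec]
  cases m <;> simp [hypermomentum, propagatorPhase, position]

lemma cornerValue_src (z : G.IntVar r → ℝ) (l : L) :
    G.cornerValue r z (G.src l) = (z (Sum.inr (Sum.inl l)) + z (Sum.inl l)) / √2 := by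
  have h : ∀ l', G.src l' = G.src l ↔ l' = l := fun l' => G.src_injective.eq_iff
  have h2 : ∀ l', G.tgt l' ≠ G.src l := fun l' => (G.src_ne_tgt l l').symm
  simp [cornerValue, Fintype.sum_sum_type, position, h, h2]
  ring

lemma cornerValue_tgt (z : G.IntVar r → ℝ) (l : L) :
    G.cornerValue r z (G.tgt l) = (z (Sum.inr (Sum.inl l)) - z (Sum.inl l)) / √2 := by
  have h : ∀ l', G.tgt l' = G.tgt l ↔ l' = l := fun l' => G.tgt_injective.eq_iff
  have h2 : ∀ l', G.src l' ≠ G.tgt l := fun l' => G.src_ne_tgt l' l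
  simp [cornerValue, Fintype.sum_sum_type, position, h, h2]
  ring

lemma cornerValue_ext (z : G.IntVar r → ℝ) {c : V × Fin 4} (hc : ∀ l, G.src l ≠ c ∧ G.tgt l ≠ c) :
    G.cornerValue r z c = 0 := by
  simp [cornerValue, Fintype.sum_sum_type, position, (hc _).1, (hc _).2]

lemma momentumValue_root (z : G.IntVar r → ℝ) : G.momentumValue r z r = 0 := by
  have h : ∀ w : {w : V // w ≠ r}, (w : V) ≠ r := fun w => w.2
  simp [momentumValue, Fintype.sum_sum_type, hypermomentum, h]

lemma momentumValue_of_ne (z : G.IntVar r → ℝ) (w : {w : V // w ≠ r}) :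
    G.momentumValue r z w = z (Sum.inr (Sum.inr w)) := by
  simp [momentumValue, Fintype.sum_sum_type, hypermomentum, Subtype.val_inj]

/-- With vanishing `u_l` the two ends of a line have equal positions and opposite signs, and
external corners contribute nothing. This supplies the constraint at the root, whose hypermomentum
is not among the integrated variables. -/
lemma sum_sign_cornerValue (z : G.IntVar r → ℝ) (hz : ∀ l, z (Sum.inl l) = 0) :
    ∑ w, ∑ i : Fin 4, (-1) ^ (i : ℕ) * G.cornerValue r z (w, i) = 0 := by
  rw [← Fintype.sum_prod_type' (f := fun (w : V) (i : Fin 4) =>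
    (-1 : ℝ) ^ (i : ℕ) * G.cornerValue r z (w, i))]
  simp only [cornerValue, Finset.mul_sum]
  rw [Finset.sum_comm]
  refine Finset.sum_eq_zero fun a _ => ?_
  rcases a with l | l | w
  · simp [hz]
  · have h := G.sum_position_v_mul r l fun c => (-1) ^ (c.2 : ℕ)
    rw [(G.src_even l).neg_one_pow, (G.tgt_odd l).neg_one_pow, add_neg_cancel, zero_div] at h
    calc _ = (∑ c : V × Fin 4, G.position r c (Sum.inl (Sum.inr (Sum.inl l))) * (-1) ^ (c.2 : ℕ)) *
          z (Sum.inr (Sum.inl l)) := by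
          rw [Finset.sum_mul]
          exact Finset.sum_congr rfl fun _ _ => by ring
      _ = 0 := by rw [h, zero_mul]
  · simp [position]

end FeynmanGraph

/-! ### Invertibility of the reduced matrices in the two models. -/

namespace FeynmanGraph

variable {V L : Type*} [Fintype V] [DecidableEq V] [Fintype L] [DecidableEq L]
  {G : FeynmanGraph V L} {r : V}

/-- Carries a property from the root along the lines, in both directions, to all vertices. -/
lemma Connected.induction (hG : G.Connected) {p : V → Prop}
    (h : ∀ l, p (G.src l).1 ↔ p (G.tgt l).1) (hr : p r) (w : V) : p w := by
  have h2 : ∀ a b, Relation.EqvGen (fun a b => ∃ l, (G.src l).1 = a ∧ (G.tgt l).1 = b) a b →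
      (p a ↔ p b) := by
    intro a b hab
    induction hab with
    | rel a b hl => obtain ⟨l, rfl, rfl⟩ := hl; exact h l
    | refl a => exact Iff.rfl
    | symm a b _ ih => exact ih.symm
    | trans a b c _ _ ih1 ih2 => exact ih1.trans ih2
  exact (h2 r w (hG r w)).1 hr

lemma internalPhase_antisymm (m : Model) (Ω : ℝ) (a b : G.IntVar r) :
    G.internalPhase r m Ω a b = -G.internalPhase r m Ω b a :=
  G.phaseMatrix_antisymm r m Ω _ _

/-- Diagonal entries of the reduced matrix that detects a square-free monomial of `HU`. -/
def reducedDiag (G : FeynmanGraph V L) (r : V) : Model → G.IntVar r → ℝ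
  | _, .inl _ => 1
  | .grosseWulkenhaar, .inr (.inl _) => 1
  | .lsz, .inr (.inl _) => 0
  | _, .inr (.inr _) => 0

/-- Row factors of the reduced matrix that detects a square-free monomial of `HU`. -/
def reducedScale (G : FeynmanGraph V L) (r : V) : Model → G.IntVar r → ℝ
  | .grosseWulkenhaar, .inl _ => 0
  | .lsz, .inl _ => 1
  | _, .inr _ => 1

lemma force_of_cornerValue_eq_zero (Ω : ℝ) {z : G.IntVar r → ℝ} (hz : ∀ c, G.cornerValue r z c = 0)
    (c : V × Fin 4) : G.force r Ω z c = -((-1) ^ (c.2 : ℕ) * G.momentumValue r z c.1) := by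
  simp [force, hz]

/-- The rows of `u_l` say `u_l = 0`, and pairing the equations with `z` leaves `∑ v_l² = 0`. All
positions then vanish, a force is plus or minus a hypermomentum, and the row of `v_l` equates the
hypermomenta at the two ends of `l`. They are all equal to that of the root, which is 0. -/
theorem eq_zero_of_grosseWulkenhaar (hG : G.Connected) (Ω : ℝ) {z : G.IntVar r → ℝ}
    (h : ∀ a, G.reducedDiag r .grosseWulkenhaar a * z a + G.reducedScale r .grosseWulkenhaar a *
      ((G.internalPhase r .grosseWulkenhaar Ω).mulVec z) a = 0) : z = 0 := by
  have hu : ∀ l, z (Sum.inl l) = 0 := fun l => by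
    simpa [reducedDiag, reducedScale] using h (Sum.inl l)
  have hv' : ∀ l, z (Sum.inr (Sum.inl l)) +
      ((G.internalPhase r .grosseWulkenhaar Ω).mulVec z) (Sum.inr (Sum.inl l)) = 0 := fun l => by
    simpa [reducedDiag, reducedScale] using h (Sum.inr (Sum.inl l))
  have hp : ∀ w, ((G.internalPhase r .grosseWulkenhaar Ω).mulVec z) (Sum.inr (Sum.inr w)) = 0 :=
    fun w => by simpa [reducedDiag, reducedScale] using h (Sum.inr (Sum.inr w))
  have hq := dotProduct_mulVec_self_of_antisymm
    (internalPhase_antisymm (G := G) (r := r) .grosseWulkenhaar Ω) z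
  have hv : ∀ l, z (Sum.inr (Sum.inl l)) = 0 := by
    have hs : ∑ l, z (Sum.inr (Sum.inl l)) ^ 2 = 0 := by
      simp only [Fintype.sum_sum_type, hu, hp, zero_mul, mul_zero, Finset.sum_const_zero, zero_add,
        add_zero] at hq
      rw [← neg_eq_zero, ← hq, ← Finset.sum_neg_distrib]
      exact Finset.sum_congr rfl fun l _ => by linear_combination -z (Sum.inr (Sum.inl l)) * hv' l
    intro l
    have := (Finset.sum_eq_zero_iff_of_nonneg fun l _ => sq_nonneg _).1 hs l (Finset.mem_univ l)
    simpa using this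
  have hX : ∀ c, G.cornerValue r z c = 0 := fun c => by
    by_cases hc : ∀ l, G.src l ≠ c ∧ G.tgt l ≠ c
    · exact G.cornerValue_ext r z hc
    · push Not at hc
      obtain ⟨l, hl⟩ := hc
      by_cases h1 : G.src l = c
      · rw [← h1, cornerValue_src, hu, hv]; simp
      · rw [← hl h1, cornerValue_tgt, hu, hv]; simp
  have hP : ∀ w, G.momentumValue r z w = 0 := by
    refine hG.induction (r := r) (fun l => ?_) (G.momentumValue_root r z)
    have h1 := hv' l
    rw [hv, zero_add, internalPhase_mulVec_v _ _ _ _ _ hu, force_of_cornerValue_eq_zero Ω hX,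
      force_of_cornerValue_eq_zero Ω hX, (G.src_even l).neg_one_pow, (G.tgt_odd l).neg_one_pow,
      div_eq_zero_iff] at h1
    have h2 := h1.resolve_right (by positivity)
    have h3 : G.momentumValue r z (G.src l).1 = G.momentumValue r z (G.tgt l).1 := by linarith
    rw [h3]
  funext a
  rcases a with l | l | w
  · exact hu l
  · exact hv l
  · rw [← G.momentumValue_of_ne r z w]; exact hP w

/-- At a vertex with vanishing alternating sum of positions, the stationarity equations of the
LSZ model force the positions of the internal corners to vanish exactly when the hypermomentum does. -/
lemma cornerValue_eq_zero_iff {Ω : ℝ} (hΩ : 0 < Ω) (hΩ1 : Ω ≠ 1) {z : G.IntVar r → ℝ} {w : V}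
    (hsum : ∑ i : Fin 4, (-1) ^ (i : ℕ) * G.cornerValue r z (w, i) = 0)
    (h : ∀ i : Fin 4, G.cornerValue r z (w, i) = 0 ∨
      G.force r Ω z (w, i) = -((-1) ^ (i : ℕ) * G.cornerValue r z (w, i))) (i : Fin 4) :
    (G.momentumValue r z w = 0 → G.cornerValue r z (w, i) = 0) ∧
    (G.force r Ω z (w, i) = -((-1) ^ (i : ℕ) * G.cornerValue r z (w, i)) →
      G.cornerValue r z (w, i) = 0 → G.momentumValue r z w = 0) := by
  set P := G.momentumValue r z w with hP
  set x : Fin 4 → ℝ := fun i => G.cornerValue r z (w, i) with hx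
  have hf0 : G.force r Ω z (w, 0) = Ω⁻¹ * (-x 1 + x 2 - x 3) - P := by
    simp [force, Fin.sum_univ_four, hx, hP, -mul_eq_mul_left_iff]; ring
  have hf1 : G.force r Ω z (w, 1) = -(Ω⁻¹ * (x 2 - x 3 - x 0) - P) := by
    simp [force, Fin.sum_univ_four, hx, hP, -mul_eq_mul_left_iff]; ring
  have hf2 : G.force r Ω z (w, 2) = Ω⁻¹ * (-x 3 - x 0 + x 1) - P := by
    simp [force, Fin.sum_univ_four, hx, hP, -mul_eq_mul_left_iff]; ring
  have hf3 : G.force r Ω z (w, 3) = -(Ω⁻¹ * (-x 0 + x 1 - x 2) - P) := by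
    simp [force, Fin.sum_univ_four, hx, hP, -mul_eq_mul_left_iff]; ring
  have hs : x 0 - x 1 + x 2 - x 3 = 0 := by
    rw [← hsum]; simp [Fin.sum_univ_four, hx]; ring
  have s0 : (-1 : ℝ) ^ ((0 : Fin 4) : ℕ) = 1 := by norm_num
  have s1 : (-1 : ℝ) ^ ((1 : Fin 4) : ℕ) = -1 := by norm_num
  have s2 : (-1 : ℝ) ^ ((2 : Fin 4) : ℕ) = 1 := by norm_num
  have s3 : (-1 : ℝ) ^ ((3 : Fin 4) : ℕ) = -1 := by norm_num
  -- The equations `c0` to `c3` are the stationarity equations of the corners after one position has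
  -- been eliminated with the alternating sum `hs`.
  have hclear : ∀ {A b : ℝ}, Ω⁻¹ * A - P = b → A = Ω * (P + b) := fun {A b} e => by
    have hΩ0 := hΩ.ne'
    field_simp at e
    linarith
  have c0 : G.force r Ω z (w, 0) = -((-1) ^ ((0 : Fin 4) : ℕ) * x 0) → -x 0 = Ω * (P - x 0) := fun e => by
    rw [hf0, s0] at e
    have := hclear (A := -x 1 + x 2 - x 3) (b := -x 0) (by linarith)
    linarith
  have c1 : G.force r Ω z (w, 1) = -((-1) ^ ((1 : Fin 4) : ℕ) * x 1) →
      x 1 - 2 * x 0 = Ω * (P - x 1) := fun e => by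
    rw [hf1, s1] at e
    have := hclear (A := x 2 - x 3 - x 0) (b := -x 1) (by linarith)
    linarith
  have c2 : G.force r Ω z (w, 2) = -((-1) ^ ((2 : Fin 4) : ℕ) * x 2) →
      2 * x 1 - 2 * x 0 - x 2 = Ω * (P - x 2) := fun e => by
    rw [hf2, s2] at e
    have := hclear (A := -x 3 - x 0 + x 1) (b := -x 2) (by linarith)
    linarith
  have c3 : G.force r Ω z (w, 3) = -((-1) ^ ((3 : Fin 4) : ℕ) * x 3) →
      -x 3 = Ω * (P - x 3) := fun e => by
    rw [hf3, s3] at e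
    have := hclear (A := -x 0 + x 1 - x 2) (b := -x 3) (by linarith)
    linarith
  -- The numbers `T`, `T + x₀`, `T + x₀ - x₁`, `T + x₀ - x₁ + x₂` are linked by the transfer
  -- relation: an external corner leaves the value unchanged, an internal one multiplies it by a
  -- nonzero factor. By `hs` the chain closes up at `x₃`. So all of them vanish as soon as one does,
  -- and the positions are their differences.
  set T := Ω * P / 2 with hT
  have hTP : T = 0 ↔ P = 0 := by simp [hT, hΩ.ne']
  have t0 := transfer_eq_zero_iff (T := T) (T' := T + x 0) hΩ hΩ1 (Or.inl rfl) ((h 0).imp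
    (fun e => by change x 0 = 0 at e; rw [e, add_zero]) fun e => by
      rw [hT]; linear_combination -c0 e)
  have t1 := transfer_eq_zero_iff (T := T + x 0) (T' := T + x 0 - x 1) hΩ hΩ1 (Or.inr rfl) ((h 1).imp
    (fun e => by change x 1 = 0 at e; rw [e, sub_zero]) fun e => by
      rw [hT]; linear_combination -c1 e)
  have t2 := transfer_eq_zero_iff (T := T + x 0 - x 1) (T' := T + x 0 - x 1 + x 2) hΩ hΩ1
    (Or.inl rfl) ((h 2).imp
    (fun e => by change x 2 = 0 at e; rw [e, add_zero]) fun e => by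
      rw [hT]; linear_combination -c2 e)
  have t0' := hTP.symm.trans t0
  have t1' := t0'.trans t1
  have t2' := t1'.trans t2
  refine ⟨fun hP0 => ?_, fun e hx0 => ?_⟩
  · have z0 := t0'.1 hP0
    have z1 := t1'.1 hP0
    have z2 := t2'.1 hP0
    have z := hTP.2 hP0
    change x i = 0
    fin_cases i <;> simp only [Fin.zero_eta, Fin.mk_one, Fin.reduceFinMk] <;> linarith
  · change x i = 0 at hx0
    fin_cases i
    · refine hTP.1 ?_
      have := c0 e
      change x 0 = 0 at hx0
      rw [hT]; rw [hx0] at this; linarith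
    · refine t0'.2 ?_
      have := c1 e
      change x 1 = 0 at hx0
      rw [hT]; rw [hx0] at this; linarith
    · refine t1'.2 ?_
      have := c2 e
      change x 2 = 0 at hx0
      rw [hT]; rw [hx0] at this; linarith
    · refine t2'.2 ?_
      have := c3 e
      change x 3 = 0 at hx0
      rw [hT]; rw [hx0] at this hs; linarith

/-- Pairing with `z` gives `u_l = 0`, so both ends of a line have position `v_l / √2`, and the rows
of `u_l` and `v_l` determine the forces there. At every vertex, vanishing hypermomentum forces
vanishing positions, and a vanishing position at a line forces vanishing hypermomentum. Vanishing
thus passes through the lines from the root to the whole graph. -/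
theorem eq_zero_of_lsz (hG : G.Connected) {Ω : ℝ} (hΩ : 0 < Ω) (hΩ1 : Ω ≠ 1) {z : G.IntVar r → ℝ}
    (h : ∀ a, G.reducedDiag r .lsz a * z a + G.reducedScale r .lsz a *
      ((G.internalPhase r .lsz Ω).mulVec z) a = 0) : z = 0 := by
  have hu' : ∀ l, z (Sum.inl l) + ((G.internalPhase r .lsz Ω).mulVec z) (Sum.inl l) = 0 := fun l => by
    simpa [reducedDiag, reducedScale] using h (Sum.inl l)
  have hv' : ∀ l, ((G.internalPhase r .lsz Ω).mulVec z) (Sum.inr (Sum.inl l)) = 0 := fun l => by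
    simpa [reducedDiag, reducedScale] using h (Sum.inr (Sum.inl l))
  have hp : ∀ w, ((G.internalPhase r .lsz Ω).mulVec z) (Sum.inr (Sum.inr w)) = 0 :=
    fun w => by simpa [reducedDiag, reducedScale] using h (Sum.inr (Sum.inr w))
  have hq := dotProduct_mulVec_self_of_antisymm (internalPhase_antisymm (G := G) (r := r) .lsz Ω) z
  have hu : ∀ l, z (Sum.inl l) = 0 := by
    have hs : ∑ l, z (Sum.inl l) ^ 2 = 0 := by
      simp only [Fintype.sum_sum_type, hv', hp, mul_zero, Finset.sum_const_zero, add_zero] at hq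
      rw [← neg_eq_zero, ← hq, ← Finset.sum_neg_distrib]
      exact Finset.sum_congr rfl fun l _ => by linear_combination -z (Sum.inl l) * hu' l
    intro l
    have := (Finset.sum_eq_zero_iff_of_nonneg fun l _ => sq_nonneg _).1 hs l (Finset.mem_univ l)
    simpa using this
  have h2 : (√2 : ℝ) ≠ 0 := by positivity
  have h22 : (√2 : ℝ) * √2 = 2 := Real.mul_self_sqrt (by norm_num)
  have hsrc : ∀ l, G.cornerValue r z (G.src l) = z (Sum.inr (Sum.inl l)) / √2 := fun l => by
    rw [cornerValue_src, hu, add_zero]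
  have htgt : ∀ l, G.cornerValue r z (G.tgt l) = z (Sum.inr (Sum.inl l)) / √2 := fun l => by
    rw [cornerValue_tgt, hu, sub_zero]
  have hF : ∀ l, G.force r Ω z (G.src l) = -(z (Sum.inr (Sum.inl l)) / √2) ∧
      G.force r Ω z (G.tgt l) = z (Sum.inr (Sum.inl l)) / √2 := by
    intro l
    have e1 := hu' l
    have e2 := hv' l
    rw [hu, zero_add, internalPhase_mulVec_u] at e1
    rw [internalPhase_mulVec_v _ _ _ _ _ hu, div_eq_zero_iff, or_iff_left h2] at e2
    have e3 : z (Sum.inr (Sum.inl l)) = √2 * G.force r Ω z (G.tgt l) := by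
      have e4 : G.force r Ω z (G.src l) = -G.force r Ω z (G.tgt l) := by linarith
      rw [e4] at e1
      field_simp at e1
      have : √2 * z (Sum.inr (Sum.inl l)) = √2 * (√2 * G.force r Ω z (G.tgt l)) := by
        rw [← mul_assoc, h22]; linarith
      exact mul_left_cancel₀ h2 this
    have e5 : z (Sum.inr (Sum.inl l)) / √2 = G.force r Ω z (G.tgt l) := by rw [e3]; field_simp
    exact ⟨by rw [e5]; linarith, e5.symm⟩
  have hsrcF : ∀ l, G.force r Ω z (G.src l) =
      -((-1) ^ ((G.src l).2 : ℕ) * G.cornerValue r z (G.src l)) := fun l => by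
    rw [(hF l).1, hsrc, (G.src_even l).neg_one_pow, one_mul]
  have htgtF : ∀ l, G.force r Ω z (G.tgt l) =
      -((-1) ^ ((G.tgt l).2 : ℕ) * G.cornerValue r z (G.tgt l)) := fun l => by
    rw [(hF l).2, htgt, (G.tgt_odd l).neg_one_pow]; ring
  have hcorner : ∀ c : V × Fin 4, G.cornerValue r z c = 0 ∨
      G.force r Ω z c = -((-1) ^ (c.2 : ℕ) * G.cornerValue r z c) := fun c => by
    by_cases hc : ∀ l, G.src l ≠ c ∧ G.tgt l ≠ c
    · exact Or.inl (G.cornerValue_ext r z hc)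
    · push Not at hc
      obtain ⟨l, hl⟩ := hc
      by_cases h1 : G.src l = c
      · rw [← h1]; exact Or.inr (hsrcF l)
      · rw [← hl h1]; exact Or.inr (htgtF l)
  -- Away from the root these are the rows of the hypermomenta; at the root the equation follows
  -- because the sum over all vertices vanishes.
  have hZ : ∀ w, ∑ i : Fin 4, (-1) ^ (i : ℕ) * G.cornerValue r z (w, i) = 0 := by
    have hZ1 : ∀ w, w ≠ r → ∑ i : Fin 4, (-1) ^ (i : ℕ) * G.cornerValue r z (w, i) = 0 :=
      fun w hw => by rw [← hp ⟨w, hw⟩, internalPhase_mulVec_p]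
    intro w
    by_cases hw : w = r
    · rw [hw, ← G.sum_sign_cornerValue r z hu]
      exact (Finset.sum_eq_single r (fun w _ hw => hZ1 w hw) fun h => absurd (Finset.mem_univ r) h).symm
    · exact hZ1 w hw
  have hiff := fun c : V × Fin 4 => cornerValue_eq_zero_iff hΩ hΩ1 (hZ c.1) (fun i => hcorner (c.1, i)) c.2
  have hP : ∀ w, G.momentumValue r z w = 0 := by
    refine hG.induction (r := r) (fun l => ?_) (G.momentumValue_root r z)
    have e1 := hiff (G.src l)
    have e2 := hiff (G.tgt l)
    simp only [Prod.mk.eta, hsrc, htgt] at e1 e2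
    have f1 := hsrcF l
    have f2 := htgtF l
    rw [hsrc] at f1
    rw [htgt] at f2
    exact ⟨fun h0 => e2.2 f2 (e1.1 h0), fun h0 => e1.2 f1 (e2.1 h0)⟩
  funext a
  rcases a with l | l | w
  · exact hu l
  · have := (hiff (G.src l)).1 (hP _)
    simp only [Prod.mk.eta, hsrc, div_eq_zero_iff, or_iff_left h2] at this
    exact this
  · rw [← G.momentumValue_of_ne r z w]; exact hP w

end FeynmanGraph

/-- Convergence and analyticity of the parametric integral at fixed invariants. -/
theorem MonomialData.Admissible.analyticOnNhd_amplitude {L KU KR KI : Type*} [Fintype L] [Fintype KU]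
    [Fintype KR] [Fintype KI] {M : MonomialData L KU KR KI} (hM : M.Admissible) (K : ℂ)
    {s : (KR → ℝ) × (KI → ℝ)} (hs : ∀ t ∈ cube L, 0 ≤ ∑ k, s.1 k * ∏ l, t l ^ M.vR k l) :
    (∀ D ∈ strip, IntegrableOn (fun t => M.complexWeight D t * M.expFactor 0 s t) (cube L)) ∧
    AnalyticOnNhd ℂ (fun D => M.amplitude K D s) strip := by
  have hE : Measurable fun t => M.expFactor 0 s t := by
    have hp : Measurable fun t : L → ℝ => (s, t) := measurable_prodMk_left
    have := (M.measurable_expFactor 0).comp hp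
    exact this
  have h := hM.analyticOnNhd_integral (ν := volume.restrict (cube L)) measurable_id
    (ae_restrict_mem (measurableSet_cube L)) hE.aestronglyMeasurable fun ρ hρ => by
      refine Integrable.mono' (hM.integrableOn_weight hρ.1 hρ.2)
        ((M.measurable_weight ρ).mul hE.norm).aestronglyMeasurable ?_
      filter_upwards [ae_restrict_mem (measurableSet_cube L)] with t ht
      have hw := hM.weight_nonneg ρ ht
      simp only [id]
      rw [Real.norm_of_nonneg (mul_nonneg hw (norm_nonneg _))]
      exact mul_le_of_le_one_right hw (hM.norm_expFactor_le le_rfl ht (hs t ht))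
  refine ⟨h.1, ?_⟩
  simp only [amplitude_eq]
  exact analyticOnNhd_const.mul h.2

lemma sum_comm_four {α β : Type*} [Fintype α] [Fintype β] (F : α → α → β → β → ℝ) :
    ∑ a, ∑ b, ∑ e, ∑ e', F a b e e' = ∑ e, ∑ e', ∑ a, ∑ b, F a b e e' := by
  calc _ = ∑ a, ∑ e, ∑ b, ∑ e', F a b e e' := Finset.sum_congr rfl fun _ _ => Finset.sum_comm
    _ = ∑ e, ∑ a, ∑ b, ∑ e', F a b e e' := Finset.sum_comm
    _ = ∑ e, ∑ a, ∑ e', ∑ b, F a b e e' :=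
      Finset.sum_congr rfl fun _ _ => Finset.sum_congr rfl fun _ _ => Finset.sum_comm
    _ = _ := Finset.sum_congr rfl fun _ _ => Finset.sum_comm

/-! ### Positivity of the graph polynomials. -/

namespace FeynmanGraph

variable {V L : Type*} [Fintype V] [DecidableEq V] [Fintype L] [DecidableEq L]
  {G : FeynmanGraph V L} {r : V} {m : Model} {Ω θ : ℝ}

lemma HU_eq_sum : G.HU m Ω r = ∑ S : Finset (G.IntVar r),
    (∏ a, S.piecewise (G.scaledDiag r m) (G.rowScale r) a) *
      MvPolynomial.C (Matrix.of fun a => S.piecewise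
        (fun a => (1 : Matrix (G.IntVar r) (G.IntVar r) ℝ) a)
        (fun a => G.internalPhase r m Ω a) a).det := by
  have h := det_diagonal_add_mul (G.scaledDiag r m) (G.rowScale r)
    ((G.internalPhase r m Ω).map (MvPolynomial.C (σ := L)))
  refine Eq.trans ?_ (h.trans (Finset.sum_congr rfl fun S _ => ?_))
  · rfl
  · congr 1
    rw [RingHom.map_det]
    congr 1
    ext1 a b
    by_cases ha : a ∈ S
    · by_cases hab : a = b
      · subst hab; simp [ha]
      · simp [ha, hab]
    · simp [ha]

lemma coeffNonneg_scaledDiag (a : G.IntVar r) : CoeffNonneg (G.scaledDiag r m a) := by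
  rcases m with _ | _ <;> rcases a with l | l | w
  · exact coeffNonneg_one
  · exact coeffNonneg_X l
  · exact coeffNonneg_zero
  · refine (coeffNonneg_C (by norm_num)).mul (coeffNonneg_one.add ?_)
    rw [pow_two]
    exact (coeffNonneg_X l).mul (coeffNonneg_X l)
  · exact coeffNonneg_zero
  · exact coeffNonneg_zero

lemma coeffNonneg_rowScale (a : G.IntVar r) : CoeffNonneg (G.rowScale r a) := by
  rcases a with l | a
  · exact coeffNonneg_X l
  · exact coeffNonneg_one

lemma coeffNonneg_piecewise (S : Finset (G.IntVar r)) (a : G.IntVar r) :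
    CoeffNonneg (S.piecewise (G.scaledDiag r m) (G.rowScale r) a) := by
  by_cases ha : a ∈ S
  · rw [Finset.piecewise_eq_of_mem _ _ _ ha]; exact coeffNonneg_scaledDiag a
  · rw [Finset.piecewise_eq_of_notMem _ _ _ ha]; exact coeffNonneg_rowScale a

lemma coeffNonneg_term (S : Finset (G.IntVar r)) :
    CoeffNonneg ((∏ a, S.piecewise (G.scaledDiag r m) (G.rowScale r) a) *
      MvPolynomial.C (Matrix.of fun a => S.piecewise
        (fun a => (1 : Matrix (G.IntVar r) (G.IntVar r) ℝ) a)
        (fun a => G.internalPhase r m Ω a) a).det) :=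
  (coeffNonneg_prod fun a _ => coeffNonneg_piecewise S a).mul
    (coeffNonneg_C (det_piecewise_one_nonneg (internalPhase_antisymm m Ω) S))

lemma coeffNonneg_HU : CoeffNonneg (G.HU m Ω r) := fun k => by
  rw [HU_eq_sum, MvPolynomial.coeff_sum]
  exact Finset.sum_nonneg fun S _ => coeffNonneg_term S k

/-- A monomial of the factor of `a` in a nonvanishing term of `HU`. -/
noncomputable def lineExponent (G : FeynmanGraph V L) (r : V) (S : Finset (G.IntVar r)) :
    Model → G.IntVar r → L →₀ ℕ
  | .grosseWulkenhaar, .inr (.inl l) => if Sum.inr (Sum.inl l) ∈ S then Finsupp.single l 1 else 0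
  | .lsz, .inl l => if Sum.inl l ∈ S then 0 else Finsupp.single l 1
  | _, _ => 0

/-- The reduced entries mark the admissible monomials of low degree. In the Grosse-Wulkenhaar model
the row of `u_l` contributes 1, so `t_l` can only come from the row of `v_l`. In the LSZ model the
row of `u_l` contributes either `t_l` or the constant `1 / 2` of `(1 + t_l²) / 2`, and the row of
`v_l` contributes 1. -/
lemma coeff_lineExponent_pos {S : Finset (G.IntVar r)}
    (hS : ∀ a, S.piecewise (G.reducedDiag r m) (G.reducedScale r m) a ≠ 0) (a : G.IntVar r) :
    0 < (S.piecewise (G.scaledDiag r m) (G.rowScale r) a).coeff (G.lineExponent r S m a) := by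
  have h := hS a
  rcases m with _ | _ <;> rcases a with l | l | w
  · by_cases ha : (Sum.inl l : G.IntVar r) ∈ S
    · simp [ha, scaledDiag, lineExponent]
    · simp [ha, reducedScale] at h
  · by_cases ha : (Sum.inr (Sum.inl l) : G.IntVar r) ∈ S
    · simp [ha, scaledDiag, lineExponent, MvPolynomial.coeff_X]
    · simp [ha, rowScale, lineExponent]
  · by_cases ha : (Sum.inr (Sum.inr w) : G.IntVar r) ∈ S
    · simp [ha, reducedDiag] at h
    · simp [ha, rowScale, lineExponent]
  · by_cases ha : (Sum.inl l : G.IntVar r) ∈ S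
    · have h2 := ((coeffNonneg_X l).mul (coeffNonneg_X l)) 0
      rw [← pow_two] at h2
      simp only [ha, Finset.piecewise_eq_of_mem, scaledDiag, lineExponent, if_true,
        MvPolynomial.coeff_C_mul, MvPolynomial.coeff_add, MvPolynomial.coeff_zero_one]
      linarith
    · simp [ha, rowScale, lineExponent, MvPolynomial.coeff_X]
  · by_cases ha : (Sum.inr (Sum.inl l) : G.IntVar r) ∈ S
    · simp [ha, reducedDiag] at h
    · simp [ha, rowScale, lineExponent]
  · by_cases ha : (Sum.inr (Sum.inr w) : G.IntVar r) ∈ S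
    · simp [ha, reducedDiag] at h
    · simp [ha, rowScale, lineExponent]

lemma sum_lineExponent_le (S : Finset (G.IntVar r)) (l : L) :
    (∑ a, G.lineExponent r S m a) l ≤ 1 := by
  have hs : ∀ (p : L → Prop) [DecidablePred p],
      (∑ l', (if p l' then Finsupp.single l' 1 else (0 : L →₀ ℕ))) l ≤ 1 := by
    intro p _
    rw [Finsupp.finsetSum_apply, Finset.sum_eq_single l]
    · split_ifs <;> simp
    · intro l' _ hl'
      split_ifs <;> simp [hl']
    · intro h; exact absurd (Finset.mem_univ l) h
  rcases m with _ | _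
  · simp only [Fintype.sum_sum_type, lineExponent, Finset.sum_const_zero, zero_add, add_zero]
    exact hs _
  · simp only [Fintype.sum_sum_type, lineExponent, Finset.sum_const_zero, add_zero]
    simpa only [ite_not] using hs fun l' => (Sum.inl l' : G.IntVar r) ∉ S

/-- Invertibility of the reduced matrix yields a set `S` whose term in its expansion is nonzero. The
same `S` gives a term of `HU` with a square-free monomial of positive coefficient, and since all
terms have nonnegative coefficients it cannot cancel. -/
theorem exists_squarefree_coeff_pos (hG : G.Connected) (hΩ : 0 < Ω) (hΩ1 : m = .lsz → Ω ≠ 1) :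
    ∃ k, (∀ l, k l ≤ 1) ∧ 0 < (G.HU m Ω r).coeff k := by
  obtain ⟨S, hS, hdet⟩ := exists_piecewise_ne_zero (d := G.reducedDiag r m)
    (ρ := G.reducedScale r m) (B := G.internalPhase r m Ω) fun z hz => by
      cases m
      · exact eq_zero_of_grosseWulkenhaar hG Ω hz
      · exact eq_zero_of_lsz hG hΩ (hΩ1 rfl) hz
  refine ⟨∑ a, G.lineExponent r S m a, sum_lineExponent_le S, ?_⟩
  rw [HU_eq_sum, MvPolynomial.coeff_sum]
  refine Finset.sum_pos' (fun S _ => coeffNonneg_term S _) ⟨S, Finset.mem_univ S, ?_⟩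
  rw [mul_comm, MvPolynomial.coeff_C_mul, mul_comm]
  exact mul_pos (coeff_prod_pos (coeffNonneg_piecewise S) (coeff_lineExponent_pos hS))
    (lt_of_le_of_ne (det_piecewise_one_nonneg (internalPhase_antisymm m Ω) S) hdet.symm)

theorem admissible_monomialData (hG : G.Connected) (hΩ : 0 < Ω) (hΩ1 : m = .lsz → Ω ≠ 1) :
    (G.monomialData m Ω θ r).Admissible where
  pos k := lt_of_le_of_ne (coeffNonneg_HU (k : L →₀ ℕ)) (MvPolynomial.mem_support_iff.1 k.2).symm
  exists_squarefree := by
    obtain ⟨k, hk, hpos⟩ := exists_squarefree_coeff_pos (r := r) hG hΩ hΩ1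
    exact ⟨⟨k, MvPolynomial.mem_support_iff.2 hpos.ne'⟩, hk⟩

lemma monomialData_U (t : L → ℝ) :
    (G.monomialData m Ω θ r).U t = MvPolynomial.eval t (G.HU m Ω r) := by
  rw [MvPolynomial.eval_eq', MonomialData.U]
  exact (Finset.sum_subtype _ (fun _ => Iff.rfl)
    fun k => (G.HU m Ω r).coeff k * ∏ l, t l ^ k l).symm

/-- Collecting monomials in a linear combination of polynomials. -/
lemma sum_eval_mul_eq {ι : Type*} [Fintype ι] (p : ι → ι → MvPolynomial L ℝ) (c : ι → ι → ℝ)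
    {q : (L →₀ ℕ) → Prop} [Fintype {k // q k}] (hq : ∀ i j, ∀ k ∈ (p i j).support, q k)
    (t : L → ℝ) :
    ∑ i, ∑ j, MvPolynomial.eval t (p i j) * c i j =
      ∑ k : {k // q k}, (∑ i, ∑ j, (p i j).coeff k * c i j) * ∏ l, t l ^ (k : L →₀ ℕ) l := by
  simp only [Finset.sum_mul]
  conv_rhs => rw [Finset.sum_comm]
  refine Finset.sum_congr rfl fun i _ => ?_
  conv_rhs => rw [Finset.sum_comm]
  refine Finset.sum_congr rfl fun j _ => ?_
  rw [MvPolynomial.eval_eq', Finset.sum_mul]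
  refine Finset.sum_bij_ne_zero (fun k hk _ => ⟨k, hq i j k hk⟩) (fun _ _ _ => Finset.mem_univ _)
    (fun _ _ _ _ _ _ h => congrArg Subtype.val h) (fun k _ hk => ?_) fun _ _ _ => by ring
  have h0 : (p i j).coeff k ≠ 0 := fun h0 => hk (by rw [h0]; ring)
  exact ⟨k, MvPolynomial.mem_support_iff.2 h0, fun h => hk (by rw [← h]; ring), rfl⟩

lemma eval_HVR_eq (x : G.ExtVar → Fin 4 → ℝ) (t : L → ℝ) :
    ∑ e, ∑ e', MvPolynomial.eval t (G.HVR m Ω θ r e e') * dot (x e) (x e') =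
      ∑ k, G.invariantR m Ω θ r x k * ∏ l, t l ^ (G.monomialData m Ω θ r).vR k l :=
  sum_eval_mul_eq (G.HVR m Ω θ r) (fun e e' => dot (x e) (x e'))
    (fun i j _ hk => Finset.mem_biUnion.2 ⟨(i, j), Finset.mem_univ _, hk⟩) t

lemma eval_HVI_eq (x : G.ExtVar → Fin 4 → ℝ) (t : L → ℝ) :
    ∑ e, ∑ e', MvPolynomial.eval t (G.HVI m Ω θ r e e') * wedge (x e) (x e') =
      ∑ k, G.invariantI m Ω θ r x k * ∏ l, t l ^ (G.monomialData m Ω θ r).vI k l :=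
  sum_eval_mul_eq (G.HVI m Ω θ r) (fun e e' => wedge (x e) (x e'))
    (fun i j _ hk => Finset.mem_biUnion.2 ⟨(i, j), Finset.mem_univ _, hk⟩) t

lemma monomialData_V (x : G.ExtVar → Fin 4 → ℝ) (t : L → ℝ) :
    (G.monomialData m Ω θ r).V (G.invariantR m Ω θ r x, G.invariantI m Ω θ r x) t =
      G.HV m Ω θ r x t := by
  rw [MonomialData.V, HV, eval_HVR_eq, eval_HVI_eq]

lemma amplitude_eq_monomialData (K D : ℂ) (x : G.ExtVar → Fin 4 → ℝ) :
    G.amplitude m Ω θ r K D x = (G.monomialData m Ω θ r).amplitude K D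
      (G.invariantR m Ω θ r x, G.invariantI m Ω θ r x) := by
  simp only [amplitude, MonomialData.amplitude, parametricIntegrand, monomialData_U, monomialData_V]

lemma parametricIntegrand_eq (D : ℂ) (x : G.ExtVar → Fin 4 → ℝ) :
    G.parametricIntegrand m Ω θ r D x = fun t => (G.monomialData m Ω θ r).complexWeight D t *
      (G.monomialData m Ω θ r).expFactor 0 (G.invariantR m Ω θ r x, G.invariantI m Ω θ r x) t := by
  funext t
  simp only [parametricIntegrand, MonomialData.complexWeight, MonomialData.expFactor, monomialData_U,
    monomialData_V, Complex.ofReal_zero, zero_mul, add_zero]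

lemma eval_scaledDiag_nonneg {t : L → ℝ} (ht : ∀ l, 0 < t l) (a : G.IntVar r) :
    0 ≤ MvPolynomial.eval t (G.scaledDiag r m a) := by
  rcases m with _ | _ <;> rcases a with l | l | w <;> simp [scaledDiag, (ht _).le]
  positivity

lemma eval_rowScale_pos {t : L → ℝ} (ht : ∀ l, 0 < t l) (a : G.IntVar r) :
    0 < MvPolynomial.eval t (G.rowScale r a) := by
  rcases a with l | a <;> simp [rowScale, ht]

lemma eval_scaledMatrix (t : L → ℝ) : (G.scaledMatrix m Ω r).map (MvPolynomial.eval t) =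
    Matrix.diagonal (fun a => MvPolynomial.eval t (G.scaledDiag r m a)) +
      Matrix.of fun a b => MvPolynomial.eval t (G.rowScale r a) * G.internalPhase r m Ω a b := by
  ext a b
  by_cases hab : a = b
  · subst hab; simp [scaledMatrix, internalPhase]
  · simp [scaledMatrix, internalPhase, hab]

/-- A quadratic form sees only the symmetric part, so `HVR` may be replaced by `schurMatrix`. The
antisymmetric external block drops out, and what is left is the quadratic form of `HU (A + B)⁻¹` at
the vector `Wᵀ y`. -/
lemma sum_HVR_mul_nonneg (hΩθ : 0 ≤ Ω / θ) {t : L → ℝ} (ht : ∀ l, 0 < t l)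
    (hU : 0 < MvPolynomial.eval t (G.HU m Ω r)) (y : G.ExtVar → ℝ) :
    0 ≤ ∑ e, ∑ e', MvPolynomial.eval t (G.HVR m Ω θ r e e') * (y e * y e') := by
  set N := Matrix.diagonal (fun a => MvPolynomial.eval t (G.scaledDiag r m a)) +
      Matrix.of fun a b => MvPolynomial.eval t (G.rowScale r a) * G.internalPhase r m Ω a b with hN
  have hdet : MvPolynomial.eval t (G.HU m Ω r) = N.det := by
    rw [HU, RingHom.map_det, RingHom.mapMatrix_apply, eval_scaledMatrix]
  have hadj : ∀ a b, MvPolynomial.eval t (G.HUinverse m Ω r a b) =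
      N.adjugate a b * MvPolynomial.eval t (G.rowScale r b) := by
    intro a b
    rw [HUinverse, Matrix.mul_diagonal, map_mul]
    congr 1
    have h := RingHom.map_adjugate (MvPolynomial.eval t) (G.scaledMatrix m Ω r)
    rw [RingHom.mapMatrix_apply, RingHom.mapMatrix_apply, eval_scaledMatrix] at h
    exact congrFun (congrFun h a) b
  set w : G.IntVar r → ℝ := fun a => ∑ e, G.phaseMatrix m Ω r (Sum.inr e) (Sum.inl a) * y e with hw
  have hq := adjugate_quadratic_nonneg (eval_scaledDiag_nonneg (G := G) (r := r) (m := m) ht)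
    (eval_rowScale_pos (G := G) (r := r) ht) (internalPhase_antisymm m Ω) (by rwa [← hdet]) w
  have hext : ∑ e, ∑ e', G.phaseMatrix m Ω r (Sum.inr e) (Sum.inr e') * (y e * y e') = 0 := by
    have h := dotProduct_mulVec_self_of_antisymm (B := Matrix.of fun e e' : G.ExtVar =>
      G.phaseMatrix m Ω r (Sum.inr e) (Sum.inr e')) (fun a b => G.phaseMatrix_antisymm r m Ω _ _) y
    rw [← h]
    refine Finset.sum_congr rfl fun e _ => ?_
    rw [Matrix.mulVec, dotProduct, Finset.mul_sum]
    exact Finset.sum_congr rfl fun e' _ => by rw [Matrix.of_apply]; ring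
  have hschur : ∀ e e', MvPolynomial.eval t (G.schurMatrix m Ω θ r e e') = Ω / θ *
      ((∑ a, ∑ b, G.phaseMatrix m Ω r (Sum.inr e) (Sum.inl a) * (N.adjugate a b *
        MvPolynomial.eval t (G.rowScale r b)) * G.phaseMatrix m Ω r (Sum.inr e') (Sum.inl b)) +
        N.det * G.phaseMatrix m Ω r (Sum.inr e) (Sum.inr e')) := by
    intro e e'
    simp only [schurMatrix, Matrix.of_apply, map_mul, map_add, map_sum, MvPolynomial.eval_C, hadj, hdet]
  have hsym : ∑ e, ∑ e', MvPolynomial.eval t (G.HVR m Ω θ r e e') * (y e * y e') =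
      ∑ e, ∑ e', MvPolynomial.eval t (G.schurMatrix m Ω θ r e e') * (y e * y e') := by
    have h1 : ∑ e, ∑ e', MvPolynomial.eval t (G.schurMatrix m Ω θ r e' e) * (y e * y e') =
        ∑ e, ∑ e', MvPolynomial.eval t (G.schurMatrix m Ω θ r e e') * (y e * y e') := by
      rw [Finset.sum_comm]
      exact Finset.sum_congr rfl fun e _ => Finset.sum_congr rfl fun e' _ => by ring
    have h2 : ∑ e, ∑ e', MvPolynomial.eval t (G.HVR m Ω θ r e e') * (y e * y e') =
        1 / 2 * (∑ e, ∑ e', MvPolynomial.eval t (G.schurMatrix m Ω θ r e e') * (y e * y e') +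
          ∑ e, ∑ e', MvPolynomial.eval t (G.schurMatrix m Ω θ r e' e) * (y e * y e')) := by
      simp only [← Finset.sum_add_distrib, Finset.mul_sum]
      refine Finset.sum_congr rfl fun e _ => Finset.sum_congr rfl fun e' _ => ?_
      simp only [HVR, Matrix.of_apply, map_mul, map_add, MvPolynomial.eval_C]
      ring
    rw [h2, h1]; ring
  have hmain : ∑ e, ∑ e', MvPolynomial.eval t (G.schurMatrix m Ω θ r e e') * (y e * y e') =
      Ω / θ * ((∑ a, ∑ b, w a * (N.adjugate a b * MvPolynomial.eval t (G.rowScale r b)) * w b) +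
        N.det * ∑ e, ∑ e', G.phaseMatrix m Ω r (Sum.inr e) (Sum.inr e') * (y e * y e')) := by
    have e1 : ∑ a, ∑ b, w a * (N.adjugate a b * MvPolynomial.eval t (G.rowScale r b)) * w b =
        ∑ e, ∑ e', (∑ a, ∑ b, G.phaseMatrix m Ω r (Sum.inr e) (Sum.inl a) * (N.adjugate a b *
        MvPolynomial.eval t (G.rowScale r b)) * G.phaseMatrix m Ω r (Sum.inr e') (Sum.inl b)) *
        (y e * y e') := by
      have e2 : ∀ a b, w a * (N.adjugate a b * MvPolynomial.eval t (G.rowScale r b)) * w b =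
          ∑ e, ∑ e', G.phaseMatrix m Ω r (Sum.inr e) (Sum.inl a) * (N.adjugate a b *
          MvPolynomial.eval t (G.rowScale r b)) * G.phaseMatrix m Ω r (Sum.inr e') (Sum.inl b) *
          (y e * y e') := by
        intro a b
        rw [mul_right_comm, hw, Finset.sum_mul_sum, Finset.sum_mul]
        refine Finset.sum_congr rfl fun e _ => ?_
        rw [Finset.sum_mul]
        exact Finset.sum_congr rfl fun e' _ => by ring
      simp only [e2]
      rw [sum_comm_four]
      refine Finset.sum_congr rfl fun e _ => Finset.sum_congr rfl fun e' _ => ?_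
      rw [Finset.sum_mul]
      exact Finset.sum_congr rfl fun a _ => by rw [Finset.sum_mul]
    rw [e1, Finset.mul_sum, ← Finset.sum_add_distrib, Finset.mul_sum]
    refine Finset.sum_congr rfl fun e _ => ?_
    rw [Finset.mul_sum, ← Finset.sum_add_distrib, Finset.mul_sum]
    refine Finset.sum_congr rfl fun e' _ => ?_
    rw [hschur]
    ring
  rw [hsym, hmain, hext, mul_zero, add_zero]
  exact mul_nonneg hΩθ hq

theorem sum_HVR_dot_nonneg (hΩθ : 0 ≤ Ω / θ) {t : L → ℝ} (ht : ∀ l, 0 < t l)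
    (hU : 0 < MvPolynomial.eval t (G.HU m Ω r)) (x : G.ExtVar → Fin 4 → ℝ) :
    0 ≤ ∑ e, ∑ e', MvPolynomial.eval t (G.HVR m Ω θ r e e') * dot (x e) (x e') := by
  have h : ∑ e, ∑ e', MvPolynomial.eval t (G.HVR m Ω θ r e e') * dot (x e) (x e') =
      ∑ μ, ∑ e, ∑ e', MvPolynomial.eval t (G.HVR m Ω θ r e e') * (x e μ * x e' μ) := by
    simp only [dot, Finset.mul_sum]
    conv_rhs => rw [Finset.sum_comm]
    exact Finset.sum_congr rfl fun e _ => Finset.sum_comm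
  rw [h]
  exact Finset.sum_nonneg fun μ _ => sum_HVR_mul_nonneg hΩθ ht hU fun e => x e μ

/-- Convergence and analyticity of the parametric integral at an external configuration. -/
theorem analyticOnNhd_amplitude (hG : G.Connected) (hΩ : 0 < Ω) (hΩ1 : m = .lsz → Ω ≠ 1)
    (hθ : 0 < θ) (K : ℂ) (x : G.ExtVar → Fin 4 → ℝ) :
    (∀ D ∈ strip, IntegrableOn (G.parametricIntegrand m Ω θ r D x) (cube L)) ∧
    AnalyticOnNhd ℂ (fun D => G.amplitude m Ω θ r K D x) strip := by
  have hM := admissible_monomialData (θ := θ) (r := r) hG hΩ hΩ1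
  have h := hM.analyticOnNhd_amplitude K (s := (G.invariantR m Ω θ r x, G.invariantI m Ω θ r x))
    fun t ht => (sum_HVR_dot_nonneg (by positivity) (pos_of_mem_cube ht)
      (by rw [← monomialData_U (θ := θ)]; exact hM.U_pos ht) x).trans_eq (eval_HVR_eq x t)
  refine ⟨fun D hD => ?_, ?_⟩
  · rw [parametricIntegrand_eq]; exact h.1 D hD
  · simp only [amplitude_eq_monomialData]
    exact h.2

end FeynmanGraph

end NCQFT

end

theorem mainTheorem1 {V L : Type*} [Fintype V] [DecidableEq V] [Fintype L] [DecidableEq L]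
    (G : NCQFT.FeynmanGraph V L) (hG : G.Connected) (m : NCQFT.Model) (Ω θ : ℝ)
    (hΩ : 0 < Ω) (hΩ1 : m = NCQFT.Model.lsz → Ω ≠ 1) (hθ : 0 < θ) (r : V) (K : ℂ) :
    -- at each external configuration the amplitude is an analytic function of `D` in the strip,
    -- and it depends on the configuration through the external invariants only
    (∀ x : G.ExtVar → Fin 4 → ℝ,
      (∀ D ∈ NCQFT.strip, MeasureTheory.IntegrableOn (G.parametricIntegrand m Ω θ r D x)
        (Set.univ.pi fun _ : L => Set.Ioo (0 : ℝ) 1)) ∧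
      AnalyticOnNhd ℂ (fun D => G.amplitude m Ω θ r K D x) NCQFT.strip ∧
      ∀ D ∈ NCQFT.strip, G.amplitude m Ω θ r K D x =
        (G.monomialData m Ω θ r).amplitude K D
          (G.invariantR m Ω θ r x, G.invariantI m Ω θ r x)) ∧
    -- the amplitude as a tempered distribution of the external invariants
    ∃ T : ℂ → 𝓢'((G.KR m Ω θ r → ℝ) × (G.KI m Ω θ r → ℝ), ℂ),
      (∀ D ∈ NCQFT.strip, ∀ f,
        MeasureTheory.IntegrableOn (fun s => f s * (G.monomialData m Ω θ r).amplitude K D s)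
          (G.monomialData m Ω θ r).invariantDomain ∧
        T D f = ∫ s in (G.monomialData m Ω θ r).invariantDomain,
          f s * (G.monomialData m Ω θ r).amplitude K D s) ∧
      -- it is analytic in the strip
      (∀ f, AnalyticOnNhd ℂ (fun D => T D f) NCQFT.strip) ∧
      -- in the strip it is given by the Mellin representation
      ∀ D ∈ NCQFT.strip,
        ((G.monomialData m Ω θ r).Delta D).Nonempty ∧
        Convex ℝ ((G.monomialData m Ω θ r).Delta D) ∧
        ∀ q ∈ (G.monomialData m Ω θ r).Delta D, ∀ k₀ : G.KU m Ω r, ∀ f,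
          (∀ (ηR : G.KR m Ω θ r → ℝ) (ηI : G.KI m Ω θ r → ℝ),
            MeasureTheory.IntegrableOn
              ((G.monomialData m Ω θ r).smearedPower f
                (NCQFT.MonomialData.line q.2.1 ηR) (NCQFT.MonomialData.line q.2.2 ηI))
              (G.monomialData m Ω θ r).invariantDomain) ∧
          MeasureTheory.Integrable ((G.monomialData m Ω θ r).contourIntegrand D f q k₀) ∧
          T D f = K * ∫ η, (G.monomialData m Ω θ r).contourIntegrand D f q k₀ η := by
  have hM := NCQFT.FeynmanGraph.admissible_monomialData (θ := θ) (r := r) hG hΩ hΩ1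
  refine ⟨fun x => ?_, hM.mellin_representation K⟩
  obtain ⟨h1, h2⟩ := NCQFT.FeynmanGraph.analyticOnNhd_amplitude (r := r) hG hΩ hΩ1 hθ K x
  exact ⟨h1, h2, fun D _ => NCQFT.FeynmanGraph.amplitude_eq_monomialData K D x⟩
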